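/- Let $\mathfrak A$ be a commutative topological ring with $1$, separated and sequentially complete, whose topology is induced by a family of functions $p:\mathfrak A\to[0,\infty)$ with $p(0)=0$, $p(-X)=p(X)$, $p(X+Y)\le p(X)+p(Y)$, such that for every $p$ in the family there is $\tilde p$ in the family with $p(X_1\cdots X_n)\le\tilde p(X_1)\cdots\tilde p(X_n)$ for all $n\ge1$. Let $\mathfrak A[z^{-1},z]$ be the topological ring of Laurent series $\sum_n a_nz^n$ for which $p(a_n)(1+|n|)^k$ is bounded for every $p$ and every $k\in\mathbb N$, and let $a=a(z)=\sum a_nz^n$ be a unit of it. Notation. $\mathsf U(a)=(a_{n-m})_{n,m\in\mathbb Z}$; $\mathsf U_{1/2}(a)$ is the same matrix with $n,m\in\mathbb Z+\frac12$. $\mathbf 1_S$ is the diagonal matrix with ones at the indices in $S$; $\mathbb Z^\pm$ are the positive/negative integers, and $\mathbf 1_{+},\mathbf 1_{-}$ are the corresponding matrices for positive/negative half-integers. $w$ is a Laurent variable (matrices below have entries in $\mathfrak A[w^{-1},w]$) and $t$ a formal power series variable. Put $$\mathsf F^{+}(t,w)=\mathbf 1_{\mathbb Z}-tw\,\mathbf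 1_{\mathbb Z^-}\mathsf U(z^{-1}),\qquad \mathsf F^{-}(t,w)=\mathbf 1_{\mathbb Z}-tw^{-1}\,\mathbf 1_{\mathbb Z^+}\mathsf U(z),\qquad \mathsf U^{\pm}(a,t,w)=\mathsf F^{\pm}(t,w)\,\mathsf U(a)\,\mathsf F^{\pm}(t,w)^{-1}.$$ The entries of $\mathsf U^\pm(a,t,w)$ are power series in $t$ into which $t=1$ can be substituted. Let $\widetilde{\mathsf U}(a,w)$ be the $\mathbb Z\times\mathbb Z$ matrix whose $0$th row and column are those of the identity matrix and whose $(n,m)$ entry, for $n,m\ne0$, is $a_{n-m}$ if $nm>0$, $-w\,a_{n-m+1}$ if $n<0<m$, and $-w^{-1}a_{n-m-1}$ if $m<0<n$; its inverse is $\widetilde{\mathsf U}(a^{-1},w)$. For an infinite matrix $M$, $\det M$ (also written $\widetilde{\det}\,M$) is $\sum_\sigma\operatorname{sgn}(\sigma)\prod_s M_{s,\sigma(s)}$ over all permutations $\sigma$ of the index set that move only finitely many indices. The projections to the strictly holomorphic, strictly antiholomorphic and orthogonal parts are given (with $w$ in place of $z$) by $$\pi^{\pm}(a,1,w)=\det\bigl(\mathsf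 U^{\pm}(a,1,w)\,\mathsf U(a)^{-1}\bigr),\qquad \tilde\pi(a,w)=\det\bigl(\mathsf U(a)\,\widetilde{\mathsf U}(a,w)^{-1}\bigr).$$ Proposition. All products and sums in the determinants in the definitions above and in (1)–(3) below converge unconditionally, and: (1) $\pi^+(a,1,w)=\widetilde{\det}\bigl(\mathsf U(a^{-1})\mathsf F^{+}(1,w)\mathsf U(a)\bigr)=\widetilde{\det}\bigl(\mathbf 1_{\mathbb Z}-w\,\mathsf U(a^{-1})\mathbf 1_{\mathbb Z^-}\mathsf U(a)\mathsf U(z^{-1})\bigr)$. (2) $\pi^-(a,1,w)=\widetilde{\det}\bigl(\mathsf U(a^{-1})\mathsf F^{-}(1,w)\mathsf U(a)\bigr)=\widetilde{\det}\bigl(\mathbf 1_{\mathbb Z}-w^{-1}\,\mathsf U(a^{-1})\mathbf 1_{\mathbb Z^+}\mathsf U(a)\mathsf U(z)\bigr)$. (3) $\tilde\pi(a,w)=\det\bigl(\mathsf U(a)\widetilde{\mathsf U}(a,1)^{-1}\bigr)\cdot\det\bigl(\mathsf U_{1/2}(a^{-1})\,(w\mathbf 1_{-}+\mathbf 1_{+})^{-1}\,\mathsf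 U_{1/2}(a)\,(w\mathbf 1_{-}+\mathbf 1_{+})\bigr)$. (4) Suppose that $a$ is finite, say $p,q\in\mathbb N$ and $a_n=0$ unless $-p\le n\le q$. Then $\mathsf U(a^{-1})\mathbf 1_{\mathbb Z^-}\mathsf U(a)$ agrees with $\mathbf 1_{\mathbb Z^-}$ outside the columns $-q\le m<p$, and $\mathsf U(a^{-1})\mathbf 1_{\mathbb Z^+}\mathsf U(a)$ agrees with $\mathbf 1_{\mathbb Z^+}$ outside the columns $-q<m\le p$. The determinants reduce to finite ones: writing $M_S$ for the $S\times S$ block of $M$, $$\pi^+(a,1,w)=\det(\mathbf 1_S-wB),\quad S=\{m\in\mathbb Z:-q<m\le p\},\ B=\bigl(\mathsf U(a^{-1})\mathbf 1_{\mathbb Z^-}\mathsf U(a)\mathsf U(z^{-1})\bigr)_S,$$ $$\pi^-(a,1,w)=\det(\mathbf 1_{S}-w^{-1}B),\quad S=\{m\in\mathbb Z:-q\le m<p\},\ B=\bigl(\mathsf U(a^{-1})\mathbf 1_{\mathbb Z^+}\mathsf U(a)\mathsf U(z)\bigr)_{S};$$ the first factor in (3) is the determinant of the block of $\mathsf U(a)\widetilde{\mathsf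 U}(a,1)^{-1}$ with indices $-p\le n\le q$, and the second factor is $w^{q}\det\bigl(\mathbf 1_S-(1-w^{-1})B\bigr)$ with $S=\{s\in\mathbb Z+\frac12:-q<s<p\}$ and $B=\bigl(\mathsf U_{1/2}(a^{-1})\mathbf 1_{-}\mathsf U_{1/2}(a)\bigr)_S$. -/

import Mathlib

open Filter Topology
open scoped PowerSeries.WithPiTopology

noncomputable section

namespace WienerHopf

universe u

/-! ### Strong polymetric rings -/

/-- The topology induced by a family of (additive group) seminorms. -/
@[reducible] def seminormTopology {A : Type u} [AddCommGroup A] (S : Set (AddGroupSeminorm A)) :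
    TopologicalSpace A :=
  ⨅ p : S, p.1.toSeminormedAddCommGroup.toUniformSpace.toTopologicalSpace

/-- A commutative strong polymetric ring: the topology is induced by a family of functions `p` with
`p 0 = 0`, `p (-x) = p x`, `p (x + y) ≤ p x + p y`, and for every `p` in the family there is a `q`
in the family with `p (x₁ ⋯ xₙ) ≤ q x₁ ⋯ q xₙ` for all `n ≥ 1`. -/
class StrongPolymetricRing (A : Type u) [CommRing A] [TopologicalSpace A] extends
    IsTopologicalRing A where
  seminorms : Set (AddGroupSeminorm A)
  topology_eq : ‹TopologicalSpace A› = seminormTopology seminorms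
  strong : ∀ p ∈ seminorms, ∃ q ∈ seminorms, ∀ l : List A, l ≠ [] → p l.prod ≤ (l.map q).prod

open StrongPolymetricRing (seminorms)

/-- Sequential completeness: every Cauchy sequence converges. -/
class SequentiallyComplete (A : Type u) [CommRing A] [TopologicalSpace A]
    [StrongPolymetricRing A] : Prop where
  exists_lim : ∀ x : ℕ → A,
    (∀ p ∈ seminorms (A := A), ∀ ε > 0, ∃ N, ∀ m ≥ N, ∀ n ≥ N, p (x m - x n) < ε) →
      ∃ y, Tendsto x atTop (𝓝 y)

section Basic

lemma seminormTopology_nhds {A : Type u} [AddCommGroup A] (S : Set (AddGroupSeminorm A)) (x : A) :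
    @nhds A (seminormTopology S) x = ⨅ p : S, comap (fun y => p.1 (y - x)) (𝓝 0) := by
  unfold seminormTopology
  rw [nhds_iInf]
  refine iInf_congr fun p => ?_
  let := p.1.toSeminormedAddCommGroup
  rw [← nhds_comap_dist x]
  congr 1
  funext y
  rw [dist_eq_norm]
  rfl

lemma seminormTopology_addGroup {A : Type u} [AddCommGroup A] (S : Set (AddGroupSeminorm A)) :
    @IsTopologicalAddGroup A (seminormTopology S) _ := by
  unfold seminormTopology
  refine topologicalAddGroup_iInf fun p => ?_
  let := p.1.toSeminormedAddCommGroup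
  infer_instance

lemma seminormTopology_tendsto {A : Type u} [AddCommGroup A] (S : Set (AddGroupSeminorm A))
    {α : Type*} (l : Filter α) (f : α → A) (x : A) :
    Tendsto f l (@nhds A (seminormTopology S) x) ↔
      ∀ p ∈ S, Tendsto (fun a => p (f a - x)) l (𝓝 0) := by
  rw [seminormTopology_nhds, tendsto_iInf]
  simp only [tendsto_comap_iff, Subtype.forall, Function.comp_def]

variable {A : Type u} [CommRing A] [TopologicalSpace A] [StrongPolymetricRing A]

lemma tendsto_iff_seminorms {α : Type*} (l : Filter α) (f : α → A) (x : A) :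
    Tendsto f l (𝓝 x) ↔ ∀ p ∈ seminorms (A := A), Tendsto (fun a => p (f a - x)) l (𝓝 0) := by
  rw [← seminormTopology_tendsto, ← StrongPolymetricRing.topology_eq]

lemma strong_mul (p : AddGroupSeminorm A) (hp : p ∈ seminorms (A := A)) :
    ∃ q ∈ seminorms (A := A), ∀ x y, p (x * y) ≤ q x * q y := by
  obtain ⟨q, hq, h⟩ := StrongPolymetricRing.strong p hp
  refine ⟨q, hq, fun x y => ?_⟩
  simpa using h [x, y] (by simp)

lemma seminorm_sum_le {β : Type*} (p : AddGroupSeminorm A) (f : β → A) (s : Finset β) :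
    p (∑ i ∈ s, f i) ≤ ∑ i ∈ s, p (f i) := by
  classical
  induction s using Finset.induction_on with
  | empty => simp
  | insert a s ha ih =>
    rw [Finset.sum_insert ha, Finset.sum_insert ha]
    exact (map_add_le_add p _ _).trans (by gcongr)

lemma summable_of_seminorms [SequentiallyComplete A] {β : Type*} [Countable β] {f : β → A}
    (hf : ∀ p ∈ seminorms (A := A), Summable fun i => p (f i)) : Summable f := by
  classical
  obtain ⟨s, hs⟩ := Filter.exists_seq_tendsto (atTop : Filter (Finset β))
  have key : ∀ p ∈ seminorms (A := A), ∀ ε > 0, ∃ T : Finset β, ∀ U, T ⊆ U → ∀ V, T ⊆ V →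
      p (∑ i ∈ U, f i - ∑ i ∈ V, f i) < ε := by
    intro p hp ε hε
    obtain ⟨T, hT⟩ := (summable_iff_vanishing_norm.1 (hf p hp)) (ε / 2) (by positivity)
    have aux : ∀ U, T ⊆ U → p (∑ i ∈ U, f i - ∑ i ∈ T, f i) < ε / 2 := by
      intro U hU
      rw [← Finset.sum_sdiff hU, add_sub_cancel_right]
      refine (seminorm_sum_le p f _).trans_lt ?_
      exact (le_abs_self _).trans_lt (hT _ Finset.sdiff_disjoint)
    refine ⟨T, fun U hU V hV => ?_⟩
    have e : ∑ i ∈ U, f i - ∑ i ∈ V, f i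
        = (∑ i ∈ U, f i - ∑ i ∈ T, f i) - (∑ i ∈ V, f i - ∑ i ∈ T, f i) := by abel
    rw [e]
    have := map_sub_le_add p (∑ i ∈ U, f i - ∑ i ∈ T, f i) (∑ i ∈ V, f i - ∑ i ∈ T, f i)
    linarith [aux U hU, aux V hV]
  obtain ⟨y, hy⟩ := SequentiallyComplete.exists_lim (fun n => ∑ i ∈ s n, f i) (by
    intro p hp ε hε
    obtain ⟨T, hT⟩ := key p hp ε hε
    obtain ⟨N, hN⟩ := eventually_atTop.1 (hs.eventually_ge_atTop T)
    exact ⟨N, fun m hm n hn => hT _ (hN m hm) _ (hN n hn)⟩)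
  refine ⟨y, ?_⟩
  rw [HasSum, SummationFilter.unconditional_filter, tendsto_iff_seminorms]
  intro p hp
  rw [Metric.tendsto_nhds]
  intro ε hε
  obtain ⟨T, hT⟩ := key p hp (ε / 2) (by positivity)
  have h1 := (tendsto_iff_seminorms _ _ _).1 hy p hp
  rw [Metric.tendsto_nhds] at h1
  obtain ⟨n, hn1, hn2⟩ := ((h1 (ε / 2) (by positivity)).and (hs.eventually_ge_atTop T)).exists
  filter_upwards [eventually_ge_atTop T] with U hU
  rw [Real.dist_eq, sub_zero, abs_of_nonneg (apply_nonneg p _)] at hn1 ⊢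
  have e : ∑ i ∈ U, f i - y = (∑ i ∈ U, f i - ∑ i ∈ s n, f i) + (∑ i ∈ s n, f i - y) := by abel
  rw [e]
  have := map_add_le_add p (∑ i ∈ U, f i - ∑ i ∈ s n, f i) (∑ i ∈ s n, f i - y)
  linarith [hT U hU _ hn2]

lemma seminorm_tsum_le {β : Type*} (p : AddGroupSeminorm A)
    (hp : p ∈ seminorms (A := A)) {f : β → A} (hs : Summable f)
    (hf : Summable fun i => p (f i)) : p (∑' i, f i) ≤ ∑' i, p (f i) := by
  have h := (tendsto_iff_seminorms _ _ _).1 hs.hasSum p hp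
  rw [SummationFilter.unconditional_filter] at h
  have h2 : Tendsto (fun s : Finset β => p (∑ i ∈ s, f i - ∑' i, f i) + ∑ i ∈ s, p (f i)) atTop
      (𝓝 (∑' i, p (f i))) := by
    simpa using h.add hf.hasSum
  refine le_of_tendsto_of_tendsto' (f := fun _ => p (∑' i, f i)) tendsto_const_nhds h2 fun s => ?_
  have e : ∑' i, f i = - (∑ i ∈ s, f i - ∑' i, f i) + ∑ i ∈ s, f i := by abel
  have h1 := map_add_le_add p (- (∑ i ∈ s, f i - ∑' i, f i)) (∑ i ∈ s, f i)
  rw [← e, map_neg_eq_map] at h1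
  linarith [seminorm_sum_le p f s]

end Basic

/-! ### Rapidly decreasing Laurent series -/

/-- The weight `1 + |n|`. -/
def wt (n : ℤ) : ℝ := 1 + |(n : ℝ)|

lemma one_le_wt (n : ℤ) : 1 ≤ wt n := by unfold wt; linarith [abs_nonneg (n : ℝ)]

lemma wt_pos (n : ℤ) : 0 < wt n := by linarith [one_le_wt n]

lemma wt_add (m n : ℤ) : wt (m + n) ≤ wt m * wt n := by
  unfold wt
  push_cast
  nlinarith [abs_add_le (m : ℝ) n, abs_nonneg (m : ℝ), abs_nonneg (n : ℝ),
    mul_nonneg (abs_nonneg (m : ℝ)) (abs_nonneg (n : ℝ))]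

lemma summable_wt : Summable fun n : ℤ => (wt n ^ 2)⁻¹ := by
  have h : Summable fun n : ℤ => 1 / (n : ℝ) ^ 2 := Real.summable_one_div_int_pow.2 (by norm_num)
  have h2 : Summable fun n : ℤ => if n = 0 then (1 : ℝ) else 0 :=
    summable_of_ne_finset_zero (s := {0}) (by intro b hb; simp at hb; simp [hb])
  refine Summable.of_nonneg_of_le (fun n => by positivity) (fun n => ?_) (h.add h2)
  by_cases hn : n = 0
  · subst hn; simp [wt]
  · have hn' : (n : ℝ) ≠ 0 := by exact_mod_cast hn
    simp only [hn, if_false, add_zero, one_div]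
    refine inv_anti₀ (by positivity) ?_
    unfold wt
    rw [← sq_abs (n : ℝ)]
    exact pow_le_pow_left₀ (abs_nonneg _) (by linarith) 2

/-- A Laurent series with rapidly decreasing coefficients: for every seminorm `p` of the ring,
`p (aₙ)` stays bounded after multiplication by any power of `1 + |n|`. -/
@[ext] structure RapidLaurent (A : Type u) [CommRing A] [TopologicalSpace A]
    [StrongPolymetricRing A] where
  coeff : ℤ → A
  rapid : ∀ p ∈ seminorms (A := A), ∀ k : ℕ, ∃ C : ℝ, ∀ n : ℤ, wt n ^ k * p (coeff n) ≤ C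

namespace RapidLaurent

section Add

variable {A : Type u} [CommRing A] [TopologicalSpace A] [StrongPolymetricRing A]

instance : Zero (RapidLaurent A) := ⟨⟨fun _ => 0, fun p _ k => ⟨0, fun n => by simp⟩⟩⟩

instance : Add (RapidLaurent A) :=
  ⟨fun a b => ⟨fun n => a.coeff n + b.coeff n, fun p hp k => by
    obtain ⟨C, hC⟩ := a.rapid p hp k
    obtain ⟨D, hD⟩ := b.rapid p hp k
    refine ⟨C + D, fun n => ?_⟩
    have h := mul_le_mul_of_nonneg_left (map_add_le_add p (a.coeff n) (b.coeff n))
      (pow_pos (wt_pos n) k).le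
    linarith [hC n, hD n]⟩⟩

instance : Neg (RapidLaurent A) :=
  ⟨fun a => ⟨fun n => - a.coeff n, fun p hp k => by
    obtain ⟨C, hC⟩ := a.rapid p hp k
    exact ⟨C, fun n => by rw [map_neg_eq_map]; exact hC n⟩⟩⟩

lemma add_coeff (a b : RapidLaurent A) (n : ℤ) : (a + b).coeff n = a.coeff n + b.coeff n := rfl

lemma zero_coeff (n : ℤ) : (0 : RapidLaurent A).coeff n = 0 := rfl

lemma neg_coeff (a : RapidLaurent A) (n : ℤ) : (-a).coeff n = - a.coeff n := rfl

instance : AddCommGroup (RapidLaurent A) where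
  add_assoc a b c := by ext n; exact add_assoc _ _ _
  zero_add a := by ext n; exact zero_add _
  add_zero a := by ext n; exact add_zero _
  add_comm a b := by ext n; exact add_comm _ _
  neg_add_cancel a := by ext n; exact neg_add_cancel _
  nsmul := nsmulRec
  zsmul := zsmulRec

/-- The monomial `c zⁿ`. -/
def single (n : ℤ) (c : A) : RapidLaurent A :=
  ⟨fun m => if m = n then c else 0, fun p _ k => ⟨wt n ^ k * p c, fun m => by
    split_ifs with h
    · rw [h]
    · simpa using mul_nonneg (pow_pos (wt_pos n) k).le (apply_nonneg p c)⟩⟩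

lemma single_coeff (n : ℤ) (c : A) (m : ℤ) :
    (single n c).coeff m = if m = n then c else 0 := rfl

lemma summable_weight (a : RapidLaurent A) (p : AddGroupSeminorm A)
    (hp : p ∈ seminorms (A := A)) (k : ℕ) : Summable fun n => wt n ^ k * p (a.coeff n) := by
  obtain ⟨C, hC⟩ := a.rapid p hp (k + 2)
  refine Summable.of_nonneg_of_le
    (fun n => mul_nonneg (pow_pos (wt_pos n) k).le (apply_nonneg p _)) (fun n => ?_)
    (summable_wt.mul_left C)
  have h := hC n
  have hw : 0 < wt n ^ 2 := pow_pos (wt_pos n) 2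
  rw [← div_eq_mul_inv, le_div_iff₀ hw]
  calc _ = wt n ^ (k + 2) * p (a.coeff n) := by ring
    _ ≤ C := h

/-- The seminorm `a ↦ ∑ₙ (1 + |n|) ^ k * p (aₙ)`. -/
def weighted (p : AddGroupSeminorm A) (hp : p ∈ seminorms (A := A)) (k : ℕ) :
    AddGroupSeminorm (RapidLaurent A) where
  toFun a := ∑' n, wt n ^ k * p (a.coeff n)
  map_zero' := by simp [zero_coeff]
  add_le' a b := by
    rw [← (a.summable_weight p hp k).tsum_add (b.summable_weight p hp k)]
    refine ((a + b).summable_weight p hp k).tsum_le_tsum (fun n => ?_)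
      ((a.summable_weight p hp k).add (b.summable_weight p hp k))
    rw [← mul_add]
    exact mul_le_mul_of_nonneg_left (map_add_le_add p _ _) (pow_pos (wt_pos n) k).le
  neg' a := by simp [neg_coeff, map_neg_eq_map]

lemma weighted_apply (p : AddGroupSeminorm A) (hp : p ∈ seminorms (A := A)) (k : ℕ)
    (a : RapidLaurent A) : weighted p hp k a = ∑' n, wt n ^ k * p (a.coeff n) := rfl

lemma le_weighted (p : AddGroupSeminorm A) (hp : p ∈ seminorms (A := A)) (k : ℕ)
    (a : RapidLaurent A) (n : ℤ) : wt n ^ k * p (a.coeff n) ≤ weighted p hp k a :=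
  (a.summable_weight p hp k).le_tsum n
    fun m _ => mul_nonneg (pow_pos (wt_pos m) k).le (apply_nonneg p _)

variable (A) in
/-- The seminorms defining the usual topology of the space of rapidly decreasing series. -/
def laurentSeminorms : Set (AddGroupSeminorm (RapidLaurent A)) :=
  {P | ∃ (p : AddGroupSeminorm A) (hp : p ∈ seminorms (A := A)) (k : ℕ), P = weighted p hp k}

instance : TopologicalSpace (RapidLaurent A) := seminormTopology (laurentSeminorms A)

instance : IsTopologicalAddGroup (RapidLaurent A) := seminormTopology_addGroup _

lemma tendsto_iff {α : Type*} (l : Filter α) (f : α → RapidLaurent A) (x : RapidLaurent A) :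
    Tendsto f l (𝓝 x) ↔ ∀ (p : AddGroupSeminorm A) (hp : p ∈ seminorms (A := A)) (k : ℕ),
      Tendsto (fun a => weighted p hp k (f a - x)) l (𝓝 0) := by
  refine (seminormTopology_tendsto _ _ _ _).trans ⟨fun h p hp k => h _ ⟨p, hp, k, rfl⟩, ?_⟩
  rintro h _ ⟨p, hp, k, rfl⟩
  exact h p hp k

lemma continuous_coeff (n : ℤ) : Continuous fun a : RapidLaurent A => a.coeff n := by
  rw [continuous_iff_continuousAt]
  intro x
  rw [ContinuousAt, tendsto_iff_seminorms]
  intro p hp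
  have h := (tendsto_iff (𝓝 x) id x).1 tendsto_id p hp 0
  refine squeeze_zero (fun a => apply_nonneg p _) (fun a => ?_) h
  have := le_weighted p hp 0 (a - x) n
  simpa [sub_eq_add_neg, add_coeff, neg_coeff] using this

instance [T2Space A] : T2Space (RapidLaurent A) := by
  refine ⟨fun x y hxy => ?_⟩
  have : ∃ n, x.coeff n ≠ y.coeff n := by
    by_contra! h
    exact hxy (RapidLaurent.ext (funext h))
  obtain ⟨n, hn⟩ := this
  exact separated_by_continuous (continuous_coeff n) hn

end Add

section Mul

variable {A : Type u} [CommRing A] [TopologicalSpace A] [StrongPolymetricRing A]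

/-- Coefficients of the product. -/
def mulCoeff (a b : RapidLaurent A) (n : ℤ) : A := ∑' k, a.coeff k * b.coeff (n - k)

lemma summable_double (a b : RapidLaurent A) (p : AddGroupSeminorm A)
    (hp : p ∈ seminorms (A := A)) (K : ℕ) :
    Summable fun x : ℤ × ℤ =>
      (wt x.2 ^ K * p (a.coeff x.2)) * (wt (x.1 - x.2) ^ K * p (b.coeff (x.1 - x.2))) := by
  have h := (a.summable_weight p hp K).mul_of_nonneg (b.summable_weight p hp K)
    (fun n => mul_nonneg (pow_pos (wt_pos n) K).le (apply_nonneg p _))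
    (fun n => mul_nonneg (pow_pos (wt_pos n) K).le (apply_nonneg p _))
  let e : ℤ × ℤ ≃ ℤ × ℤ :=
    { toFun := fun x => (x.2, x.1 - x.2)
      invFun := fun x => (x.1 + x.2, x.1)
      left_inv := fun x => by ext <;> simp
      right_inv := fun x => by ext <;> simp }
  exact (e.summable_iff (f := fun x : ℤ × ℤ =>
    (wt x.1 ^ K * p (a.coeff x.1)) * (wt x.2 ^ K * p (b.coeff x.2)))).2 h

lemma summable_conv_seminorm (a b : RapidLaurent A) (p : AddGroupSeminorm A)
    (hp : p ∈ seminorms (A := A)) (n : ℤ) :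
    Summable fun k => p (a.coeff k * b.coeff (n - k)) := by
  obtain ⟨q, hq, h⟩ := strong_mul p hp
  have h1 := (summable_double a b q hq 0).comp_injective
    (i := fun k : ℤ => (n, k)) (fun x y hxy => by simpa using hxy)
  refine Summable.of_nonneg_of_le (fun k => apply_nonneg p _) (fun k => ?_) h1
  simpa using h _ _

variable [SequentiallyComplete A]

lemma summable_conv (a b : RapidLaurent A) (n : ℤ) :
    Summable fun k => a.coeff k * b.coeff (n - k) :=
  summable_of_seminorms fun p hp => summable_conv_seminorm a b p hp n

lemma mulCoeff_bound (a b : RapidLaurent A) (p : AddGroupSeminorm A)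
    (hp : p ∈ seminorms (A := A)) (q : AddGroupSeminorm A) (hq : q ∈ seminorms (A := A))
    (h : ∀ x y, p (x * y) ≤ q x * q y) (K : ℕ) (n : ℤ) :
    wt n ^ K * p (mulCoeff a b n) ≤
      ∑' k, (wt k ^ K * q (a.coeff k)) * (wt (n - k) ^ K * q (b.coeff (n - k))) := by
  have h1 := (summable_double a b q hq K).comp_injective
    (i := fun k : ℤ => (n, k)) (fun x y hxy => by simpa using hxy)
  have hw : 0 ≤ wt n ^ K := (pow_pos (wt_pos n) K).le
  refine (mul_le_mul_of_nonneg_left (seminorm_tsum_le p hp (summable_conv a b n)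
    (summable_conv_seminorm a b p hp n)) hw).trans ?_
  rw [← tsum_mul_left]
  refine ((summable_conv_seminorm a b p hp n).mul_left _).tsum_le_tsum (fun k => ?_) h1
  have hq1 : 0 ≤ q (a.coeff k) * q (b.coeff (n - k)) :=
    mul_nonneg (apply_nonneg q _) (apply_nonneg q _)
  have hwk : wt n ^ K ≤ wt k ^ K * wt (n - k) ^ K := by
    rw [← mul_pow]
    refine pow_le_pow_left₀ (wt_pos n).le ?_ K
    simpa using wt_add k (n - k)
  calc wt n ^ K * p (a.coeff k * b.coeff (n - k))
      ≤ wt n ^ K * (q (a.coeff k) * q (b.coeff (n - k))) :=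
        mul_le_mul_of_nonneg_left (h _ _) hw
    _ ≤ (wt k ^ K * wt (n - k) ^ K) * (q (a.coeff k) * q (b.coeff (n - k))) :=
        mul_le_mul_of_nonneg_right hwk hq1
    _ = _ := by ring

lemma summable_conv_real (a b : RapidLaurent A) (q : AddGroupSeminorm A)
    (hq : q ∈ seminorms (A := A)) (K : ℕ) :
    Summable fun n => ∑' k, (wt k ^ K * q (a.coeff k)) *
      (wt (n - k) ^ K * q (b.coeff (n - k))) :=
  (summable_double a b q hq K).prod

lemma tsum_conv_real (a b : RapidLaurent A) (q : AddGroupSeminorm A)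
    (hq : q ∈ seminorms (A := A)) (K : ℕ) :
    ∑' n, ∑' k, (wt k ^ K * q (a.coeff k)) * (wt (n - k) ^ K * q (b.coeff (n - k))) =
      weighted q hq K a * weighted q hq K b := by
  have hc := (summable_double a b q hq K).tsum_comm (f := fun n k =>
    (wt k ^ K * q (a.coeff k)) * (wt (n - k) ^ K * q (b.coeff (n - k))))
  rw [← hc, weighted_apply, weighted_apply, ← tsum_mul_right]
  refine tsum_congr fun k => ?_
  rw [tsum_mul_left]
  congr 1
  exact (Equiv.subRight k).tsum_eq (fun m => wt m ^ K * q (b.coeff m))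

instance : Mul (RapidLaurent A) :=
  ⟨fun a b => ⟨mulCoeff a b, fun p hp K => by
    obtain ⟨q, hq, h⟩ := strong_mul p hp
    refine ⟨weighted q hq K a * weighted q hq K b, fun n => ?_⟩
    refine (mulCoeff_bound a b p hp q hq h K n).trans ?_
    rw [← tsum_conv_real]
    refine (summable_conv_real a b q hq K).le_tsum n fun m _ => tsum_nonneg fun k => ?_
    exact mul_nonneg (mul_nonneg (pow_pos (wt_pos _) K).le (apply_nonneg q _))
      (mul_nonneg (pow_pos (wt_pos _) K).le (apply_nonneg q _))⟩⟩

lemma mul_coeff (a b : RapidLaurent A) (n : ℤ) :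
    (a * b).coeff n = ∑' k, a.coeff k * b.coeff (n - k) := rfl

lemma weighted_mul (p : AddGroupSeminorm A) (hp : p ∈ seminorms (A := A)) :
    ∃ (q : AddGroupSeminorm A) (hq : q ∈ seminorms (A := A)), ∀ (K : ℕ) (a b : RapidLaurent A),
      weighted p hp K (a * b) ≤ weighted q hq K a * weighted q hq K b := by
  obtain ⟨q, hq, h⟩ := strong_mul p hp
  refine ⟨q, hq, fun K a b => ?_⟩
  rw [← tsum_conv_real]
  exact ((a * b).summable_weight p hp K).tsum_le_tsum
    (fun n => mulCoeff_bound a b p hp q hq h K n) (summable_conv_real a b q hq K)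

instance : One (RapidLaurent A) := ⟨single 0 1⟩

lemma one_coeff (n : ℤ) : (1 : RapidLaurent A).coeff n = if n = 0 then 1 else 0 := rfl

variable [T2Space A]

lemma mul_comm' (a b : RapidLaurent A) : a * b = b * a := by
  ext n
  rw [mul_coeff, mul_coeff, ← (Equiv.subLeft n).tsum_eq]
  refine tsum_congr fun k => ?_
  simp [mul_comm]

lemma one_mul' (a : RapidLaurent A) : 1 * a = a := by
  ext n
  rw [mul_coeff, tsum_eq_single 0]
  · simp [one_coeff]
  · intro k hk
    simp [one_coeff, hk]

lemma mul_add' (a b c : RapidLaurent A) : a * (b + c) = a * b + a * c := by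
  ext n
  rw [add_coeff, mul_coeff, mul_coeff, mul_coeff,
    ← (summable_conv a b n).tsum_add (summable_conv a c n)]
  refine tsum_congr fun k => ?_
  rw [add_coeff, mul_add]

lemma mul_assoc' (a b c : RapidLaurent A) : a * b * c = a * (b * c) := by
  ext n
  have hR : ∀ j, a.coeff j * (b * c).coeff (n - j)
      = ∑' k, a.coeff j * (b.coeff (k - j) * c.coeff (n - k)) := by
    intro j
    rw [mul_coeff, ← (summable_conv b c (n - j)).tsum_mul_left,
      ← (Equiv.subRight j).tsum_eq]
    refine tsum_congr fun k => ?_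
    simp
  have hL : ∀ k, (a * b).coeff k * c.coeff (n - k)
      = ∑' j, a.coeff j * (b.coeff (k - j) * c.coeff (n - k)) := by
    intro k
    rw [mul_coeff, ← (summable_conv a b k).tsum_mul_right]
    refine tsum_congr fun k => ?_
    rw [mul_assoc]
  rw [mul_coeff, mul_coeff, tsum_congr hL, tsum_congr hR]
  have hs : Summable (Function.uncurry fun k j =>
      a.coeff j * (b.coeff (k - j) * c.coeff (n - k))) := by
    refine summable_of_seminorms fun p hp => ?_
    obtain ⟨q, hq, h⟩ := StrongPolymetricRing.strong p hp
    have h1 := summable_double a b q hq 0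
    refine Summable.of_nonneg_of_le (fun x => apply_nonneg p _) (fun x => ?_)
      (h1.mul_right (weighted q hq 0 c))
    have h2 := h [a.coeff x.2, b.coeff (x.1 - x.2), c.coeff (n - x.1)] (by simp)
    have h3 := le_weighted q hq 0 c (n - x.1)
    simp only [List.prod_cons, List.prod_nil, List.map_cons, List.map_nil, mul_one, pow_zero,
      one_mul, Function.uncurry] at h2 h3 ⊢
    refine h2.trans ?_
    rw [← mul_assoc]
    exact mul_le_mul_of_nonneg_left h3 (mul_nonneg (apply_nonneg q _) (apply_nonneg q _))
  refine (hs.tsum_comm' (fun k => ?_) fun j => ?_).symm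
  · refine ((summable_conv a b k).mul_right (c.coeff (n - k))).congr fun j => ?_
    simp [mul_assoc]
  · have h1 := (summable_conv b c (n - j)).mul_left (a.coeff j)
    refine ((Equiv.subRight j).summable_iff.2 h1).congr fun k => ?_
    simp
/-- The algebra `A[z⁻¹, z]`. -/
instance : CommRing (RapidLaurent A) where
  mul_assoc := mul_assoc'
  mul_comm := mul_comm'
  one_mul := one_mul'
  mul_one a := by rw [mul_comm', one_mul']
  left_distrib := mul_add'
  right_distrib a b c := by rw [mul_comm', mul_add', mul_comm' c, mul_comm' c]
  zero_mul a := by ext n; simp [mul_coeff, zero_coeff]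
  mul_zero a := by ext n; simp [mul_coeff, zero_coeff]
  neg_add_cancel := neg_add_cancel
  zsmul := zsmulRec
  nsmul := nsmulRec

instance : IsTopologicalRing (RapidLaurent A) := by
  have hl : ∀ a : RapidLaurent A, Tendsto (fun b => a * b) (𝓝 0) (𝓝 0) := by
    intro a
    rw [tendsto_iff]
    intro p hp K
    obtain ⟨q, hq, h⟩ := weighted_mul p hp
    have h0 := ((tendsto_iff (𝓝 0) id (0 : RapidLaurent A)).1 tendsto_id q hq K).const_mul
      (weighted q hq K a)
    rw [mul_zero] at h0
    refine squeeze_zero (fun b => apply_nonneg _ _) (fun b => ?_) h0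
    simpa using h K a b
  refine IsTopologicalRing.of_addGroup_of_nhds_zero ?_ hl ?_
  · rw [tendsto_iff]
    intro p hp K
    obtain ⟨q, hq, h⟩ := weighted_mul p hp
    have h0 := (tendsto_iff (𝓝 0) id (0 : RapidLaurent A)).1 tendsto_id q hq K
    have h1 := (h0.comp (tendsto_fst (f := 𝓝 0) (g := 𝓝 (0 : RapidLaurent A)))).mul
      (h0.comp (tendsto_snd (f := 𝓝 (0 : RapidLaurent A)) (g := 𝓝 0)))
    rw [mul_zero] at h1
    refine squeeze_zero (fun b => apply_nonneg _ _) (fun b => ?_) h1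
    simpa [Function.uncurry] using h K b.1 b.2
  · intro a
    simpa only [mul_comm] using hl a

lemma single_mul_single (m n : ℤ) (x y : A) :
    single m x * single n y = single (m + n) (x * y) := by
  ext k
  rw [mul_coeff, tsum_eq_single m]
  · simp only [single_coeff, if_true]
    by_cases h : k = m + n
    · simp [h]
    · have : ¬ (k - m = n) := fun h' => h (by omega)
      simp [h, this]
  · intro j hj
    simp [single_coeff, hj]

variable (A) in
/-- The formal variable, as a unit of the algebra of Laurent series. -/
def X : (RapidLaurent A)ˣ where
  val := single 1 1
  inv := single (-1) 1
  val_inv := by rw [single_mul_single]; simp; rfl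
  inv_val := by rw [single_mul_single]; simp; rfl

/-- The embedding of the coefficient ring as constant Laurent series. -/
def C : A →+* RapidLaurent A where
  toFun := single 0
  map_one' := rfl
  map_mul' x y := by rw [single_mul_single]; simp
  map_zero' := by ext n; simp [single_coeff, zero_coeff]
  map_add' x y := by ext n; by_cases h : n = 0 <;> simp [single_coeff, add_coeff, h]

end Mul

end RapidLaurent

/-! ### Infinite matrices -/

/-- Product of infinite matrices; the entries are unconditionally convergent sums. -/
def mmul {ι R : Type*} [Semiring R] [TopologicalSpace R] (M N : Matrix ι ι R) : Matrix ι ι R :=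
  fun i k => ∑' j, M i j * N j k

infixl:70 " ⊠ " => mmul

open scoped Classical in
/-- The matrix `1_S = ∑_{s ∈ S} e_{s,s}`. -/
def oneOn {ι : Type*} (R : Type*) [Semiring R] (S : Set ι) : Matrix ι ι R :=
  fun i j => if i = j ∧ i ∈ S then 1 else 0

/-- Permutations moving only finitely many elements. -/
def FinPerm (ι : Type*) : Type _ := {σ : Equiv.Perm ι // {i | σ i ≠ i}.Finite}

open scoped Classical in
/-- The sign of a finite permutation, computed on the finite set of moved elements. -/
def FinPerm.sign {ι : Type*} (σ : FinPerm ι) : ℤ :=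
  letI : Fintype {i // σ.1 i ≠ i} := σ.2.fintype
  (Equiv.Perm.sign
    (σ.1.subtypePerm (p := fun i => σ.1 i ≠ i) fun _ => not_congr σ.1.apply_eq_iff_eq) : ℤˣ)

/-- The term of the determinant that belongs to a finite permutation. -/
def detTerm {ι R : Type*} [CommRing R] [TopologicalSpace R] (M : Matrix ι ι R)
    (σ : FinPerm ι) : R :=
  (σ.sign : R) * ∏' i, M i (σ.1 i)

/-- The naive determinant of an infinite matrix: the alternating sum, over the finite permutations,
of the products of entries. -/
def idet {ι R : Type*} [CommRing R] [TopologicalSpace R] (M : Matrix ι ι R) : R :=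
  ∑' σ, detTerm M σ

/-- The naive determinant of `M` converges (all the products and the sum) and has the value `d`. -/
def HasDet {ι R : Type*} [CommRing R] [TopologicalSpace R] (M : Matrix ι ι R) (d : R) : Prop :=
  (∀ σ : FinPerm ι, Multipliable fun i => M i (σ.1 i)) ∧ HasSum (detTerm M) d

/-- The block of `M` with indices in the finite set `T`. -/
def block {ι R : Type*} (T : Finset ι) (M : Matrix ι ι R) : Matrix T T R :=
  M.submatrix Subtype.val Subtype.val

/-- The half-integers `ℤ + 1/2`; the element `⟨n⟩` stands for `n + 1/2`. -/
@[ext] structure HalfInt where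
  floor : ℤ
deriving DecidableEq

/-- The half-integer as a rational number. -/
def HalfInt.toRat (s : HalfInt) : ℚ := s.floor + 1 / 2

/-- The half-integers between `m` and `n`. -/
def HalfInt.between (m n : ℤ) : Finset HalfInt := (Finset.Ico m n).image HalfInt.mk

lemma HalfInt.mem_between (m n : ℤ) (s : HalfInt) :
    s ∈ HalfInt.between m n ↔ (m : ℚ) < s.toRat ∧ s.toRat < n := by
  obtain ⟨k⟩ := s
  have h1 : (m : ℚ) < k + 1 / 2 ↔ m ≤ k := by
    constructor
    · intro h
      by_contra! hc
      have : (k : ℚ) + 1 ≤ m := by exact_mod_cast hc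
      linarith
    · intro h
      have : (m : ℚ) ≤ k := by exact_mod_cast h
      linarith
  have h2 : (k : ℚ) + 1 / 2 < n ↔ k < n := by
    constructor
    · intro h
      by_contra! hc
      have : (n : ℚ) ≤ k := by exact_mod_cast hc
      linarith
    · intro h
      have : (k : ℚ) + 1 ≤ n := by exact_mod_cast h
      linarith
  simp [HalfInt.between, HalfInt.toRat, -one_div, h1, h2]

/-- The negative integers. -/
def negZ : Set ℤ := {n | n < 0}

/-- The positive integers. -/
def posZ : Set ℤ := {n | 0 < n}

/-- The negative half-integers. -/
def negH : Set HalfInt := {s | s.toRat < 0}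

/-- The positive half-integers. -/
def posH : Set HalfInt := {s | 0 < s.toRat}

section Definitions

variable {A : Type u} [CommRing A] [TopologicalSpace A] [StrongPolymetricRing A]

/-- The multiplication matrix of a Laurent series, with entries `a_{n - m}`. -/
def U (a : RapidLaurent A) : Matrix ℤ ℤ A := fun n m => a.coeff (n - m)

/-- The multiplication matrix with half-integer indices, with entries `a_{s - t}`. -/
def UH (a : RapidLaurent A) : Matrix HalfInt HalfInt A :=
  fun s t => a.coeff (s.floor - t.floor)

variable [SequentiallyComplete A] [T2Space A]

open RapidLaurent (C X)

lemma U_mul (a b : RapidLaurent A) : U a ⊠ U b = U (a * b) := by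
  ext n m
  simp only [mmul, U]
  rw [RapidLaurent.mul_coeff, ← (Equiv.subLeft n).tsum_eq]
  refine tsum_congr fun k => ?_
  simp only [Equiv.subLeft_apply, sub_sub_cancel]
  congr 2
  omega

lemma U_one : U (1 : RapidLaurent A) = 1 := by
  ext n m
  simp only [U, RapidLaurent.one_coeff, Matrix.one_apply, sub_eq_zero]

/-- `1 - x 1_{ℤ⁻} U(z⁻¹)`, for `x` in a ring `R` over the coefficient ring; `F⁺(t, w)` is the case
`x = t w`. -/
def FPlus {R : Type*} [CommRing R] (f : A →+* R) (x : R) : Matrix ℤ ℤ R :=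
  1 - x • (oneOn A negZ ⊠ U (↑(X A)⁻¹ : RapidLaurent A)).map f

/-- `1 - x 1_{ℤ⁺} U(z)`; `F⁻(t, w)` is the case `x = t w⁻¹`. -/
def FMinus {R : Type*} [CommRing R] (f : A →+* R) (x : R) : Matrix ℤ ℤ R :=
  1 - x • (oneOn A posZ ⊠ U (X A : RapidLaurent A)).map f

/-- The inverse of `FPlus f x`, written out (see `FPlus_mul_inv`, `FPlus_inv_mul`). -/
def FPlusInv {R : Type*} [CommRing R] (x : R) : Matrix ℤ ℤ R := fun n m =>
  if n = m then 1 else if n < m ∧ m ≤ 0 then x ^ (m - n).toNat else 0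

/-- The inverse of `FMinus f x`, written out (see `FMinus_mul_inv`, `FMinus_inv_mul`). -/
def FMinusInv {R : Type*} [CommRing R] (x : R) : Matrix ℤ ℤ R := fun n m =>
  if n = m then 1 else if m < n ∧ 0 ≤ m then x ^ (n - m).toNat else 0

lemma FPlus_apply {R : Type*} [CommRing R] (f : A →+* R) (x : R) (n m : ℤ) :
    FPlus f x n m = (if n = m then 1 else 0) - if n < 0 ∧ m = n + 1 then x else 0 := by
  have h : (oneOn A negZ ⊠ U (↑(X A)⁻¹ : RapidLaurent A)) n m
      = if n < 0 ∧ m = n + 1 then 1 else 0 := by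
    rw [mmul, tsum_eq_single n]
    · have e : n - m = -1 ↔ m = n + 1 := by omega
      have e2 : (U (↑(X A)⁻¹ : RapidLaurent A)) n m = if n - m = -1 then 1 else 0 := rfl
      simp only [oneOn, e2, e, negZ, Set.mem_ofPred_eq, true_and, ite_and]
      split_ifs <;> simp
    · intro j hj
      simp [oneOn, Ne.symm hj]
  simp only [FPlus, Matrix.sub_apply, Matrix.smul_apply, Matrix.map_apply, h, Matrix.one_apply]
  split_ifs <;> simp

lemma FMinus_apply {R : Type*} [CommRing R] (f : A →+* R) (x : R) (n m : ℤ) :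
    FMinus f x n m = (if n = m then 1 else 0) - if 0 < n ∧ m = n - 1 then x else 0 := by
  have h : (oneOn A posZ ⊠ U (X A : RapidLaurent A)) n m
      = if 0 < n ∧ m = n - 1 then 1 else 0 := by
    rw [mmul, tsum_eq_single n]
    · have e : n - m = 1 ↔ m = n - 1 := by omega
      have e2 : (U (↑(X A) : RapidLaurent A)) n m = if n - m = 1 then 1 else 0 := rfl
      simp only [oneOn, e2, e, posZ, Set.mem_ofPred_eq, true_and, ite_and]
      split_ifs <;> simp
    · intro j hj
      simp [oneOn, Ne.symm hj]
  simp only [FMinus, Matrix.sub_apply, Matrix.smul_apply, Matrix.map_apply, h, Matrix.one_apply]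
  split_ifs <;> simp

lemma FPlus_mul_inv {R : Type*} [CommRing R] [TopologicalSpace R] (f : A →+* R) (x : R) :
    FPlus f x ⊠ FPlusInv x = 1 := by
  ext n m
  rw [mmul, tsum_eq_sum (s := {n, n + 1}), Finset.sum_pair (by omega)]
  · simp only [FPlus_apply, FPlusInv, Matrix.one_apply]
    by_cases h0 : n < 0
    · rcases lt_trichotomy n m with h | h | h
      · by_cases hm : m ≤ 0
        · have e : (m - n).toNat = (m - (n + 1)).toNat + 1 := by omega
          by_cases h1 : n + 1 = m
          · have e1 : (m - n).toNat = 1 := by omega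
            simp [h0, h.ne, hm, h, h1, e1]
          · have h2 : n + 1 < m := by omega
            simp [h0, h.ne, hm, h, h1, h2, e, pow_succ]
            ring
        · have h1 : n + 1 ≠ m := by omega
          simp [h.ne, hm, h1]
      · subst h
        simp
      · have h1 : n + 1 ≠ m := by omega
        have h2 : ¬ (n + 1 < m) := by omega
        simp [h.ne', h1, h2, not_lt.2 h.le]
    · have h1 : ¬ (n < m ∧ m ≤ 0) := by omega
      simp [h0, h1]
  · intro j hj
    simp only [Finset.mem_insert, Finset.mem_singleton, not_or] at hj
    simp [FPlus_apply, Ne.symm hj.1, hj.2]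

lemma FPlus_inv_mul {R : Type*} [CommRing R] [TopologicalSpace R] (f : A →+* R) (x : R) :
    FPlusInv x ⊠ FPlus f x = 1 := by
  ext n m
  rw [mmul, tsum_eq_sum (s := {m, m - 1}), Finset.sum_pair (by omega)]
  · simp only [FPlus_apply, FPlusInv, Matrix.one_apply]
    by_cases h0 : m ≤ 0
    · have h0' : m < 1 := by omega
      rcases lt_trichotomy n m with h | h | h
      · by_cases h1 : n = m - 1
        · subst h1
          simp [h0, h0']
        · have h2 : n < m - 1 := by omega
          have h3 : m - 1 ≤ 0 := by omega
          have h4 : ¬ (m - 1 = m) := by omega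
          have h5 : m - 1 < 0 := by omega
          have e : (m - n).toNat = (m - 1 - n).toNat + 1 := by omega
          have h6 : m = m - 1 + 1 := by omega
          have h7 : ¬ (m = m + 1) := by omega
          simp only [h.ne, h, h0, h1, h2, h3, h4, h5, h7, ← h6, e, pow_succ, if_true, if_false,
            and_true, and_false]
          ring
      · subst h
        have h1 : ¬ (n = n - 1) := by omega
        have h2 : ¬ (n < n - 1) := by omega
        simp [h1, h2]
      · have h1 : n ≠ m - 1 := by omega
        have h2 : ¬ (n < m - 1) := by omega
        simp [h.ne', h1, h2, not_lt.2 h.le]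
    · have h1 : ¬ (n < m ∧ m ≤ 0) := by omega
      have h2 : ¬ (m < 1) := by omega
      simp [h0, h2]
  · intro j hj
    simp only [Finset.mem_insert, Finset.mem_singleton, not_or] at hj
    have : m ≠ j + 1 := by omega
    simp [FPlus_apply, hj.1, this]

lemma FMinus_mul_inv {R : Type*} [CommRing R] [TopologicalSpace R] (f : A →+* R) (x : R) :
    FMinus f x ⊠ FMinusInv x = 1 := by
  have h := congrFun₂ (FPlus_mul_inv f x)
  ext n m
  have h1 := h (-n) (-m)
  rw [mmul, ← (Equiv.neg ℤ).tsum_eq] at h1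
  rw [mmul]
  convert h1 using 1
  · refine tsum_congr fun j => ?_
    simp only [FPlus_apply, FMinus_apply, FPlusInv, FMinusInv, Equiv.neg_apply]
    congr 1
    · congr 1
      · simp
      · congr 1
        simp only [eq_iff_iff]
        omega
    · have e : -m - -j = j - m := by ring
      simp only [e, neg_inj, neg_lt_neg_iff, neg_nonpos]
  · simp [Matrix.one_apply]

lemma FMinus_inv_mul {R : Type*} [CommRing R] [TopologicalSpace R] (f : A →+* R) (x : R) :
    FMinusInv x ⊠ FMinus f x = 1 := by
  have h := congrFun₂ (FPlus_inv_mul f x)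
  ext n m
  have h1 := h (-n) (-m)
  rw [mmul, ← (Equiv.neg ℤ).tsum_eq] at h1
  rw [mmul]
  convert h1 using 1
  · refine tsum_congr fun j => ?_
    simp only [FPlus_apply, FMinus_apply, FPlusInv, FMinusInv, Equiv.neg_apply]
    congr 1
    · have e : -j - -n = n - j := by ring
      simp only [e, neg_inj, neg_lt_neg_iff, neg_nonpos]
    · congr 1
      · simp
      · congr 1
        simp only [eq_iff_iff]
        omega
  · simp [Matrix.one_apply]

variable (A) in
/-- Constants, as formal power series in `t` over the Laurent series in `w`. -/
def CC : A →+* PowerSeries (RapidLaurent A) := (PowerSeries.C (R := RapidLaurent A)).comp C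

/-- `U⁺(a, t, w) = F⁺(t, w) U(a) F⁺(t, w)⁻¹`. -/
def UPlus (a : RapidLaurent A) : Matrix ℤ ℤ (PowerSeries (RapidLaurent A)) :=
  FPlus (CC A) (PowerSeries.X * PowerSeries.C (X A : RapidLaurent A)) ⊠ (U a).map (CC A) ⊠
    FPlusInv (PowerSeries.X * PowerSeries.C (X A : RapidLaurent A))

/-- `U⁻(a, t, w) = F⁻(t, w) U(a) F⁻(t, w)⁻¹`. -/
def UMinus (a : RapidLaurent A) : Matrix ℤ ℤ (PowerSeries (RapidLaurent A)) :=
  FMinus (CC A) (PowerSeries.X * PowerSeries.C (↑(X A)⁻¹ : RapidLaurent A)) ⊠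
    (U a).map (CC A) ⊠
    FMinusInv (PowerSeries.X * PowerSeries.C (↑(X A)⁻¹ : RapidLaurent A))

/-- Substitution of `t = 1` in a power series in `t`. -/
def evalOne {R : Type*} [CommRing R] [TopologicalSpace R] (g : PowerSeries R) : R :=
  ∑' j, PowerSeries.coeff j g

/-- The matrix `Ũ(a, w)`. -/
def UTilde (a : RapidLaurent A) (w : (RapidLaurent A)ˣ) : Matrix ℤ ℤ (RapidLaurent A) :=
  fun n m =>
    if n = 0 ∨ m = 0 then (if n = m then 1 else 0)
    else if n < 0 ∧ 0 < m then -(w * C (a.coeff (n - m + 1)))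
    else if 0 < n ∧ m < 0 then -(↑w⁻¹ * C (a.coeff (n - m - 1)))
    else C (a.coeff (n - m))

lemma continuous_C : Continuous (C : A → RapidLaurent A) := by
  rw [continuous_iff_continuousAt]
  intro x
  rw [ContinuousAt, RapidLaurent.tendsto_iff]
  intro p hp k
  have h := (tendsto_iff_seminorms (𝓝 x) id x).1 tendsto_id p hp
  refine h.congr fun y => ?_
  rw [← map_sub, RapidLaurent.weighted_apply, tsum_eq_single 0]
  · simp [C, RapidLaurent.single_coeff, wt]
  · intro n hn
    simp [C, RapidLaurent.single_coeff, hn]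

/-- The order preserving bijection of `ℤ` with `ℤ \ {0}` that fixes the negative integers. -/
def skipZero (n : ℤ) : ℤ := if n < 0 then n else n + 1

lemma UTilde_skipZero (a : RapidLaurent A) (w : (RapidLaurent A)ˣ) (n m : ℤ) :
    UTilde a w (skipZero n) (skipZero m) =
      (if n < 0 ∧ 0 ≤ m then -(w : RapidLaurent A)
        else if 0 ≤ n ∧ m < 0 then -(↑w⁻¹ : RapidLaurent A) else 1) * C (a.coeff (n - m)) := by
  unfold UTilde skipZero
  by_cases hn : n < 0 <;> by_cases hm : m < 0
  · simp [hn, hm, hn.ne, hm.ne, not_le.2 hm, not_lt.2 hm.le, not_lt.2 hn.le, not_le.2 hn]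
  · have h1 : m + 1 ≠ 0 := by omega
    have h2 : 0 < m + 1 := by omega
    have h3 : n - (m + 1) + 1 = n - m := by ring
    simp [hn, hm, hn.ne, h1, h2, h3, not_lt.1 hm]
  · have h1 : n + 1 ≠ 0 := by omega
    have h2 : 0 < n + 1 := by omega
    have h3 : n + 1 - m - 1 = n - m := by ring
    have h4 : ¬ (n + 1 < 0) := by omega
    simp [hn, hm, hm.ne, h1, h2, h3, h4, not_lt.1 hn]
  · have h1 : n + 1 ≠ 0 := by omega
    have h2 : m + 1 ≠ 0 := by omega
    have h3 : ¬ (n + 1 < 0) := by omega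
    have h4 : ¬ (m + 1 < 0) := by omega
    simp [hn, hm, h1, h2, h3, h4]

lemma UTilde_mul (a b : RapidLaurent A) (w : (RapidLaurent A)ˣ) :
    UTilde a w ⊠ UTilde b w = UTilde (a * b) w := by
  have hinj : Function.Injective skipZero := by
    intro x y h
    unfold skipZero at h
    split_ifs at h <;> omega
  have hsurj : ∀ n : ℤ, n ≠ 0 → ∃ k, n = skipZero k := by
    intro n hn
    unfold skipZero
    by_cases h : n < 0
    · exact ⟨n, by simp [h]⟩
    · refine ⟨n - 1, ?_⟩
      rw [if_neg (by omega)]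
      ring
  have hz : ∀ (c : RapidLaurent A) (n m : ℤ), n = 0 ∨ m = 0 →
      UTilde c w n m = if n = m then 1 else 0 := fun c n m h => if_pos h
  ext1 n m
  by_cases h0 : n = 0 ∨ m = 0
  · rw [hz _ _ _ h0, mmul]
    rcases h0 with rfl | rfl
    · rw [tsum_eq_single 0]
      · simp [hz]
      · intro j hj
        simp [hz, Ne.symm hj]
    · rw [tsum_eq_single 0]
      · simp [hz]
      · intro j hj
        simp [hz, hj]
  · rw [not_or] at h0
    obtain ⟨n, rfl⟩ := hsurj n h0.1
    obtain ⟨m, rfl⟩ := hsurj m h0.2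
    rw [mmul, ← hinj.tsum_eq]
    · have hs : Summable fun k => a.coeff (n - k) * b.coeff (k - m) := by
        refine ((Equiv.subLeft n).summable_iff.2
          (RapidLaurent.summable_conv a b (n - m))).congr fun k => ?_
        simp
      have hsum : (a * b).coeff (n - m) = ∑' k, a.coeff (n - k) * b.coeff (k - m) :=
        (congrFun₂ (U_mul a b) n m).symm
      have h1 := (hs.map (C : A →+* RapidLaurent A) continuous_C)
      have h2 : C ((a * b).coeff (n - m)) = ∑' k, C (a.coeff (n - k)) * C (b.coeff (k - m)) := by
        rw [hsum, hs.map_tsum (C : A →+* RapidLaurent A) continuous_C]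
        simp
      rw [UTilde_skipZero, h2, ← Summable.tsum_mul_left _ (h1.congr fun k => by simp)]
      refine tsum_congr fun k => ?_
      rw [UTilde_skipZero, UTilde_skipZero]
      have hw1 : (w : RapidLaurent A) * ↑w⁻¹ = 1 := w.mul_inv
      split_ifs <;> first
        | omega
        | ring1
        | linear_combination C (a.coeff (n - k)) * C (b.coeff (k - m)) * hw1
    · intro k hk
      by_contra hk2
      have : k = 0 := by
        by_contra h
        obtain ⟨j, rfl⟩ := hsurj k h
        exact hk2 ⟨j, rfl⟩
      subst this
      apply hk
      simp [hz, h0.1, h0.2]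

lemma UTilde_one (w : (RapidLaurent A)ˣ) : UTilde (1 : RapidLaurent A) w = 1 := by
  ext1 n m
  simp only [UTilde, RapidLaurent.one_coeff, Matrix.one_apply]
  split_ifs <;> first | omega | simp

/-- `Ũ(a⁻¹, w)` is the inverse matrix of `Ũ(a, w)`. -/
lemma UTilde_inv (a w : (RapidLaurent A)ˣ) :
    UTilde (a : RapidLaurent A) w ⊠ UTilde (↑a⁻¹ : RapidLaurent A) w = 1 ∧
      UTilde (↑a⁻¹ : RapidLaurent A) w ⊠ UTilde (a : RapidLaurent A) w = 1 := by
  simp [UTilde_mul, UTilde_one]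

/-- `U(a⁻¹)` is the inverse matrix of `U(a)`. -/
lemma U_inv (a : (RapidLaurent A)ˣ) :
    U (a : RapidLaurent A) ⊠ U (↑a⁻¹ : RapidLaurent A) = 1 ∧
      U (↑a⁻¹ : RapidLaurent A) ⊠ U (a : RapidLaurent A) = 1 := by
  simp [U_mul, U_one]

/-- The matrix `w 1_{-} + 1_{+}` with half-integer indices; its inverse is `DH w⁻¹`. -/
def DH (w : (RapidLaurent A)ˣ) : Matrix HalfInt HalfInt (RapidLaurent A) :=
  (w : RapidLaurent A) • oneOn _ negH + oneOn _ posH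

lemma DH_inv (w : (RapidLaurent A)ˣ) : DH w ⊠ DH w⁻¹ = 1 := by
  ext1 s t
  have h : ∀ (v : (RapidLaurent A)ˣ) (i j : HalfInt), DH v i j =
      if i = j then (if i.toRat < 0 then (v : RapidLaurent A) else 1) else 0 := by
    intro v i j
    have hi : i.toRat ≠ 0 := by
      intro h0
      have h1 : ((2 * i.floor + 1 : ℤ) : ℚ) = 0 := by
        have : 2 * i.toRat = 0 := by rw [h0, mul_zero]
        unfold HalfInt.toRat at this
        push_cast
        linarith
      have h2 : 2 * i.floor + 1 = 0 := by exact_mod_cast h1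
      omega
    by_cases hij : i = j
    · subst hij
      rcases lt_or_gt_of_ne hi with hl | hg
      · simp [DH, oneOn, negH, posH, hl, not_lt.2 hl.le]
      · simp [DH, oneOn, negH, posH, hg, not_lt.2 hg.le]
    · simp [DH, oneOn, hij]
  rw [mmul, tsum_eq_single s]
  · rw [h, h, Matrix.one_apply, if_pos rfl]
    split_ifs <;> simp
  · intro j hj
    rw [h, if_neg (Ne.symm hj), zero_mul]

/-- `U(a⁻¹) 1_{ℤ⁻} U(a)`. -/
def conjNeg (a : (RapidLaurent A)ˣ) : Matrix ℤ ℤ A :=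
  U (↑a⁻¹ : RapidLaurent A) ⊠ oneOn A negZ ⊠ U (a : RapidLaurent A)

/-- `U(a⁻¹) 1_{ℤ⁺} U(a)`. -/
def conjPos (a : (RapidLaurent A)ˣ) : Matrix ℤ ℤ A :=
  U (↑a⁻¹ : RapidLaurent A) ⊠ oneOn A posZ ⊠ U (a : RapidLaurent A)

/-- `U(a⁻¹) 1_{-} U(a)` with half-integer indices. -/
def conjNegH (a : (RapidLaurent A)ˣ) : Matrix HalfInt HalfInt A :=
  UH (↑a⁻¹ : RapidLaurent A) ⊠ oneOn A negH ⊠ UH (a : RapidLaurent A)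

/-- The matrix `U⁺(a, 1, w) U(a)⁻¹`. -/
def plusMatrix (a : (RapidLaurent A)ˣ) : Matrix ℤ ℤ (RapidLaurent A) :=
  (UPlus (a : RapidLaurent A)).map evalOne ⊠ (U (↑a⁻¹ : RapidLaurent A)).map C

/-- The matrix `U⁻(a, 1, w) U(a)⁻¹`. -/
def minusMatrix (a : (RapidLaurent A)ˣ) : Matrix ℤ ℤ (RapidLaurent A) :=
  (UMinus (a : RapidLaurent A)).map evalOne ⊠ (U (↑a⁻¹ : RapidLaurent A)).map C

/-- The matrix `U(a) Ũ(a, w)⁻¹`. -/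
def tildeMatrix (a w : (RapidLaurent A)ˣ) : Matrix ℤ ℤ (RapidLaurent A) :=
  (U (a : RapidLaurent A)).map C ⊠ UTilde (↑a⁻¹ : RapidLaurent A) w

/-- The matrix `U(a⁻¹) (w 1_{-} + 1_{+})⁻¹ U(a) (w 1_{-} + 1_{+})` with half-integer indices. -/
def commMatrix (a w : (RapidLaurent A)ˣ) : Matrix HalfInt HalfInt (RapidLaurent A) :=
  (UH (↑a⁻¹ : RapidLaurent A)).map C ⊠ DH w⁻¹ ⊠ (UH (a : RapidLaurent A)).map C ⊠ DH w

/-- `π⁺(a, 1, w) = det (U⁺(a, 1, w) U(a)⁻¹)`. -/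
def piPlus (a : (RapidLaurent A)ˣ) : RapidLaurent A := idet (plusMatrix a)

/-- `π⁻(a, 1, w) = det (U⁻(a, 1, w) U(a)⁻¹)`. -/
def piMinus (a : (RapidLaurent A)ˣ) : RapidLaurent A := idet (minusMatrix a)

/-- `π̃(a, w) = det (U(a) Ũ(a, w)⁻¹)`. -/
def piTilde (a : (RapidLaurent A)ˣ) : RapidLaurent A := idet (tildeMatrix a (X A))

end Definitions

end WienerHopf

end

/-! The matrices in question are built from Toeplitz matrices with rapidly decreasing symbol and
from cutoffs at the index 0. A cutoff almost commutes with a Toeplitz matrix. In the commutator only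
entries with indices on opposite sides of 0 survive (up to a shift by one), and there the distance
of the indices dominates both of them, so the commutator decreases rapidly in both indices
(`RapidSeq.rapidMatrix`, `rapid_FPlus_comm`, `rapid_signDiag_comm`). All determinants are thus
determinants of the identity, or of the bidiagonal matrix F, perturbed by a nuclear matrix.

Convergence. Both the coefficient ring and its ring of Laurent series have their topology defined by
submultiplicative seminorms (`costNorm`, `weightedNorm`), so infinite products and sums can be
estimated as over the reals. A finite permutation is determined by the part of its graph off a
relation E (the diagonal, or the support of F). If the entries are bounded by 1 + s on E and by s
off E with s summable, the sum over permutations is therefore dominated by a sum over finite sets of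
index pairs (`Control`, `Good`). The bound is uniform under truncation, so determinants are limits
of finite block determinants. Sylvester's identity det(1 + AB) = det(1 + BA) and the formula det((1
+ S)N) = det(1 + S) det N pass to the limit (`idet_one_add_mmul_comm`, `Good.hasDet_add_mmul`).

Statement (1). Put K = FU - UF. Then F U F⁻¹ U⁻¹ = 1 + K F⁻¹ U⁻¹ and U⁻¹ F U = (1 + U⁻¹ K F⁻¹) F. As
det F = 1, Sylvester's identity makes the two determinants equal (`exists_det_plus_one`). To have
entries of F of size at most 1, one first conjugates by the diagonal matrix of the powers of w,
which does not change determinants and turns w into 1 (`exists_det_plus`). Statement (2) is (1)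
reflected by n ↦ -n.

Statement (3). Half-integers are shifted to integers. Away from the index 0, Ũ(a, w) is U(a)
conjugated by a diagonal matrix with entries -w and 1 (`UTilde_eq`). Hence Ũ(a, 1) Ũ(a, w)⁻¹ = 1 +
LQM with ML = 1, where 1 + Q is the multiplicative commutator of the second factor. Sylvester's
identity gives its determinant, and multiplicativity splits off U(a) Ũ(a, 1)⁻¹
(`tilde_factorization`).

Statement (4). For finite a, the columns (or rows) outside a window are those of F or of the
identity, so the block determinants are constant as soon as the block contains the window
(`det_block_eq_of_subset`). -/

noncomputable section

namespace WienerHopf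

open StrongPolymetricRing (seminorms)

/-! ### Locally multiplicatively convex rings -/

/-- A sequentially complete topological ring whose topology is induced by submultiplicative
seminorms `ν` with `ν 1 ≤ 1`. -/
class MConvexRing (R : Type*) [CommRing R] [TopologicalSpace R] extends
    IsTopologicalRing R where
  norms : Set (RingSeminorm R)
  norm_one_le : ∀ ν ∈ norms, ν 1 ≤ 1
  nhds_eq : ∀ x : R, 𝓝 x = ⨅ ν : norms, comap (fun y => ν.1 (y - x)) (𝓝 0)
  summable_nat : ∀ f : ℕ → R, (∀ ν ∈ norms, Summable fun i => ν (f i)) → Summable f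

open MConvexRing (norms)

section MConvexRing

variable {R : Type*} [CommRing R] [TopologicalSpace R] [MConvexRing R]

lemma tendsto_iff_norms {α : Type*} {l : Filter α} {f : α → R} {x : R} :
    Tendsto f l (𝓝 x) ↔ ∀ ν ∈ norms (R := R), Tendsto (fun a => ν (f a - x)) l (𝓝 0) := by
  rw [MConvexRing.nhds_eq, tendsto_iInf]
  simp only [tendsto_comap_iff, Subtype.forall, Function.comp_def]

lemma tendsto_norm {α : Type*} {l : Filter α} {f : α → R} {x : R} (h : Tendsto f l (𝓝 x))
    {ν : RingSeminorm R} (hν : ν ∈ norms (R := R)) : Tendsto (fun a => ν (f a)) l (𝓝 (ν x)) := by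
  have h1 := tendsto_iff_norms.1 h ν hν
  rw [tendsto_iff_dist_tendsto_zero]
  refine squeeze_zero (fun _ => dist_nonneg) (fun a => ?_) h1
  rw [Real.dist_eq, abs_le]
  have h2 := map_add_le_add ν (f a - x) x
  have h3 := map_sub_le_add ν (f a) (f a - x)
  simp only [sub_add_cancel, sub_sub_cancel] at h2 h3
  constructor <;> linarith

/-- Extension by zero along an injection into ℕ reduces any countable index type to the sequences of
`MConvexRing.summable_nat`. -/
lemma summable_of_norms {β : Type*} [Countable β] {f : β → R}
    (hf : ∀ ν ∈ norms (R := R), Summable fun i => ν (f i)) : Summable f := by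
  obtain ⟨e, he⟩ := exists_injective_nat β
  have h0 : ∀ x ∉ Set.range e, Function.extend e f 0 x = 0 := fun x hx => by
    rw [Function.extend_apply' _ _ _ (by simpa using hx)]; rfl
  have h1 : f = Function.extend e f 0 ∘ e := by
    ext x; simp [he.extend_apply]
  rw [h1, he.summable_iff h0]
  refine MConvexRing.summable_nat _ fun ν hν => ?_
  rw [← he.summable_iff fun x hx => by rw [h0 x hx, map_zero]]
  refine (hf ν hν).congr fun x => ?_
  simp [he.extend_apply]

lemma norm_finset_sum_le {β : Type*} (ν : RingSeminorm R) (f : β → R) (s : Finset β) :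
    ν (∑ i ∈ s, f i) ≤ ∑ i ∈ s, ν (f i) :=
  Finset.le_sum_of_subadditive ν (map_zero ν).le (map_add_le_add ν) s f

lemma norm_finset_prod_le {β : Type*} {ν : RingSeminorm R} (hν : ν ∈ norms (R := R)) (f : β → R)
    (s : Finset β) : ν (∏ i ∈ s, f i) ≤ ∏ i ∈ s, ν (f i) := by
  classical
  induction s using Finset.induction_on with
  | empty => simpa using MConvexRing.norm_one_le ν hν
  | insert a s ha ih =>
    rw [Finset.prod_insert ha, Finset.prod_insert ha]
    exact (map_mul_le_mul ν _ _).trans (mul_le_mul_of_nonneg_left ih (apply_nonneg ν _))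

lemma norm_hasSum_le {β : Type*} {ν : RingSeminorm R} (hν : ν ∈ norms (R := R)) {f : β → R} {x : R}
    (hx : HasSum f x) {g : β → ℝ} (hg : Summable g) (h : ∀ i, ν (f i) ≤ g i) :
    ν x ≤ ∑' i, g i := by
  refine le_of_tendsto_of_tendsto' (tendsto_norm hx hν) hg.hasSum fun s => ?_
  exact (norm_finset_sum_le ν f s).trans (Finset.sum_le_sum fun i _ => h i)

lemma norm_tsum_le {β : Type*} [Countable β] {ν : RingSeminorm R} (hν : ν ∈ norms (R := R))
    {f : β → R} (hf : Summable fun i => ν (f i)) : ν (∑' i, f i) ≤ ∑' i, ν (f i) := by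
  by_cases h : Summable f
  · exact norm_hasSum_le hν h.hasSum hf fun i => le_rfl
  · rw [tsum_eq_zero_of_not_summable h, map_zero]
    exact tsum_nonneg fun i => apply_nonneg ν _

/-- Tannery's theorem. -/
lemma tendsto_tsum_of_norms [T2Space R] {α β : Type*} [Countable β] {l : Filter α} {f : α → β → R} {g : β → R}
    {b : RingSeminorm R → β → ℝ} (hb : ∀ ν ∈ norms (R := R), Summable (b ν))
    (hf : ∀ ν ∈ norms (R := R), ∀ a i, ν (f a i) ≤ b ν i)
    (hg : ∀ ν ∈ norms (R := R), ∀ i, ν (g i) ≤ b ν i)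
    (h : ∀ i, Tendsto (fun a => f a i) l (𝓝 (g i))) :
    Tendsto (fun a => ∑' i, f a i) l (𝓝 (∑' i, g i)) := by
  have hs : ∀ a, Summable (f a) := fun a => summable_of_norms fun ν hν =>
    (hb ν hν).of_nonneg_of_le (fun i => apply_nonneg ν _) (hf ν hν a)
  have hsg : Summable g := summable_of_norms fun ν hν =>
    (hb ν hν).of_nonneg_of_le (fun i => apply_nonneg ν _) (hg ν hν)
  rw [tendsto_iff_norms]
  intro ν hν
  have hle : ∀ a i, ν (f a i - g i) ≤ 2 * b ν i := fun a i => by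
    linarith [map_sub_le_add ν (f a i) (g i), hf ν hν a i, hg ν hν i]
  have h2 : Tendsto (fun a => ∑' i, ν (f a i - g i)) l (𝓝 (∑' _ : β, (0 : ℝ))) := by
    refine tendsto_tsum_of_dominated_convergence ((hb ν hν).mul_left 2)
      (fun i => tendsto_iff_norms.1 (h i) ν hν) (Eventually.of_forall fun a i => ?_)
    rw [Real.norm_of_nonneg (apply_nonneg ν _)]
    exact hle a i
  rw [tsum_zero] at h2
  refine squeeze_zero (fun _ => apply_nonneg ν _) (fun a => ?_) h2
  rw [← (hs a).tsum_sub hsg]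
  exact norm_tsum_le hν (((hb ν hν).mul_left 2).of_nonneg_of_le (fun i => apply_nonneg ν _) (hle a))

end MConvexRing

/-! ### Submultiplicative seminorms on strong polymetric rings -/

section Cost

variable {A : Type*} [CommRing A]

/-- `Cost q x c` says that `x` is a combination with signs of products of elements
with total `q`-cost `c`. -/
inductive Cost (q : A → ℝ) : A → ℝ → Prop
  | prod (l : List A) : Cost q l.prod (l.map q).prod
  | zero : Cost q 0 0
  | neg {x : A} {c : ℝ} : Cost q x c → Cost q (-x) c
  | add {x y : A} {c d : ℝ} : Cost q x c → Cost q y d → Cost q (x + y) (c + d)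

/-- Concatenation of lists multiplies both products and costs; the other cases follow by
distributivity. This makes the infimum of the costs submultiplicative. -/
lemma Cost.mul {q : A → ℝ} {x y : A} {c d : ℝ} (hx : Cost q x c) (hy : Cost q y d) :
    Cost q (x * y) (c * d) := by
  induction hy with
  | prod l =>
    induction hx with
    | prod k => simpa using Cost.prod (q := q) (k ++ l)
    | zero => simpa using Cost.zero
    | neg _ ih => simpa using ih.neg
    | add _ _ ih1 ih2 => simpa [add_mul] using ih1.add ih2
  | zero => simpa using Cost.zero
  | neg _ ih => simpa using ih.neg
  | add _ _ ih1 ih2 => simpa [mul_add] using ih1.add ih2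

lemma Cost.of {q : A → ℝ} (x : A) : Cost q x (q x) := by simpa using Cost.prod (q := q) [x]

lemma Cost.one {q : A → ℝ} : Cost q 1 1 := by simpa using Cost.prod (q := q) []

lemma Cost.nonneg {q : AddGroupSeminorm A} {x : A} {c : ℝ} (h : Cost q x c) : 0 ≤ c := by
  induction h with
  | prod l =>
    refine List.prod_nonneg fun a ha => ?_
    obtain ⟨b, -, rfl⟩ := List.mem_map.1 ha
    exact apply_nonneg q b
  | zero => rfl
  | neg _ ih => exact ih
  | add _ _ ih1 ih2 => exact add_nonneg ih1 ih2

lemma Cost.bddBelow (q : AddGroupSeminorm A) (x : A) : BddBelow {c | Cost q x c} :=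
  ⟨0, fun _ h => h.nonneg⟩

lemma Cost.exists_lt {q : AddGroupSeminorm A} {x : A} {ε : ℝ} (hε : 0 < ε) :
    ∃ c, Cost q x c ∧ c < sInf {c | Cost q x c} + ε := by
  obtain ⟨c, hc, h⟩ := exists_lt_of_csInf_lt (s := {c | Cost q x c}) ⟨_, Cost.of x⟩
    (lt_add_of_pos_right _ hε)
  exact ⟨c, hc, h⟩

/-- The largest submultiplicative seminorm below `q` whose value at `1` is at most `1`. -/
def costNorm (q : AddGroupSeminorm A) : RingSeminorm A where
  toFun x := sInf {c | Cost q x c}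
  map_zero' := le_antisymm (csInf_le (Cost.bddBelow q 0) Cost.zero)
    (Real.sInf_nonneg fun _ h => Cost.nonneg h)
  neg' x := by
    congr 1
    ext c
    exact ⟨fun h => by simpa using h.neg, fun h => h.neg⟩
  add_le' x y := by
    refine le_of_forall_pos_le_add fun ε hε => ?_
    obtain ⟨c, hc, h1⟩ := Cost.exists_lt (q := q) (x := x) (half_pos hε)
    obtain ⟨d, hd, h2⟩ := Cost.exists_lt (q := q) (x := y) (half_pos hε)
    have := csInf_le (Cost.bddBelow q _) (hc.add hd)
    linarith
  mul_le' x y := by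
    have h0 : ∀ x, 0 ≤ sInf {c | Cost q x c} := fun x => Real.sInf_nonneg fun _ h => Cost.nonneg h
    have h3 : Tendsto (fun ε : ℝ => (sInf {c | Cost q x c} + ε) * (sInf {c | Cost q y c} + ε))
        (𝓝[>] 0) (𝓝 (sInf {c | Cost q x c} * sInf {c | Cost q y c})) := by
      -- The bound for ε > 0 comes from nearly optimal representations of x and y; their product is
      -- one of x y, and ε tends to 0.
      have : Continuous fun ε : ℝ =>
          (sInf {c | Cost q x c} + ε) * (sInf {c | Cost q y c} + ε) := by fun_prop
      simpa using (this.tendsto 0).mono_left nhdsWithin_le_nhds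
    refine ge_of_tendsto h3 ?_
    filter_upwards [self_mem_nhdsWithin] with ε hε
    obtain ⟨c, hc, h1⟩ := Cost.exists_lt (q := q) (x := x) hε
    obtain ⟨d, hd, h2⟩ := Cost.exists_lt (q := q) (x := y) hε
    refine (csInf_le (Cost.bddBelow q _) (hc.mul hd)).trans ?_
    exact mul_le_mul h1.le h2.le hd.nonneg (hc.nonneg.trans h1.le)

lemma costNorm_le_of_cost {q : AddGroupSeminorm A} {x : A} {c : ℝ} (h : Cost q x c) :
    costNorm q x ≤ c := csInf_le (Cost.bddBelow q x) h

lemma costNorm_le (q : AddGroupSeminorm A) (x : A) : costNorm q x ≤ q x :=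
  costNorm_le_of_cost (Cost.of x)

/-- By induction on the representation of x. The factor 1 + p 1 pays for the empty product, which
has cost 1 but is not covered by the strong inequality. -/
lemma le_costNorm {p q : AddGroupSeminorm A}
    (h : ∀ l : List A, l ≠ [] → p l.prod ≤ (l.map q).prod) (x : A) :
    p x ≤ (1 + p 1) * costNorm q x := by
  have hp : 0 < 1 + p 1 := by linarith [apply_nonneg p 1]
  have h1 : ∀ {x c}, Cost q x c → p x ≤ (1 + p 1) * c := by
    intro x c hc
    induction hc with
    | prod l =>
      rcases eq_or_ne l [] with rfl | hl
      · simp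
      · refine (h l hl).trans (le_mul_of_one_le_left (Cost.prod (q := q) l).nonneg ?_)
        linarith [apply_nonneg p 1]
    | zero => simp
    | neg _ ih => rwa [map_neg_eq_map]
    | add _ _ ih1 ih2 =>
      rw [mul_add]
      exact (map_add_le_add p _ _).trans (add_le_add ih1 ih2)
  rw [← div_le_iff₀' hp]
  exact le_csInf ⟨_, Cost.of x⟩ fun c hc => (div_le_iff₀' hp).2 (h1 hc)

end Cost

/-! ### Strong polymetric rings are locally multiplicatively convex. -/

section Instances

variable {A : Type u} [CommRing A] [TopologicalSpace A] [StrongPolymetricRing A]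

/-- Together with `costNorm_le` this shows that the submultiplicative seminorms induce the given
topology. -/
lemma exists_le_costNorm (p : AddGroupSeminorm A) (hp : p ∈ seminorms (A := A)) :
    ∃ q ∈ seminorms (A := A), ∀ x, p x ≤ (1 + p 1) * costNorm q x := by
  obtain ⟨q, hq, h⟩ := StrongPolymetricRing.strong p hp
  exact ⟨q, hq, le_costNorm h⟩

instance StrongPolymetricRing.instMConvexRing [SequentiallyComplete A] : MConvexRing A where
  norms := costNorm '' seminorms (A := A)
  norm_one_le := by
    rintro _ ⟨q, -, rfl⟩
    exact costNorm_le_of_cost Cost.one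
  nhds_eq x := by
    refine le_antisymm ?_ ?_
    · refine le_iInf ?_
      rintro ⟨_, q, hq, rfl⟩
      rw [← tendsto_iff_comap]
      refine squeeze_zero (fun y => apply_nonneg _ _) (fun y => costNorm_le q _) ?_
      exact (tendsto_iff_seminorms (𝓝 x) id x).1 tendsto_id q hq
    · refine (tendsto_iff_seminorms _ id x).2 fun p hp => ?_
      obtain ⟨q, hq, h⟩ := exists_le_costNorm p hp
      have h1 : Tendsto (fun y => costNorm q (y - x))
          (⨅ ν : (costNorm '' seminorms (A := A)), comap (fun y => ν.1 (y - x)) (𝓝 0)) (𝓝 0) :=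
        tendsto_iff_comap.2 (iInf_le _ (⟨costNorm q, q, hq, rfl⟩ : costNorm '' seminorms (A := A)))
      have h2 := h1.const_mul (1 + p 1)
      rw [mul_zero] at h2
      exact squeeze_zero (fun y => apply_nonneg _ _) (fun y => h _) h2
  summable_nat f hf := summable_of_seminorms fun p hp => by
    obtain ⟨q, hq, h⟩ := exists_le_costNorm p hp
    exact ((hf _ ⟨q, hq, rfl⟩).mul_left _).of_nonneg_of_le (fun i => apply_nonneg p _) fun i => h _

end Instances

/-! ### Rings of rapidly decreasing Laurent series are locally multiplicatively convex. -/

namespace RapidLaurent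

section

variable {A : Type u} [CommRing A] [TopologicalSpace A] [StrongPolymetricRing A]
  [SequentiallyComplete A]

lemma summable_weight_norm (a : RapidLaurent A) {ν : RingSeminorm A} (hν : ν ∈ norms (R := A))
    (k : ℕ) : Summable fun n => wt n ^ k * ν (a.coeff n) := by
  obtain ⟨q, hq, rfl⟩ := hν
  refine (a.summable_weight q hq k).of_nonneg_of_le (fun n => ?_) fun n => ?_
  · exact mul_nonneg (pow_pos (wt_pos n) k).le (apply_nonneg _ _)
  · exact mul_le_mul_of_nonneg_left (costNorm_le q _) (pow_pos (wt_pos n) k).le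

lemma coeff_sub (a b : RapidLaurent A) (n : ℤ) : (a - b).coeff n = a.coeff n - b.coeff n := by
  rw [sub_eq_add_neg, add_coeff, neg_coeff, sub_eq_add_neg]

variable [T2Space A]

lemma summable_double_norm (a b : RapidLaurent A) {ν : RingSeminorm A} (hν : ν ∈ norms (R := A))
    (K : ℕ) :
    Summable fun x : ℤ × ℤ =>
      (wt x.2 ^ K * ν (a.coeff x.2)) * (wt (x.1 - x.2) ^ K * ν (b.coeff (x.1 - x.2))) := by
  have h := (a.summable_weight_norm hν K).mul_of_nonneg (b.summable_weight_norm hν K)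
    (fun n => mul_nonneg (pow_pos (wt_pos n) K).le (apply_nonneg ν _))
    (fun n => mul_nonneg (pow_pos (wt_pos n) K).le (apply_nonneg ν _))
  let e : ℤ × ℤ ≃ ℤ × ℤ :=
    { toFun := fun x => (x.2, x.1 - x.2)
      invFun := fun x => (x.1 + x.2, x.1)
      left_inv := fun x => by ext <;> simp
      right_inv := fun x => by ext <;> simp }
  exact (e.summable_iff (f := fun x : ℤ × ℤ =>
    (wt x.1 ^ K * ν (a.coeff x.1)) * (wt x.2 ^ K * ν (b.coeff x.2)))).2 h

/-- The submultiplicative seminorm `a ↦ ∑ₙ (1 + |n|) ^ k * ν (aₙ)`. -/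
def weightedNorm (ν : RingSeminorm A) (hν : ν ∈ norms (R := A)) (K : ℕ) :
    RingSeminorm (RapidLaurent A) where
  toFun a := ∑' n, wt n ^ K * ν (a.coeff n)
  map_zero' := by simp [zero_coeff]
  add_le' a b := by
    rw [← (a.summable_weight_norm hν K).tsum_add (b.summable_weight_norm hν K)]
    refine ((a + b).summable_weight_norm hν K).tsum_le_tsum (fun n => ?_)
      ((a.summable_weight_norm hν K).add (b.summable_weight_norm hν K))
    rw [← mul_add]
    exact mul_le_mul_of_nonneg_left (map_add_le_add ν _ _) (pow_pos (wt_pos n) K).le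
  neg' a := by simp [neg_coeff, map_neg_eq_map]
  mul_le' a b := by
    -- The usual argument for weighted convolution algebras: `wt n ≤ wt k * wt (n - k)`, and the
    -- weighted double sum factors.
    have hd := summable_double_norm a b hν K
    have hc := hd.tsum_comm (f := fun n k =>
      (wt k ^ K * ν (a.coeff k)) * (wt (n - k) ^ K * ν (b.coeff (n - k))))
    have he : (∑' n, wt n ^ K * ν (a.coeff n)) * ∑' n, wt n ^ K * ν (b.coeff n) =
        ∑' n, ∑' k, (wt k ^ K * ν (a.coeff k)) * (wt (n - k) ^ K * ν (b.coeff (n - k))) := by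
      rw [← hc, ← tsum_mul_right]
      refine tsum_congr fun k => ?_
      rw [tsum_mul_left]
      congr 1
      exact ((Equiv.subRight k).tsum_eq (fun m => wt m ^ K * ν (b.coeff m))).symm
    rw [he]
    refine ((a * b).summable_weight_norm hν K).tsum_le_tsum (fun n => ?_) hd.prod
    have h1 := hd.comp_injective (i := fun k : ℤ => (n, k)) (fun x y hxy => by simpa using hxy)
    have hw : 0 < wt n ^ K := pow_pos (wt_pos n) K
    have h2 : ∀ k, ν (a.coeff k * b.coeff (n - k)) ≤ (wt n ^ K)⁻¹ *
        ((wt k ^ K * ν (a.coeff k)) * (wt (n - k) ^ K * ν (b.coeff (n - k)))) := by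
      intro k
      rw [← div_eq_inv_mul, le_div_iff₀ hw]
      have hwk : wt n ^ K ≤ wt k ^ K * wt (n - k) ^ K := by
        rw [← mul_pow]
        refine pow_le_pow_left₀ (wt_pos n).le ?_ K
        simpa using wt_add k (n - k)
      calc _ ≤ (ν (a.coeff k) * ν (b.coeff (n - k))) * (wt k ^ K * wt (n - k) ^ K) :=
            mul_le_mul (map_mul_le_mul ν _ _) hwk hw.le
              (mul_nonneg (apply_nonneg ν _) (apply_nonneg ν _))
        _ = _ := by ring
    have h3 := norm_hasSum_le hν (summable_conv a b n).hasSum (h1.mul_left _) h2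
    rw [tsum_mul_left, ← div_eq_inv_mul, le_div_iff₀ hw] at h3
    rw [mul_coeff, mul_comm]
    exact h3

lemma weightedNorm_apply {ν : RingSeminorm A} (hν : ν ∈ norms (R := A)) (K : ℕ)
    (a : RapidLaurent A) : weightedNorm ν hν K a = ∑' n, wt n ^ K * ν (a.coeff n) := rfl

lemma weightedNorm_single {ν : RingSeminorm A} (hν : ν ∈ norms (R := A)) (K : ℕ) (n : ℤ) (c : A) :
    weightedNorm ν hν K (single n c) = wt n ^ K * ν c := by
  rw [weightedNorm_apply, tsum_eq_single n]
  · simp [single_coeff]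
  · intro m hm
    simp [single_coeff, hm]

lemma weightedNorm_C {ν : RingSeminorm A} (hν : ν ∈ norms (R := A)) (K : ℕ) (c : A) :
    weightedNorm ν hν K (C c) = ν c :=
  (weightedNorm_single hν K 0 c).trans (by simp [wt])

/-- The limit is formed coefficientwise. All estimates rest on absolute summability of the double
family of the weighted coefficients, indexed by the terms and the exponents. -/
lemma summable_of_weightedNorm (f : ℕ → RapidLaurent A)
    (hf : ∀ (ν : RingSeminorm A) (hν : ν ∈ norms (R := A)) (K : ℕ),
      Summable fun i => weightedNorm ν hν K (f i)) :
    ∃ g : RapidLaurent A, ∀ (ν : RingSeminorm A) (hν : ν ∈ norms (R := A)) (K : ℕ),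
      Tendsto (fun s : Finset ℕ => weightedNorm ν hν K (∑ i ∈ s, f i - g)) atTop (𝓝 0) := by
  have hd : ∀ (ν : RingSeminorm A) (_ : ν ∈ norms (R := A)) (K : ℕ),
      Summable fun x : ℕ × ℤ => wt x.2 ^ K * ν ((f x.1).coeff x.2) := fun ν hν K =>
    (summable_prod_of_nonneg fun x => mul_nonneg (pow_pos (wt_pos _) K).le (apply_nonneg ν _)).2
      ⟨fun i => (f i).summable_weight_norm hν K, hf ν hν K⟩
  have hdn : ∀ (ν : RingSeminorm A) (_ : ν ∈ norms (R := A)) (K : ℕ) (n : ℤ),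
      Summable fun i => wt n ^ K * ν ((f i).coeff n) := fun ν hν K n =>
    (hd ν hν K).comp_injective (i := fun i : ℕ => (i, n)) fun x y hxy => by simpa using hxy
  have hdn' : ∀ (ν : RingSeminorm A) (_ : ν ∈ norms (R := A)) (n : ℤ),
      Summable fun i => ν ((f i).coeff n) := fun ν hν n => by simpa using hdn ν hν 0 n
  have hs : ∀ n, Summable fun i => (f i).coeff n := fun n =>
    summable_of_norms fun ν hν => hdn' ν hν n
  refine ⟨⟨fun n => ∑' i, (f i).coeff n, fun p hp k => ?_⟩, fun ν hν K => ?_⟩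
  -- Rapid decrease is defined by the original seminorms, hence the passage through `costNorm`.
  · obtain ⟨q, hq, h⟩ := exists_le_costNorm p hp
    have hν : costNorm q ∈ norms (R := A) := ⟨q, hq, rfl⟩
    refine ⟨(1 + p 1) * ∑' x : ℕ × ℤ, wt x.2 ^ k * costNorm q ((f x.1).coeff x.2), fun n => ?_⟩
    have h1 : wt n ^ k * costNorm q (∑' i, (f i).coeff n) ≤
        ∑' x : ℕ × ℤ, wt x.2 ^ k * costNorm q ((f x.1).coeff x.2) := by
      refine (mul_le_mul_of_nonneg_left (norm_tsum_le hν (hdn' _ hν n))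
        (pow_pos (wt_pos n) k).le).trans ?_
      rw [← tsum_mul_left]
      refine (hdn _ hν k n).tsum_le_tsum_of_inj (fun i => (i, n))
        (fun x y hxy => by simpa using hxy)
        (fun x _ => mul_nonneg (pow_pos (wt_pos _) k).le (apply_nonneg _ _))
        (fun i => le_rfl) (hd _ hν k)
    have hp1 : 0 ≤ 1 + p 1 := by linarith [apply_nonneg p 1]
    calc _ ≤ wt n ^ k * ((1 + p 1) * costNorm q (∑' i, (f i).coeff n)) :=
          mul_le_mul_of_nonneg_left (h _) (pow_pos (wt_pos n) k).le
      _ = (1 + p 1) * (wt n ^ k * costNorm q (∑' i, (f i).coeff n)) := by ring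
      _ ≤ _ := mul_le_mul_of_nonneg_left h1 hp1
  -- The distance to a partial sum is at most the tail of the series of norms, once the sums over i
  -- and n are exchanged.
  · have h1 : Tendsto (fun s : Finset ℕ => ∑' i : {x // x ∉ s}, weightedNorm ν hν K (f i)) atTop
        (𝓝 0) := tendsto_tsum_compl_atTop_zero fun i => weightedNorm ν hν K (f i)
    refine squeeze_zero (fun s => apply_nonneg _ _) (fun s => ?_) h1
    have hds := (hd ν hν K).comp_injective (i := fun x : {x // x ∉ s} × ℤ => (x.1.1, x.2))
      (fun x y hxy => by
        simp only [Prod.mk.injEq] at hxy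
        exact Prod.ext (Subtype.ext hxy.1) hxy.2)
    simp only [Function.comp_def] at hds
    have hcm := hds.tsum_comm (f := fun (i : {x // x ∉ s}) (n : ℤ) =>
      wt n ^ K * ν ((f i).coeff n))
    have hsw : Summable fun x : ℤ × {x // x ∉ s} => wt x.1 ^ K * ν ((f x.2).coeff x.1) :=
      (Equiv.prodComm _ _).summable_iff.1 hds
    have hcoe : ∀ n, (∑ i ∈ s, f i).coeff n = ∑ i ∈ s, (f i).coeff n := fun n =>
      map_sum (⟨⟨fun a => a.coeff n, rfl⟩, fun a b => rfl⟩ : RapidLaurent A →+ A) f s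
    simp only [weightedNorm_apply]
    rw [← hcm]
    refine (summable_weight_norm _ hν K).tsum_le_tsum (fun n => ?_) hsw.prod
    rw [coeff_sub, hcoe, tsum_mul_left]
    refine mul_le_mul_of_nonneg_left ?_ (pow_pos (wt_pos n) K).le
    have e := (hs n).sum_add_tsum_compl (s := s)
    have e2 : ∑ i ∈ s, (f i).coeff n - ∑' i, (f i).coeff n =
        - ∑' i : {x // x ∉ s}, (f i).coeff n := by
      rw [← e]
      simp only [sub_add_cancel_left]
      rfl
    rw [e2, map_neg_eq_map]
    exact norm_tsum_le hν ((hdn' ν hν n).comp_injective Subtype.val_injective)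

instance : MConvexRing (RapidLaurent A) where
  norms := {P | ∃ (ν : RingSeminorm A) (hν : ν ∈ norms (R := A)) (K : ℕ), P = weightedNorm ν hν K}
  norm_one_le := by
    rintro _ ⟨ν, hν, K, rfl⟩
    rw [← map_one C, weightedNorm_C]
    exact MConvexRing.norm_one_le ν hν
  nhds_eq x := by
    refine le_antisymm ?_ ?_
    · refine le_iInf ?_
      rintro ⟨_, _, ⟨q, hq, rfl⟩, K, rfl⟩
      rw [← tendsto_iff_comap]
      refine squeeze_zero (fun y => apply_nonneg _ _) (fun y => ?_)
        ((tendsto_iff (𝓝 x) id x).1 tendsto_id q hq K)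
      refine (summable_weight_norm _ ⟨q, hq, rfl⟩ K).tsum_le_tsum (fun n => ?_)
        (summable_weight _ q hq K)
      exact mul_le_mul_of_nonneg_left (costNorm_le q _) (pow_pos (wt_pos n) K).le
    · refine (tendsto_iff _ id x).2 fun p hp K => ?_
      obtain ⟨q, hq, h⟩ := exists_le_costNorm p hp
      have hν : costNorm q ∈ norms (R := A) := ⟨q, hq, rfl⟩
      have h1 : Tendsto (fun y => weightedNorm (costNorm q) hν K (y - x))
          (⨅ ν : {P : RingSeminorm (RapidLaurent A) |
            ∃ (ν : RingSeminorm A) (hν : ν ∈ norms (R := A)) (K : ℕ), P = weightedNorm ν hν K},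
            comap (fun y => ν.1 (y - x)) (𝓝 0)) (𝓝 0) :=
        tendsto_iff_comap.2 (iInf_le _ (⟨_, _, hν, K, rfl⟩ :
          {P : RingSeminorm (RapidLaurent A) |
            ∃ (ν : RingSeminorm A) (hν : ν ∈ norms (R := A)) (K : ℕ), P = weightedNorm ν hν K}))
      have h2 := h1.const_mul (1 + p 1)
      rw [mul_zero] at h2
      refine squeeze_zero (fun y => apply_nonneg _ _) (fun y => ?_) h2
      rw [weighted_apply, weightedNorm_apply, ← tsum_mul_left]
      refine (summable_weight _ p hp K).tsum_le_tsum (fun n => ?_)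
        ((summable_weight_norm _ hν K).mul_left _)
      calc _ ≤ wt n ^ K * ((1 + p 1) * costNorm q ((y - x).coeff n)) :=
            mul_le_mul_of_nonneg_left (h _) (pow_pos (wt_pos n) K).le
        _ = _ := by ring
  summable_nat f hf := by
    obtain ⟨g, hg⟩ := summable_of_weightedNorm f fun ν hν K => hf _ ⟨ν, hν, K, rfl⟩
    refine ⟨g, ?_⟩
    rw [HasSum, SummationFilter.unconditional_filter, tendsto_iff]
    intro p hp K
    obtain ⟨q, hq, h⟩ := exists_le_costNorm p hp
    have hν : costNorm q ∈ norms (R := A) := ⟨q, hq, rfl⟩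
    have h2 := (hg _ hν K).const_mul (1 + p 1)
    rw [mul_zero] at h2
    refine squeeze_zero (fun y => apply_nonneg _ _) (fun y => ?_) h2
    rw [weighted_apply, weightedNorm_apply, ← tsum_mul_left]
    refine (summable_weight _ p hp K).tsum_le_tsum (fun n => ?_)
      ((summable_weight_norm _ hν K).mul_left _)
    calc _ ≤ wt n ^ K * ((1 + p 1) * costNorm q ((∑ i ∈ y, f i - g).coeff n)) :=
          mul_le_mul_of_nonneg_left (h _) (pow_pos (wt_pos n) K).le
      _ = _ := by ring

end

end RapidLaurent

/-! ### Finite permutations -/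

section FinPerm

variable {ι : Type*}

open scoped Classical in
/-- The permutations of a finite subset, as finite permutations. -/
def FinPerm.ofFinset (T : Finset ι) (τ : Equiv.Perm T) : FinPerm ι :=
  ⟨Equiv.Perm.ofSubtype τ, T.finite_toSet.subset fun i hi => by
    by_contra h
    exact hi (Equiv.Perm.ofSubtype_apply_of_not_mem τ h)⟩

lemma FinPerm.ofFinset_apply (T : Finset ι) (τ : Equiv.Perm T) (i : T) :
    (FinPerm.ofFinset T τ).1 i = τ i := by
  classical
  simp [FinPerm.ofFinset]

lemma FinPerm.ofFinset_apply_of_notMem (T : Finset ι) (τ : Equiv.Perm T) {i : ι} (hi : i ∉ T) :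
    (FinPerm.ofFinset T τ).1 i = i := by
  classical
  exact Equiv.Perm.ofSubtype_apply_of_not_mem τ hi

lemma FinPerm.ofFinset_injective (T : Finset ι) : Function.Injective (FinPerm.ofFinset T) :=
  fun τ τ' h => by
    ext i
    rw [← FinPerm.ofFinset_apply, h, FinPerm.ofFinset_apply]

lemma FinPerm.exists_ofFinset (T : Finset ι) (σ : FinPerm ι) (h : ∀ i ∉ T, σ.1 i = i) :
    ∃ τ, FinPerm.ofFinset T τ = σ := by
  classical
  have h1 : ∀ i, σ.1 i ∈ T ↔ i ∈ T := fun i => by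
    constructor
    · intro hi
      by_contra hc
      rw [h i hc] at hi
      exact hc hi
    · intro hi
      by_contra hc
      have := σ.1.injective (h _ hc)
      rw [this] at hc
      exact hc hi
  refine ⟨σ.1.subtypePerm h1, Subtype.ext ?_⟩
  exact Equiv.Perm.ofSubtype_subtypePerm h1 fun i hi => by
    by_contra hc
    exact hi (h i hc)

lemma FinPerm.sign_eq [DecidableEq ι] (σ : FinPerm ι) [Fintype {i // σ.1 i ≠ i}] :
    σ.sign = (Equiv.Perm.sign
      (σ.1.subtypePerm (p := fun i => σ.1 i ≠ i) fun _ => not_congr σ.1.apply_eq_iff_eq) : ℤ) := by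
  unfold FinPerm.sign
  congr!

/-- One sign is computed on the moved points and the other on T; the fixed points in T make no
difference. -/
lemma FinPerm.sign_ofFinset [DecidableEq ι] (T : Finset ι) (τ : Equiv.Perm T) :
    (FinPerm.ofFinset T τ).sign = (Equiv.Perm.sign τ : ℤ) := by
  have : Finite {i // (FinPerm.ofFinset T τ).1 i ≠ i} := (FinPerm.ofFinset T τ).2
  have := Fintype.ofFinite {i // (FinPerm.ofFinset T τ).1 i ≠ i}
  rw [FinPerm.sign_eq]
  congr 1
  have hm : ∀ x : ι, (FinPerm.ofFinset T τ).1 x ≠ x → x ∈ T := fun x hx => by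
    by_contra hc
    exact hx (FinPerm.ofFinset_apply_of_notMem T τ hc)
  refine Equiv.Perm.sign_bij (fun x _ => (⟨x.1, hm x.1 x.2⟩ : T)) ?_ ?_ ?_
  · intro x hx hx'
    ext
    exact FinPerm.ofFinset_apply T τ ⟨x.1, hm x.1 x.2⟩
  · intro x y hx hy h
    ext
    simpa using h
  · intro y hy
    have h1 : (FinPerm.ofFinset T τ).1 y ≠ y := by
      rw [FinPerm.ofFinset_apply]
      exact fun h => hy (Subtype.ext h)
    refine ⟨⟨y, h1⟩, fun h => h1 (congrArg Subtype.val h), rfl⟩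

lemma FinPerm.sign_eq_or (σ : FinPerm ι) : σ.sign = 1 ∨ σ.sign = -1 := by
  classical
  have : Finite {i // σ.1 i ≠ i} := σ.2
  have := Fintype.ofFinite {i // σ.1 i ≠ i}
  rw [FinPerm.sign_eq]
  rcases Int.units_eq_one_or (Equiv.Perm.sign
    (σ.1.subtypePerm (p := fun i => σ.1 i ≠ i) fun _ => not_congr σ.1.apply_eq_iff_eq)) with h | h
  · left; rw [h]; rfl
  · right; rw [h]; rfl

/-- Transport of finite permutations along a bijection. -/
def FinPerm.congr {κ : Type*} (e : κ ≃ ι) : FinPerm κ ≃ FinPerm ι :=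
  e.permCongr.subtypeEquiv fun σ => by
    have : {i | e.permCongr σ i ≠ i} = e '' {i | σ i ≠ i} := by
      ext i
      simp [Equiv.permCongr_apply, ← Equiv.eq_symm_apply]
    rw [this, Set.finite_image_iff e.injective.injOn]

lemma FinPerm.congr_apply {κ : Type*} (e : κ ≃ ι) (σ : FinPerm κ) (i : ι) :
    (FinPerm.congr e σ).1 i = e (σ.1 (e.symm i)) := rfl

lemma FinPerm.sign_congr {κ : Type*} (e : κ ≃ ι) (σ : FinPerm κ) :
    (FinPerm.congr e σ).sign = σ.sign := by
  classical
  have : Finite {i // σ.1 i ≠ i} := σ.2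
  have := Fintype.ofFinite {i // σ.1 i ≠ i}
  have : Finite {i // (FinPerm.congr e σ).1 i ≠ i} := (FinPerm.congr e σ).2
  have := Fintype.ofFinite {i // (FinPerm.congr e σ).1 i ≠ i}
  rw [FinPerm.sign_eq, FinPerm.sign_eq]
  congr 1
  symm
  refine Equiv.Perm.sign_eq_sign_of_equiv _ _ (e.subtypeEquiv fun i => ?_) fun x => ?_
  · simp [FinPerm.congr_apply]
  · refine Subtype.ext ?_
    change e (σ.1 x.1) = e (σ.1 (e.symm (e x.1)))
    rw [e.symm_apply_apply]

end FinPerm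

/-! ### Elementary properties of determinants -/

section Det

variable {ι R : Type*} [CommRing R] [TopologicalSpace R]

lemma HasDet.idet_eq [T2Space R] {M : Matrix ι ι R} {d : R} (h : HasDet M d) : idet M = d :=
  h.2.tsum_eq

/-- Serves for the reflection n ↦ -n and for the passage from integers to half-integers. -/
lemma HasDet.reindex {κ : Type*} (e : κ ≃ ι) {M : Matrix ι ι R} {d : R} (h : HasDet M d) :
    HasDet (M.submatrix e e) d := by
  have h1 : ∀ σ : FinPerm κ, (fun i => M.submatrix e e i (σ.1 i)) =
      (fun i => M i ((FinPerm.congr e σ).1 i)) ∘ e := by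
    intro σ
    ext i
    simp [FinPerm.congr_apply]
  refine ⟨fun σ => ?_, ?_⟩
  · rw [h1]
    refine (e.multipliable_iff (f := fun i => M i ((FinPerm.congr e σ).1 i))).2 ?_
    exact h.1 _
  · have h2 : detTerm (M.submatrix e e) = detTerm M ∘ FinPerm.congr e := by
      ext σ
      rw [Function.comp_apply, detTerm, detTerm, FinPerm.sign_congr, h1]
      congr 1
      exact e.tprod_eq fun i => M i ((FinPerm.congr e σ).1 i)
    rw [h2, (FinPerm.congr e).hasSum_iff]
    exact h.2

/-- Conjugation by a diagonal matrix. -/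
def dconj (d : ι → Rˣ) (M : Matrix ι ι R) : Matrix ι ι R :=
  fun i j => d i * M i j * ↑(d j)⁻¹

/-- Each term is left unchanged: the extra factors `u i * (u (σ i))⁻¹` are 1 at the fixed points,
and their product over the finitely many moved points is 1 because σ permutes these points. -/
lemma HasDet.dconj [IsTopologicalRing R] [T2Space R] (u : ι → Rˣ) {M : Matrix ι ι R} {d : R}
    (h : HasDet M d) : HasDet (dconj u M) d := by
  have key : ∀ σ : FinPerm ι, HasProd (fun i => WienerHopf.dconj u M i (σ.1 i))
      (∏' i, M i (σ.1 i)) := by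
    intro σ
    have h0 : ∀ i ∉ σ.2.toFinset, (u i : R) * ↑(u (σ.1 i))⁻¹ = 1 := fun i hi => by
      have : σ.1 i = i := by simpa using hi
      rw [this, Units.mul_inv]
    have h1 := hasProd_prod_of_ne_finset_one (L := .unconditional ι) h0
    have h2 : ∏ i ∈ σ.2.toFinset, (u i : R) * ↑(u (σ.1 i))⁻¹ = 1 := by
      have h3 : ∏ i ∈ σ.2.toFinset, (↑(u (σ.1 i))⁻¹ : R) = ∏ i ∈ σ.2.toFinset, ↑(u i)⁻¹ := by
        refine Finset.prod_bij (fun i _ => σ.1 i) ?_ ?_ ?_ ?_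
        · intro i hi
          simpa using hi
        · intro i _ j _ hij
          exact σ.1.injective hij
        · intro i hi
          refine ⟨σ.1.symm i, ?_, by simp⟩
          have : σ.1 i ≠ i := by simpa using hi
          simpa [Equiv.eq_symm_apply] using this
        · intro i _
          rfl
      rw [Finset.prod_mul_distrib, h3, ← Finset.prod_mul_distrib]
      exact Finset.prod_eq_one fun i _ => Units.mul_inv _
    rw [h2] at h1
    have h3 := (h.1 σ).hasProd.mul h1
    rw [mul_one] at h3
    convert h3 using 2 with i
    unfold WienerHopf.dconj
    ring
  refine ⟨fun σ => (key σ).multipliable, ?_⟩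
  convert h.2 using 1
  ext σ
  rw [detTerm, detTerm, (key σ).tprod_eq]

lemma dconj_inv_dconj (u : ι → Rˣ) (M : Matrix ι ι R) : dconj u⁻¹ (dconj u M) = M := by
  ext i j
  simp only [dconj, Pi.inv_apply, inv_inv]
  calc _ = (↑(u i)⁻¹ * ↑(u i) : R) * M i j * (↑(u j)⁻¹ * ↑(u j)) := by ring
    _ = _ := by simp

lemma hasDet_dconj_iff [IsTopologicalRing R] [T2Space R] (u : ι → Rˣ) {M : Matrix ι ι R} {d : R} :
    HasDet (dconj u M) d ↔ HasDet M d :=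
  ⟨fun h => by simpa [dconj_inv_dconj] using h.dconj u⁻¹, fun h => h.dconj u⟩

lemma dconj_mmul [IsTopologicalRing R] [T2Space R] (u : ι → Rˣ) (M N : Matrix ι ι R) :
    dconj u (M ⊠ N) = dconj u M ⊠ dconj u N := by
  ext i k
  have h := tsum_const_smul' (L := .unconditional ι) (u i * (u k)⁻¹) (f := fun j => M i j * N j k)
  simp only [dconj, mmul]
  rw [show ((u i : R) * (∑' j, M i j * N j k) * ↑(u k)⁻¹) =
    (u i * (u k)⁻¹) • ∑' j, M i j * N j k by
      rw [Units.smul_def, smul_eq_mul, Units.val_mul]; ring, ← h]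
  refine tsum_congr fun j => ?_
  rw [Units.smul_def, smul_eq_mul, Units.val_mul]
  calc _ = (u i : R) * (M i j * N j k) * ↑(u k)⁻¹ * 1 := by ring
    _ = (u i : R) * (M i j * N j k) * ↑(u k)⁻¹ * (↑(u j)⁻¹ * ↑(u j)) := by rw [Units.inv_mul]
    _ = _ := by ring

lemma reindex_mmul {κ : Type*} (e : κ ≃ ι) (M N : Matrix ι ι R) :
    (M ⊠ N).submatrix e e = M.submatrix e e ⊠ N.submatrix e e := by
  ext i k
  simp only [mmul, Matrix.submatrix_apply]
  exact (e.tsum_eq fun j => M (e i) j * N j (e k)).symm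

/-- Matrices that agree with the identity outside a finite block. -/
def IdOff (T : Finset ι) [DecidableEq ι] (M : Matrix ι ι R) : Prop :=
  ∀ i j, (i ∉ T ∨ j ∉ T) → M i j = (1 : Matrix ι ι R) i j

/-- A permutation that moves an index outside T picks up a zero entry, so only the permutations of T
contribute. -/
lemma IdOff.idet_eq [T2Space R] [DecidableEq ι] {T : Finset ι} {M : Matrix ι ι R}
    (h : IdOff T M) : idet M = (block T M).det := by
  have h0 : Function.support (detTerm M) ⊆ Set.range (FinPerm.ofFinset T) := by
    intro σ hσ
    refine FinPerm.exists_ofFinset T σ fun i hi => ?_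
    by_contra hc
    refine hσ ?_
    rw [detTerm, tprod_of_exists_eq_zero ⟨i, ?_⟩, mul_zero]
    rw [h _ _ (Or.inl hi), Matrix.one_apply_ne (Ne.symm hc)]
  -- The terms here contain `M i (σ i)`, those of `Matrix.det_apply'` contain `M (σ i) i`; hence the
  -- transpose.
  rw [idet, ← (FinPerm.ofFinset_injective T).tsum_eq h0, tsum_fintype, ← Matrix.det_transpose,
    Matrix.det_apply']
  refine Finset.sum_congr rfl fun τ _ => ?_
  rw [detTerm, FinPerm.sign_ofFinset]
  congr 1
  rw [tprod_eq_prod (s := T), ← Finset.prod_coe_sort]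
  · refine Finset.prod_congr rfl fun i _ => ?_
    rw [FinPerm.ofFinset_apply]
    rfl
  · intro i hi
    rw [h _ _ (Or.inl hi), FinPerm.ofFinset_apply_of_notMem T τ hi, Matrix.one_apply_eq]

end Det

/-! ### Infinite products -/

section Products

variable {R : Type*} [CommRing R] [TopologicalSpace R] [MConvexRing R]

/-- Expanding ∏ (1 + (f i - 1)) gives a sum over finite subsets, which converges absolutely. -/
lemma multipliable_of_norms {β : Type*} [Countable β] {f : β → R}
    (hf : ∀ ν ∈ norms (R := R), Summable fun i => ν (f i - 1)) : Multipliable f := by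
  have h : Summable fun s : Finset β => ∏ i ∈ s, (f i - 1) := summable_of_norms fun ν hν =>
    (summable_finsetProd_of_summable_nonneg (fun i => apply_nonneg ν _) (hf ν hν)).of_nonneg_of_le
      (fun s => apply_nonneg ν _) fun s => norm_finset_prod_le hν _ s
  simpa using multipliable_one_add_of_summable_prod h

/-- Telescoping: one factor at a time is exchanged, the others being bounded by `1 + c`. -/
lemma norm_prod_sub_prod_le {β : Type*} {ν : RingSeminorm R} (hν : ν ∈ norms (R := R))
    (s : Finset β) {f g : β → R} {c : β → ℝ} (hc : ∀ i, 0 ≤ c i) (hf : ∀ i, ν (f i) ≤ 1 + c i)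
    (hg : ∀ i, ν (g i) ≤ 1 + c i) :
    ν (∏ i ∈ s, f i - ∏ i ∈ s, g i) ≤ (∏ i ∈ s, (1 + c i)) * ∑ i ∈ s, ν (f i - g i) := by
  classical
  induction s using Finset.induction_on with
  | empty => simp
  | insert a s ha ih =>
    rw [Finset.prod_insert ha, Finset.prod_insert ha, Finset.prod_insert ha, Finset.sum_insert ha]
    have e : f a * ∏ i ∈ s, f i - g a * ∏ i ∈ s, g i =
      f a * (∏ i ∈ s, f i - ∏ i ∈ s, g i) + (f a - g a) * ∏ i ∈ s, g i := by ring
    have hp : 0 ≤ ∏ i ∈ s, (1 + c i) := Finset.prod_nonneg fun i _ => by linarith [hc i]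
    have hs : 0 ≤ ∑ i ∈ s, ν (f i - g i) := Finset.sum_nonneg fun i _ => apply_nonneg ν _
    have h1 : ν (∏ i ∈ s, g i) ≤ ∏ i ∈ s, (1 + c i) := (norm_finset_prod_le hν g s).trans
      (Finset.prod_le_prod (fun i _ => apply_nonneg ν _) fun i _ => hg i)
    rw [e]
    refine (map_add_le_add ν _ _).trans ?_
    have h2 := (map_mul_le_mul ν (f a) (∏ i ∈ s, f i - ∏ i ∈ s, g i)).trans
      (mul_le_mul (hf a) ih (apply_nonneg ν _) (by linarith [hc a]))
    have h3 := (map_mul_le_mul ν (f a - g a) (∏ i ∈ s, g i)).trans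
      (mul_le_mul_of_nonneg_left h1 (apply_nonneg ν _))
    have h4 : ν (f a - g a) * ∏ i ∈ s, (1 + c i) ≤
        (1 + c a) * (ν (f a - g a) * ∏ i ∈ s, (1 + c i)) :=
      le_mul_of_one_le_left (mul_nonneg (apply_nonneg ν _) hp) (by linarith [hc a])
    linarith

lemma prod_one_add_le_exp_tsum {β : Type*} {c : β → ℝ} (hc : ∀ i, 0 ≤ c i) (hs : Summable c)
    (s : Finset β) : ∏ i ∈ s, (1 + c i) ≤ Real.exp (∑' i, c i) := by
  refine (Finset.prod_le_prod (fun i _ => by linarith [hc i]) fun i _ =>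
    (add_comm 1 (c i)).trans_le (Real.add_one_le_exp (c i))).trans ?_
  rw [← Real.exp_sum]
  exact Real.exp_le_exp.2 (hs.sum_le_tsum s fun i _ => hc i)

lemma norm_tprod_sub_tprod_le {β : Type*} {ν : RingSeminorm R} (hν : ν ∈ norms (R := R))
    {f g : β → R} (hfm : Multipliable f) (hgm : Multipliable g)
    {c : β → ℝ} (hc : ∀ i, 0 ≤ c i) (hs : Summable c) (hf : ∀ i, ν (f i) ≤ 1 + c i)
    (hg : ∀ i, ν (g i) ≤ 1 + c i) (hd : Summable fun i => ν (f i - g i)) :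
    ν (∏' i, f i - ∏' i, g i) ≤ Real.exp (∑' i, c i) * ∑' i, ν (f i - g i) := by
  have h1 := tendsto_norm (hfm.hasProd.sub hgm.hasProd) hν
  refine le_of_tendsto' h1 fun s => (norm_prod_sub_prod_le hν s hc hf hg).trans ?_
  exact mul_le_mul (prod_one_add_le_exp_tsum hc hs s)
    (hd.sum_le_tsum s fun i _ => apply_nonneg ν _) (Finset.sum_nonneg fun i _ => apply_nonneg ν _)
    (Real.exp_pos _).le

end Products

/-! ### Absolutely convergent determinants -/

section Good

variable {ι R : Type*} [CommRing R] [TopologicalSpace R] [MConvexRing R]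

/-- The hypotheses on a relation `E` and a family of weights `s` under which determinants of
matrices of size `1 + s` on `E` and of size `s` off `E` converge. -/
structure Control (R : Type*) [CommRing R] [TopologicalSpace R] [MConvexRing R]
    (E : ι → ι → Prop) (s : RingSeminorm R → ι × ι → ℝ) : Prop where
  refl : ∀ i, E i i
  inj : ∀ σ τ : FinPerm ι,
    (∀ i, (¬ E i (σ.1 i) ∨ ¬ E i (τ.1 i)) → σ.1 i = τ.1 i) → σ = τ
  nonneg : ∀ ν ∈ norms (R := R), ∀ x, 0 ≤ s ν x
  summable : ∀ ν ∈ norms (R := R), Summable (s ν)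

/-- Matrices of size `1 + s` on `E` and of size `s` off `E`, with diagonal close to `1`. -/
structure Good (E : ι → ι → Prop) (s : RingSeminorm R → ι × ι → ℝ) (M : Matrix ι ι R) : Prop where
  diag : ∀ ν ∈ norms (R := R), ∀ i, ν (M i i - 1) ≤ s ν (i, i)
  le_one_add : ∀ ν ∈ norms (R := R), ∀ i j, ν (M i j) ≤ 1 + s ν (i, j)
  le : ∀ ν ∈ norms (R := R), ∀ i j, ¬ E i j → ν (M i j) ≤ s ν (i, j)

variable {E : ι → ι → Prop} {s : RingSeminorm R → ι × ι → ℝ}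

open scoped Classical in
/-- The part of the graph of `σ` off `E`. -/
def offGraph (E : ι → ι → Prop) (σ : FinPerm ι) : Finset (ι × ι) :=
  (σ.2.toFinset.filter fun i => ¬ E i (σ.1 i)).map
    ⟨fun i => (i, σ.1 i), fun i j h => (Prod.ext_iff.1 h).1⟩

lemma Control.mem_offGraph (hE : Control R E s) (σ : FinPerm ι) (i j : ι) :
    (i, j) ∈ offGraph E σ ↔ j = σ.1 i ∧ ¬ E i j := by
  simp only [offGraph, Finset.mem_map, Finset.mem_filter, Set.Finite.mem_toFinset,
    Set.mem_ofPred_eq]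
  constructor
  · rintro ⟨k, ⟨h1, h2⟩, h3⟩
    obtain ⟨rfl, rfl⟩ := Prod.ext_iff.1 h3
    exact ⟨rfl, h2⟩
  · rintro ⟨rfl, h⟩
    refine ⟨i, ⟨fun h1 => h ?_, h⟩, rfl⟩
    rw [h1]
    exact hE.refl i

/-- This is what `Control.inj` is for: permutations become finite subsets of ι × ι, over which
products of summable weights can be summed. -/
lemma Control.offGraph_injective (hE : Control R E s) : Function.Injective (offGraph E) := by
  intro σ τ h
  refine hE.inj σ τ fun i hi => ?_
  rcases hi with hi | hi
  · have := (hE.mem_offGraph σ i _).2 ⟨rfl, hi⟩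
    rw [h, hE.mem_offGraph] at this
    exact this.1
  · have := (hE.mem_offGraph τ i _).2 ⟨rfl, hi⟩
    rw [← h, hE.mem_offGraph] at this
    exact this.1.symm

lemma Control.countable [Countable ι] (hE : Control R E s) : Countable (FinPerm ι) :=
  hE.offGraph_injective.countable

lemma Control.summable_perm (hE : Control R E s) (σ : FinPerm ι) {ν : RingSeminorm R}
    (hν : ν ∈ norms (R := R)) : Summable fun i => s ν (i, σ.1 i) :=
  (hE.summable ν hν).comp_injective (i := fun i => (i, σ.1 i)) fun i j h => (Prod.ext_iff.1 h).1

/-- All but finitely many factors are diagonal entries, whose distance to 1 is controlled by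
`Good.diag`. -/
lemma Good.summable_sub_one {M : Matrix ι ι R} (hE : Control R E s) (hM : Good E s M)
    (σ : FinPerm ι) {ν : RingSeminorm R} (hν : ν ∈ norms (R := R)) :
    Summable fun i => ν (M i (σ.1 i) - 1) := by
  refine (hE.summable_perm σ hν).of_norm_bounded_eventually ?_
  rw [Filter.eventually_cofinite]
  refine σ.2.subset fun i hi h => hi ?_
  rw [Real.norm_of_nonneg (apply_nonneg ν _), h]
  exact hM.diag ν hν i

lemma Good.multipliable [Countable ι] {M : Matrix ι ι R} (hE : Control R E s) (hM : Good E s M)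
    (σ : FinPerm ι) : Multipliable fun i => M i (σ.1 i) :=
  multipliable_of_norms fun _ hν => hM.summable_sub_one hE σ hν

lemma norm_detTerm (M : Matrix ι ι R) (σ : FinPerm ι) (ν : RingSeminorm R) :
    ν (detTerm M σ) = ν (∏' i, M i (σ.1 i)) := by
  rw [detTerm]
  rcases σ.sign_eq_or with h | h <;> simp [h]

/-- The bound for the terms of a determinant. -/
def detBound (E : ι → ι → Prop) (s : RingSeminorm R → ι × ι → ℝ) (ν : RingSeminorm R)
    (σ : FinPerm ι) : ℝ :=
  Real.exp (∑' x, s ν x) * ∏ x ∈ offGraph E σ, s ν x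

lemma Control.summable_detBound (hE : Control R E s) {ν : RingSeminorm R}
    (hν : ν ∈ norms (R := R)) : Summable (detBound E s ν) := by
  refine Summable.mul_left _ ?_
  exact (summable_finsetProd_of_summable_nonneg (hE.nonneg ν hν)
    (hE.summable ν hν)).comp_injective hE.offGraph_injective

/-- A factor on E is at most 1 + s, one off E at most s ≤ (1 + s) s. The factors 1 + s are collected
in one exponential that does not depend on σ; what remains is the product of s over `offGraph`. -/
lemma Good.norm_detTerm_le [Countable ι] {M : Matrix ι ι R} (hE : Control R E s) (hM : Good E s M)
    (σ : FinPerm ι) {ν : RingSeminorm R} (hν : ν ∈ norms (R := R)) :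
    ν (detTerm M σ) ≤ detBound E s ν σ := by
  classical
  rw [norm_detTerm]
  refine le_of_tendsto (tendsto_norm (hM.multipliable hE σ).hasProd hν) ?_
  filter_upwards [eventually_ge_atTop σ.2.toFinset] with T hT
  have hs := hE.summable_perm σ hν
  have hn : ∀ i, 0 ≤ s ν (i, σ.1 i) := fun i => hE.nonneg ν hν _
  calc ν (∏ i ∈ T, M i (σ.1 i)) ≤ ∏ i ∈ T, ν (M i (σ.1 i)) := norm_finset_prod_le hν _ T
    _ ≤ ∏ i ∈ T, ((1 + s ν (i, σ.1 i)) * if ¬ E i (σ.1 i) then s ν (i, σ.1 i) else 1) := by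
      refine Finset.prod_le_prod (fun i _ => apply_nonneg ν _) fun i _ => ?_
      by_cases h : E i (σ.1 i)
      · rw [if_neg (not_not.2 h), mul_one]
        exact hM.le_one_add ν hν i _
      · rw [if_pos h]
        refine (hM.le ν hν i _ h).trans ?_
        nlinarith [hn i]
    _ ≤ _ := by
      rw [Finset.prod_mul_distrib]
      have h1 : ∏ i ∈ T, (if ¬ E i (σ.1 i) then s ν (i, σ.1 i) else 1) =
          ∏ x ∈ offGraph E σ, s ν x := by
        rw [offGraph, Finset.prod_map, Finset.prod_filter]
        symm
        refine Finset.prod_subset hT fun i _ hi => ?_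
        have : σ.1 i = i := by simpa using hi
        rw [this, if_neg (not_not.2 (hE.refl i))]
      rw [h1, detBound]
      refine mul_le_mul_of_nonneg_right ?_ (Finset.prod_nonneg fun x _ => hE.nonneg ν hν x)
      refine (prod_one_add_le_exp_tsum hn hs T).trans (Real.exp_le_exp.2 ?_)
      exact hs.tsum_le_tsum_of_inj (fun i => (i, σ.1 i)) (fun i j h => (Prod.ext_iff.1 h).1)
        (fun x _ => hE.nonneg ν hν x) (fun i => le_rfl) (hE.summable ν hν)

lemma Good.hasDet [Countable ι] {M : Matrix ι ι R} (hE : Control R E s) (hM : Good E s M) :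
    HasDet M (idet M) := by
  have := hE.countable
  refine ⟨hM.multipliable hE, Summable.hasSum (summable_of_norms fun ν hν => ?_)⟩
  exact (hE.summable_detBound hν).of_nonneg_of_le (fun σ => apply_nonneg ν _)
    fun σ => hM.norm_detTerm_le hE σ hν

variable [T2Space R]

lemma Good.tendsto_detTerm [Countable ι] {α : Type*} {l : Filter α} {N : α → Matrix ι ι R}
    {M : Matrix ι ι R} (hE : Control R E s) (hN : ∀ a, Good E s (N a)) (hM : Good E s M)
    (h : ∀ i j, Tendsto (fun a => N a i j) l (𝓝 (M i j))) (σ : FinPerm ι) :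
    Tendsto (fun a => detTerm (N a) σ) l (𝓝 (detTerm M σ)) := by
  classical
  refine Tendsto.const_mul _ ?_
  rw [tendsto_iff_norms]
  intro ν hν
  have hs := hE.summable_perm σ hν
  have hn : ∀ i, 0 ≤ s ν (i, σ.1 i) := fun i => hE.nonneg ν hν _
  -- At moved points the entries are only known to be of size 1 + s. There are finitely many such
  -- points, so an extra 2 there keeps the bound summable.
  have hle : ∀ a i, ν (N a i (σ.1 i) - M i (σ.1 i)) ≤
      2 * s ν (i, σ.1 i) + if i ∈ σ.2.toFinset then 2 else 0 := by
    intro a i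
    split_ifs with hi
    · linarith [map_sub_le_add ν (N a i (σ.1 i)) (M i (σ.1 i)), (hN a).le_one_add ν hν i (σ.1 i),
        hM.le_one_add ν hν i (σ.1 i)]
    · have : σ.1 i = i := by simpa using hi
      rw [this]
      have h1 := map_sub_le_add ν (N a i i - 1) (M i i - 1)
      rw [sub_sub_sub_cancel_right] at h1
      linarith [(hN a).diag ν hν i, hM.diag ν hν i]
  have hb : Summable fun i => 2 * s ν (i, σ.1 i) + if i ∈ σ.2.toFinset then (2 : ℝ) else 0 :=
    (hs.mul_left 2).add (summable_of_ne_finset_zero (s := σ.2.toFinset) fun i hi => by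
      rw [if_neg hi])
  have h2 : Tendsto (fun a => ∑' i, ν (N a i (σ.1 i) - M i (σ.1 i))) l (𝓝 (∑' _ : ι, (0 : ℝ))) := by
    refine tendsto_tsum_of_dominated_convergence hb
      (fun i => tendsto_iff_norms.1 (h i (σ.1 i)) ν hν) (Eventually.of_forall fun a i => ?_)
    rw [Real.norm_of_nonneg (apply_nonneg ν _)]
    exact hle a i
  have h3 := h2.const_mul (Real.exp (∑' i, s ν (i, σ.1 i)))
  rw [tsum_zero, mul_zero] at h3
  refine squeeze_zero (fun a => apply_nonneg ν _) (fun a => ?_) h3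
  exact norm_tprod_sub_tprod_le hν ((hN a).multipliable hE σ) (hM.multipliable hE σ) hn hs
    (fun i => (hN a).le_one_add ν hν i _) (fun i => hM.le_one_add ν hν i _)
    (hb.of_nonneg_of_le (fun i => apply_nonneg ν _) (hle a))

/-- Dominated convergence for determinants. -/
lemma Good.tendsto_idet [Countable ι] {α : Type*} {l : Filter α} {N : α → Matrix ι ι R}
    {M : Matrix ι ι R} (hE : Control R E s) (hN : ∀ a, Good E s (N a)) (hM : Good E s M)
    (h : ∀ i j, Tendsto (fun a => N a i j) l (𝓝 (M i j))) :
    Tendsto (fun a => idet (N a)) l (𝓝 (idet M)) := by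
  have := hE.countable
  exact tendsto_tsum_of_norms (fun ν hν => hE.summable_detBound hν)
    (fun ν hν a σ => (hN a).norm_detTerm_le hE σ hν) (fun ν hν σ => hM.norm_detTerm_le hE σ hν)
    (Good.tendsto_detTerm hE hN hM h)

/-! ### Truncation to finite blocks, Sylvester's identity and multiplicativity. -/

section Truncation

variable [DecidableEq ι]

/-- The matrix that agrees with `M` on the block `T` and with `D` elsewhere. -/
def patch (T : Finset ι) (D M : Matrix ι ι R) : Matrix ι ι R :=
  fun i j => if i ∈ T ∧ j ∈ T then M i j else D i j

omit [TopologicalSpace R] [MConvexRing R] [T2Space R] in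
lemma patch_zero_apply (T : Finset ι) (M : Matrix ι ι R) (i j : ι) :
    patch T 0 M i j = if i ∈ T ∧ j ∈ T then M i j else 0 := rfl

omit [MConvexRing R] [T2Space R] in
lemma tendsto_patch (D M : Matrix ι ι R) (i j : ι) :
    Tendsto (fun T : Finset ι => patch T D M i j) atTop (𝓝 (M i j)) := by
  refine tendsto_const_nhds.congr' ?_
  filter_upwards [eventually_ge_atTop {i, j}] with T hT
  rw [patch, if_pos ⟨hT (by simp), hT (by simp)⟩]

omit [TopologicalSpace R] [MConvexRing R] [T2Space R] in
lemma idOff_patch (T : Finset ι) (M : Matrix ι ι R) : IdOff T (patch T 1 M) := fun i j h => by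
  rw [patch, if_neg]
  tauto

omit [TopologicalSpace R] [MConvexRing R] [T2Space R] in
lemma block_patch (T : Finset ι) (D M : Matrix ι ι R) : block T (patch T D M) = block T M := by
  ext i j
  simp [block, patch]

-- Truncation respects the same weights, so that dominated convergence applies uniformly in T.
omit [T2Space R] in
lemma Good.patch {M : Matrix ι ι R} (hE : Control R E s) (hM : Good E s M) (T : Finset ι) :
    Good E s (patch T 1 M) where
  diag ν hν i := by
    unfold WienerHopf.patch
    split_ifs
    · exact hM.diag ν hν i
    · simpa using hE.nonneg ν hν _
  le_one_add ν hν i j := by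
    unfold WienerHopf.patch
    split_ifs
    · exact hM.le_one_add ν hν i j
    · by_cases h : i = j
      · subst h
        rw [Matrix.one_apply_eq]
        linarith [hE.nonneg ν hν (i, i), MConvexRing.norm_one_le ν hν]
      · rw [Matrix.one_apply_ne h, map_zero]
        linarith [hE.nonneg ν hν (i, j)]
  le ν hν i j h := by
    unfold WienerHopf.patch
    split_ifs
    · exact hM.le ν hν i j h
    · have : i ≠ j := fun hij => h (hij ▸ hE.refl i)
      rw [Matrix.one_apply_ne this, map_zero]
      exact hE.nonneg ν hν _

/-- The determinant is the limit of the determinants of the finite blocks. -/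
lemma Good.tendsto_block [Countable ι] {M : Matrix ι ι R} (hE : Control R E s) (hM : Good E s M) :
    Tendsto (fun T => (block T M).det) atTop (𝓝 (idet M)) := by
  refine (Good.tendsto_idet hE (fun T => hM.patch hE T) hM (tendsto_patch 1 M)).congr fun T => ?_
  rw [(idOff_patch T M).idet_eq, block_patch]

lemma Good.idet_eq_of_block [Countable ι] {M : Matrix ι ι R} (hE : Control R E s) (hM : Good E s M)
    (S : Finset ι) {d : R} (h : ∀ T, S ⊆ T → (block T M).det = d) : idet M = d := by
  refine tendsto_nhds_unique (hM.tendsto_block hE) (tendsto_const_nhds.congr' ?_)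
  filter_upwards [eventually_ge_atTop S] with T hT
  exact (h T hT).symm

/-- Absolute summability of all the products that occur in `A ⊠ B`. -/
def TripleSummable (A B : Matrix ι ι R) : Prop :=
  ∀ ν ∈ norms (R := R), Summable fun x : (ι × ι) × ι => ν (A x.1.1 x.2) * ν (B x.2 x.1.2)

/-- Absolute summability of the entries. -/
def Nuclear (A : Matrix ι ι R) : Prop :=
  ∀ ν ∈ norms (R := R), Summable fun x : ι × ι => ν (A x.1 x.2)

/-- The absolute values of the entries of a product, estimated termwise. -/
def mulBound (A B : Matrix ι ι R) (ν : RingSeminorm R) (x : ι × ι) : ℝ :=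
  ∑' k, ν (A x.1 k) * ν (B k x.2)

omit [TopologicalSpace R] [MConvexRing R] [T2Space R] [DecidableEq ι] in
lemma mulBound_nonneg (A B : Matrix ι ι R) (ν : RingSeminorm R) (x : ι × ι) :
    0 ≤ mulBound A B ν x :=
  tsum_nonneg fun k => mul_nonneg (apply_nonneg ν _) (apply_nonneg ν _)

-- With equality as the relation, the part of the graph off E records exactly the moved points and
-- their images, which determine the permutation.
omit [T2Space R] [DecidableEq ι] in
lemma control_eq {s : RingSeminorm R → ι × ι → ℝ} (h0 : ∀ ν ∈ norms (R := R), ∀ x, 0 ≤ s ν x)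
    (hs : ∀ ν ∈ norms (R := R), Summable (s ν)) : Control R Eq s where
  refl _ := rfl
  inj σ τ h := by
    refine Subtype.ext (Equiv.ext fun i => ?_)
    by_cases h1 : i = σ.1 i
    · by_cases h2 : i = τ.1 i
      · exact h1.symm.trans h2
      · exact h i (Or.inr h2)
    · exact h i (Or.inl h1)
  nonneg := h0
  summable := hs

omit [TopologicalSpace R] [MConvexRing R] [T2Space R] in
lemma block_one_add (T : Finset ι) (A : Matrix ι ι R) : block T (1 + A) = 1 + block T A := by
  ext i j
  simp only [block, Matrix.submatrix_apply, Matrix.add_apply, Matrix.one_apply, Subtype.ext_iff]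

omit [T2Space R] in
lemma good_one_add {A : Matrix ι ι R} {s : RingSeminorm R → ι × ι → ℝ}
    (h : ∀ ν ∈ norms (R := R), ∀ i j, ν (A i j) ≤ s ν (i, j)) : Good Eq s (1 + A) where
  diag ν hν i := by simpa using h ν hν i i
  le_one_add ν hν i j := by
    refine (map_add_le_add ν _ _).trans (add_le_add ?_ (h ν hν i j))
    rw [Matrix.one_apply]
    split_ifs
    · exact MConvexRing.norm_one_le ν hν
    · simp
  le ν hν i j hij := by simpa [Matrix.one_apply_ne hij] using h ν hν i j

omit [T2Space R] [DecidableEq ι] in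
lemma Nuclear.control {A : Matrix ι ι R} (h : Nuclear A) :
    Control R Eq fun ν (x : ι × ι) => ν (A x.1 x.2) :=
  control_eq (fun ν _ _ => apply_nonneg ν _) h

lemma Nuclear.tendsto_block [Countable ι] {A : Matrix ι ι R} (h : Nuclear A) :
    Tendsto (fun T => (1 + block T A).det) atTop (𝓝 (idet (1 + A))) := by
  refine ((good_one_add (A := A) (s := fun ν x => ν (A x.1 x.2)) fun ν _ i j => le_rfl).tendsto_block h.control).congr fun T => ?_
  rw [block_one_add]

omit [T2Space R] in
lemma Nuclear.hasDet [Countable ι] {A : Matrix ι ι R} (h : Nuclear A) :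
    HasDet (1 + A) (idet (1 + A)) :=
  (good_one_add (A := A) (s := fun ν x => ν (A x.1 x.2)) fun ν _ i j => le_rfl).hasDet h.control

omit [T2Space R] [DecidableEq ι] in
lemma TripleSummable.summable_mulBound {A B : Matrix ι ι R} (h : TripleSummable A B)
    {ν : RingSeminorm R} (hν : ν ∈ norms (R := R)) : Summable (mulBound A B ν) :=
  (h ν hν).prod

omit [T2Space R] [DecidableEq ι] in
lemma TripleSummable.summable_entry {A B : Matrix ι ι R} (h : TripleSummable A B)
    {ν : RingSeminorm R} (hν : ν ∈ norms (R := R)) (i j : ι) :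
    Summable fun k => ν (A i k) * ν (B k j) :=
  (h ν hν).comp_injective (i := fun k => ((i, j), k)) fun x y hxy => (Prod.ext_iff.1 hxy).2

omit [T2Space R] [DecidableEq ι] in
lemma TripleSummable.norm_mmul_le [Countable ι] {A B : Matrix ι ι R} (h : TripleSummable A B)
    {ν : RingSeminorm R} (hν : ν ∈ norms (R := R)) (i j : ι) :
    ν ((A ⊠ B) i j) ≤ mulBound A B ν (i, j) := by
  have h1 := h.summable_entry hν i j
  refine (norm_tsum_le hν (h1.of_nonneg_of_le (fun k => apply_nonneg ν _)
    fun k => map_mul_le_mul ν _ _)).trans ?_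
  exact (h1.of_nonneg_of_le (fun k => apply_nonneg ν _)
    fun k => map_mul_le_mul ν _ _).tsum_le_tsum (fun k => map_mul_le_mul ν _ _) h1

omit [MConvexRing R] in
lemma patch_zero_mmul (T : Finset ι) (A B : Matrix ι ι R) (i j : ι) :
    (patch T 0 A ⊠ patch T 0 B) i j =
      if i ∈ T ∧ j ∈ T then ∑ k ∈ T, A i k * B k j else 0 := by
  rw [mmul, tsum_eq_sum (s := T)]
  · split_ifs with h
    · refine Finset.sum_congr rfl fun k hk => ?_
      rw [patch_zero_apply, patch_zero_apply, if_pos ⟨h.1, hk⟩, if_pos ⟨hk, h.2⟩]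
    · refine Finset.sum_eq_zero fun k _ => ?_
      rw [patch_zero_apply, patch_zero_apply]
      by_cases hi : i ∈ T
      · have hj : j ∉ T := fun hj => h ⟨hi, hj⟩
        simp [hj]
      · simp [hi]
  · intro k hk
    simp [patch_zero_apply, hk]

omit [MConvexRing R] in
lemma block_patch_zero_mmul (T : Finset ι) (A B : Matrix ι ι R) :
    block T (patch T 0 A ⊠ patch T 0 B) = block T A * block T B := by
  ext i j
  simp only [block, Matrix.submatrix_apply, patch_zero_mmul, Matrix.mul_apply]
  rw [if_pos ⟨i.2, j.2⟩, ← Finset.sum_coe_sort]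

lemma TripleSummable.norm_patch_mmul_le {A B : Matrix ι ι R} (h : TripleSummable A B)
    {ν : RingSeminorm R} (hν : ν ∈ norms (R := R)) (T : Finset ι) (i j : ι) :
    ν ((patch T 0 A ⊠ patch T 0 B) i j) ≤ mulBound A B ν (i, j) := by
  rw [patch_zero_mmul]
  split_ifs
  · refine (norm_finset_sum_le ν _ T).trans ((Finset.sum_le_sum fun k _ =>
      map_mul_le_mul ν (A i k) (B k j)).trans ?_)
    exact (h.summable_entry hν i j).sum_le_tsum T
      fun k _ => mul_nonneg (apply_nonneg ν _) (apply_nonneg ν _)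
  · rw [map_zero]
    exact mulBound_nonneg A B ν _

lemma TripleSummable.tendsto_patch_mmul [Countable ι] {A B : Matrix ι ι R}
    (h : TripleSummable A B) (i j : ι) :
    Tendsto (fun T => (patch T 0 A ⊠ patch T 0 B) i j) atTop (𝓝 ((A ⊠ B) i j)) := by
  have hs : Summable fun k => A i k * B k j := summable_of_norms fun ν hν =>
    (h.summable_entry hν i j).of_nonneg_of_le (fun k => apply_nonneg ν _)
      fun k => map_mul_le_mul ν _ _
  refine Tendsto.congr' ?_ hs.hasSum
  filter_upwards [eventually_ge_atTop {i, j}] with T hT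
  rw [patch_zero_mmul, if_pos ⟨hT (by simp), hT (by simp)⟩]

/-- The two factors are truncated separately, so the approximating block is a product of finite
matrices. `mulBound` dominates the entries for all T because it is formed from absolute values. -/
lemma TripleSummable.tendsto_det [Countable ι] {A B : Matrix ι ι R} (h : TripleSummable A B) :
    Tendsto (fun T => (1 + block T A * block T B).det) atTop (𝓝 (idet (1 + A ⊠ B))) := by
  have hE : Control R Eq (mulBound A B) :=
    control_eq (fun ν _ x => mulBound_nonneg A B ν x) fun ν hν => h.summable_mulBound hν
  have h1 := Good.tendsto_idet (l := atTop) hE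
    (fun T => good_one_add fun ν hν i j => h.norm_patch_mmul_le hν T i j)
    (good_one_add fun ν hν i j => h.norm_mmul_le hν i j)
    fun i j => (h.tendsto_patch_mmul i j).const_add ((1 : Matrix ι ι R) i j)
  refine h1.congr fun T => ?_
  have h2 : IdOff T (1 + patch T 0 A ⊠ patch T 0 B) := fun i j hij => by
    rw [Matrix.add_apply, patch_zero_mmul, if_neg (by tauto), add_zero]
  rw [h2.idet_eq, ← block_patch_zero_mmul, block_one_add]

/-- Sylvester's identity for infinite determinants. -/
lemma idet_one_add_mmul_comm [Countable ι] {A B : Matrix ι ι R} (h : TripleSummable A B)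
    (h' : TripleSummable B A) : idet (1 + A ⊠ B) = idet (1 + B ⊠ A) := by
  refine tendsto_nhds_unique h.tendsto_det (h'.tendsto_det.congr fun T => ?_)
  rw [Matrix.det_one_add_mul_comm]

/-- Multiplicativity of the determinant. -/
lemma Good.hasDet_add_mmul [Countable ι] {N S : Matrix ι ι R} (hE : Control R E s)
    (hN : Good E s N) (hS : Nuclear S) (h : TripleSummable S N) :
    HasDet (N + S ⊠ N) (idet (1 + S) * idet N) ∧
      Tendsto (fun T => (block T (N + S ⊠ N)).det) atTop (𝓝 (idet (1 + S) * idet N)) := by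
  -- The perturbation only adds to the weights; the relation E stays that of N.
  have hE' : Control R E fun ν x => s ν x + mulBound S N ν x :=
    ⟨hE.refl, hE.inj, fun ν hν x => add_nonneg (hE.nonneg ν hν x) (mulBound_nonneg S N ν x),
      fun ν hν => (hE.summable ν hν).add (h.summable_mulBound hν)⟩
  have hadd : ∀ N' P : Matrix ι ι R, Good E s N' →
      (∀ ν ∈ norms (R := R), ∀ i j, ν (P i j) ≤ mulBound S N ν (i, j)) →
      Good E (fun ν x => s ν x + mulBound S N ν x) (N' + P) := fun N' P hN' hP =>
    { diag := fun ν hν i => by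
        have := map_add_le_add ν (N' i i - 1) (P i i)
        rw [Matrix.add_apply, add_sub_right_comm]
        exact this.trans (add_le_add (hN'.diag ν hν i) (hP ν hν i i))
      le_one_add := fun ν hν i j => by
        rw [← add_assoc]
        exact (map_add_le_add ν _ _).trans (add_le_add (hN'.le_one_add ν hν i j) (hP ν hν i j))
      le := fun ν hν i j hij =>
        (map_add_le_add ν _ _).trans (add_le_add (hN'.le ν hν i j hij) (hP ν hν i j)) }
  have hM := hadd N (S ⊠ N) hN fun ν hν => h.norm_mmul_le hν
  -- N is continued by the identity outside T, but both factors of the product by 0. The T-block of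
  -- this approximation is (1 + S_T) N_T, to which the finite product formula applies.
  have h1 := Good.tendsto_idet (l := atTop) hE'
    (fun T => hadd _ _ (hN.patch hE T) fun ν hν => h.norm_patch_mmul_le hν T) hM
    fun i j => (tendsto_patch 1 N i j).add (h.tendsto_patch_mmul i j)
  have h2 := hS.tendsto_block.mul (hN.tendsto_block hE)
  have h3 : idet (N + S ⊠ N) = idet (1 + S) * idet N := by
    refine tendsto_nhds_unique h1 (h2.congr fun T => ?_)
    have h4 : IdOff T (WienerHopf.patch T 1 N + WienerHopf.patch T 0 S ⊠ WienerHopf.patch T 0 N) :=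
      fun i j hij => by
        rw [Matrix.add_apply, patch_zero_mmul, if_neg (by tauto), add_zero, idOff_patch T N i j hij]
    have h5 : block T (WienerHopf.patch T 1 N + WienerHopf.patch T 0 S ⊠ WienerHopf.patch T 0 N) =
        block T (WienerHopf.patch T 1 N) +
          block T (WienerHopf.patch T 0 S ⊠ WienerHopf.patch T 0 N) := rfl
    rw [h4.idet_eq, h5, block_patch, block_patch_zero_mmul, ← Matrix.det_mul, add_mul, one_mul]
  rw [← h3]
  exact ⟨hM.hasDet hE', hM.tendsto_block hE'⟩

end Truncation

end Good

/-! ### Tame and rapidly decreasing matrices -/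

lemma wt_neg (n : ℤ) : wt (-n) = wt n := by simp [wt]

lemma wt_le_of_abs_le {m n : ℤ} (h : |m| ≤ |n|) : wt m ≤ wt n := by
  unfold wt
  have : (|m| : ℝ) ≤ |(n : ℝ)| := by exact_mod_cast h
  linarith

section Tame

variable {R : Type*} [CommRing R] [TopologicalSpace R] [MConvexRing R]

/-- Matrices that act from the right on rapidly decreasing row vectors. -/
def RowTame (M : Matrix ℤ ℤ R) : Prop :=
  ∀ ν ∈ norms (R := R), ∀ k : ℕ, ∃ (l : ℕ) (C : ℝ), ∀ i j, wt j ^ k * ν (M i j) ≤ C * wt i ^ l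

/-- Matrices whose entries decrease rapidly in both indices. -/
def RapidMatrix (M : Matrix ℤ ℤ R) : Prop :=
  ∀ ν ∈ norms (R := R), ∀ k : ℕ, ∃ C : ℝ, ∀ i j, wt i ^ k * wt j ^ k * ν (M i j) ≤ C

lemma RowTame.exists_bound {M : Matrix ℤ ℤ R} (h : RowTame M) {ν : RingSeminorm R}
    (hν : ν ∈ norms (R := R)) (k : ℕ) :
    ∃ (l : ℕ) (C : ℝ), 0 ≤ C ∧ ∀ i j, ν (M i j) ≤ C * wt i ^ l * (wt j ^ k)⁻¹ := by
  obtain ⟨l, C, hC⟩ := h ν hν k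
  refine ⟨l, C, ?_, fun i j => ?_⟩
  · have h0 := hC 0 0
    have h1 : (0 : ℝ) ≤ wt 0 ^ k * ν (M 0 0) :=
      mul_nonneg (pow_pos (wt_pos _) k).le (apply_nonneg ν _)
    have h2 : wt 0 = 1 := by simp [wt]
    rw [h2, one_pow, one_pow, mul_one, one_mul] at h0
    exact (apply_nonneg ν _).trans h0
  · rw [← div_eq_mul_inv, le_div_iff₀ (pow_pos (wt_pos j) k), mul_comm]
    exact hC i j

lemma RapidMatrix.exists_bound {M : Matrix ℤ ℤ R} (h : RapidMatrix M) {ν : RingSeminorm R}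
    (hν : ν ∈ norms (R := R)) (k : ℕ) :
    ∃ C : ℝ, 0 ≤ C ∧ ∀ i j, ν (M i j) ≤ C * (wt i ^ k)⁻¹ * (wt j ^ k)⁻¹ := by
  obtain ⟨C, hC⟩ := h ν hν k
  have hp : ∀ i, 0 < wt i ^ k := fun i => pow_pos (wt_pos i) k
  refine ⟨C, (mul_nonneg (mul_nonneg (hp 0).le (hp 0).le) (apply_nonneg ν _)).trans (hC 0 0),
    fun i j => ?_⟩
  rw [← div_eq_mul_inv, ← div_eq_mul_inv, le_div_iff₀ (hp j), le_div_iff₀ (hp i)]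
  linarith [hC i j]

lemma inv_wt_nonneg (i : ℤ) (k : ℕ) : 0 ≤ (wt i ^ k)⁻¹ := inv_nonneg.2 (pow_pos (wt_pos i) k).le

lemma wt_pow_mul_inv (i : ℤ) (k l : ℕ) : wt i ^ k * (wt i ^ (k + l))⁻¹ = (wt i ^ l)⁻¹ := by
  have := (wt_pos i).ne'
  rw [pow_add]
  field_simp

lemma inv_wt_pow_le (i : ℤ) {k l : ℕ} (h : k ≤ l) : (wt i ^ l)⁻¹ ≤ (wt i ^ k)⁻¹ :=
  inv_anti₀ (pow_pos (wt_pos i) k) (pow_le_pow_right₀ (one_le_wt i) h)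

/-- The terms of `(A ⊠ B)ᵢⱼ` are dominated by a multiple of a fixed summable sequence. -/
lemma RowTame.exists_mul_bound {A B : Matrix ℤ ℤ R} (hA : RowTame A) (hB : RowTame B)
    {ν : RingSeminorm R} (hν : ν ∈ norms (R := R)) (k : ℕ) :
    ∃ (l : ℕ) (C : ℝ), 0 ≤ C ∧ ∀ i j m, ν (A i j) * ν (B j m) ≤
      (C * wt i ^ l * (wt m ^ k)⁻¹) * (wt j ^ 2)⁻¹ := by
  obtain ⟨l, C, hC, h1⟩ := hB.exists_bound hν k
  obtain ⟨l', C', hC', h2⟩ := hA.exists_bound hν (l + 2)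
  refine ⟨l', C' * C, mul_nonneg hC' hC, fun i j m => ?_⟩
  calc _ ≤ (C' * wt i ^ l' * (wt j ^ (l + 2))⁻¹) * (C * wt j ^ l * (wt m ^ k)⁻¹) :=
        mul_le_mul (h2 i j) (h1 j m) (apply_nonneg ν _)
          (mul_nonneg (mul_nonneg hC' (pow_pos (wt_pos i) _).le) (inv_wt_nonneg _ _))
    _ = C' * C * wt i ^ l' * (wt m ^ k)⁻¹ * (wt j ^ l * (wt j ^ (l + 2))⁻¹) := by ring
    _ = _ := by rw [wt_pow_mul_inv]

lemma RowTame.summable_norm {A B : Matrix ℤ ℤ R} (hA : RowTame A) (hB : RowTame B)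
    {ν : RingSeminorm R} (hν : ν ∈ norms (R := R)) (i m : ℤ) :
    Summable fun j => ν (A i j) * ν (B j m) := by
  obtain ⟨l, C, -, h⟩ := hA.exists_mul_bound hB hν 0
  exact (summable_wt.mul_left _).of_nonneg_of_le
    (fun j => mul_nonneg (apply_nonneg ν _) (apply_nonneg ν _)) fun j => h i j m

lemma RowTame.summable {A B : Matrix ℤ ℤ R} (hA : RowTame A) (hB : RowTame B) (i m : ℤ) :
    Summable fun j => A i j * B j m :=
  summable_of_norms fun _ hν => (hA.summable_norm hB hν i m).of_nonneg_of_le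
    (fun _ => apply_nonneg _ _) fun _ => map_mul_le_mul _ _ _

lemma RowTame.norm_mmul_le {A B : Matrix ℤ ℤ R} (hA : RowTame A) (hB : RowTame B)
    {ν : RingSeminorm R} (hν : ν ∈ norms (R := R)) {i m : ℤ} {c : ℝ}
    (h : ∀ j, ν (A i j) * ν (B j m) ≤ c * (wt j ^ 2)⁻¹) :
    ν ((A ⊠ B) i m) ≤ c * ∑' j, (wt j ^ 2)⁻¹ := by
  rw [← tsum_mul_left]
  exact norm_hasSum_le hν (hA.summable hB i m).hasSum (summable_wt.mul_left c)
    fun j => (map_mul_le_mul ν _ _).trans (h j)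

lemma RowTame.mmul {A B : Matrix ℤ ℤ R} (hA : RowTame A) (hB : RowTame B) : RowTame (A ⊠ B) := by
  intro ν hν k
  obtain ⟨l, C, hC, h⟩ := hA.exists_mul_bound hB hν k
  refine ⟨l, C * ∑' j, (wt j ^ 2)⁻¹, fun i m => ?_⟩
  have h1 := hA.norm_mmul_le hB hν (i := i) (m := m) fun j => h i j m
  have hp := pow_pos (wt_pos m) k
  calc _ ≤ wt m ^ k * (C * wt i ^ l * (wt m ^ k)⁻¹ * ∑' j, (wt j ^ 2)⁻¹) :=
        mul_le_mul_of_nonneg_left h1 hp.le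
    _ = (wt m ^ k * (wt m ^ k)⁻¹) * (C * (∑' j, (wt j ^ 2)⁻¹) * wt i ^ l) := by ring
    _ = _ := by rw [mul_inv_cancel₀ hp.ne', one_mul]

lemma RowTame.add {A B : Matrix ℤ ℤ R} (hA : RowTame A) (hB : RowTame B) : RowTame (A + B) := by
  intro ν hν k
  obtain ⟨l, C, hC, h⟩ := hA.exists_bound hν k
  obtain ⟨l', C', hC', h'⟩ := hB.exists_bound hν k
  refine ⟨l + l', C + C', fun i j => ?_⟩
  have hp := pow_pos (wt_pos j) k
  have h1 : wt i ^ l ≤ wt i ^ (l + l') := pow_le_pow_right₀ (one_le_wt i) (by omega)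
  have h2 : wt i ^ l' ≤ wt i ^ (l + l') := pow_le_pow_right₀ (one_le_wt i) (by omega)
  have h3 : ν ((A + B) i j) ≤ (C + C') * wt i ^ (l + l') * (wt j ^ k)⁻¹ := by
    refine (map_add_le_add ν _ _).trans ((add_le_add (h i j) (h' i j)).trans ?_)
    refine (add_le_add
      (mul_le_mul_of_nonneg_right (mul_le_mul_of_nonneg_left h1 hC) (inv_wt_nonneg _ _))
      (mul_le_mul_of_nonneg_right (mul_le_mul_of_nonneg_left h2 hC') (inv_wt_nonneg _ _))).trans_eq
      ?_
    ring
  rw [← div_eq_mul_inv, le_div_iff₀ hp] at h3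
  linarith

lemma RowTame.neg {A : Matrix ℤ ℤ R} (hA : RowTame A) : RowTame (-A) := by
  intro ν hν k
  obtain ⟨l, C, h⟩ := hA ν hν k
  exact ⟨l, C, fun i j => by rw [Matrix.neg_apply, map_neg_eq_map]; exact h i j⟩

lemma rowTame_zero : RowTame (0 : Matrix ℤ ℤ R) := fun ν _ k => ⟨0, 0, fun i j => by simp⟩

/-- A matrix whose entries are bounded and supported on `|j| ≤ 1 + |i|` is tame. -/
lemma rowTame_of_bounded {A : Matrix ℤ ℤ R} (h : ∀ i j, wt (i - j) ≤ 2 ∨ wt j ≤ 2 * wt i ∨ A i j = 0)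
    (hb : ∀ ν ∈ norms (R := R), ∃ C : ℝ, ∀ i j, ν (A i j) ≤ C) : RowTame A := by
  intro ν hν k
  obtain ⟨C, hC⟩ := hb ν hν
  refine ⟨k, 2 ^ k * C, fun i j => ?_⟩
  have h0 : 0 ≤ C := (apply_nonneg ν _).trans (hC 0 0)
  by_cases hz : A i j = 0
  · rw [hz, map_zero, mul_zero]
    exact mul_nonneg (mul_nonneg (by positivity) h0) (pow_pos (wt_pos i) k).le
  · have h1 : wt j ≤ 2 * wt i := by
      rcases h i j with h1 | h1 | h1
      · have h2 := wt_add (-(i - j)) i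
        rw [wt_neg] at h2
        have e : -(i - j) + i = j := by ring
        rw [e] at h2
        exact h2.trans (mul_le_mul_of_nonneg_right h1 (wt_pos i).le)
      · exact h1
      · exact absurd h1 hz
    calc _ ≤ (2 * wt i) ^ k * C := mul_le_mul (pow_le_pow_left₀ (wt_pos j).le h1 k) (hC i j)
          (apply_nonneg ν _) (pow_nonneg (by linarith [wt_pos i]) k)
      _ = _ := by rw [mul_pow]; ring

lemma rowTame_one : RowTame (1 : Matrix ℤ ℤ R) := by
  refine rowTame_of_bounded (fun i j => ?_) fun ν hν => ⟨1, fun i j => ?_⟩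
  · by_cases h : i = j
    · left
      subst h
      simp [wt]
    · exact Or.inr (Or.inr (Matrix.one_apply_ne h))
  · rw [Matrix.one_apply]
    split_ifs
    · exact MConvexRing.norm_one_le ν hν
    · simp

lemma RapidMatrix.rowTame {S : Matrix ℤ ℤ R} (h : RapidMatrix S) : RowTame S := by
  intro ν hν k
  obtain ⟨C, hC⟩ := h ν hν k
  refine ⟨0, C, fun i j => ?_⟩
  rw [pow_zero, mul_one]
  refine le_trans ?_ (hC i j)
  rw [mul_assoc]
  exact le_mul_of_one_le_left (mul_nonneg (pow_pos (wt_pos j) k).le (apply_nonneg ν _))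
    (one_le_pow₀ (one_le_wt i))

lemma RapidMatrix.transpose {S : Matrix ℤ ℤ R} (h : RapidMatrix S) :
    RapidMatrix S.transpose := by
  intro ν hν k
  obtain ⟨C, hC⟩ := h ν hν k
  exact ⟨C, fun i j => by rw [mul_comm (wt i ^ k)]; exact hC j i⟩

lemma RapidMatrix.exists_mul_bound {S B : Matrix ℤ ℤ R} (hS : RapidMatrix S) (hB : RowTame B)
    {ν : RingSeminorm R} (hν : ν ∈ norms (R := R)) (k : ℕ) :
    ∃ C : ℝ, 0 ≤ C ∧ ∀ i j m, ν (S i j) * ν (B j m) ≤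
      (C * (wt i ^ k)⁻¹ * (wt m ^ k)⁻¹) * (wt j ^ 2)⁻¹ := by
  obtain ⟨l, C, hC, h1⟩ := hB.exists_bound hν k
  obtain ⟨C', hC', h2⟩ := hS.exists_bound hν (l + 2 + k)
  refine ⟨C' * C, mul_nonneg hC' hC, fun i j m => ?_⟩
  have h3 : ν (S i j) ≤ C' * (wt i ^ k)⁻¹ * (wt j ^ (l + 2))⁻¹ := by
    refine (h2 i j).trans (mul_le_mul ?_ (inv_wt_pow_le j (by omega)) (inv_wt_nonneg _ _)
      (mul_nonneg hC' (inv_wt_nonneg _ _)))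
    exact mul_le_mul_of_nonneg_left (inv_wt_pow_le i (by omega)) hC'
  calc _ ≤ (C' * (wt i ^ k)⁻¹ * (wt j ^ (l + 2))⁻¹) * (C * wt j ^ l * (wt m ^ k)⁻¹) :=
        mul_le_mul h3 (h1 j m) (apply_nonneg ν _)
          (mul_nonneg (mul_nonneg hC' (inv_wt_nonneg _ _)) (inv_wt_nonneg _ _))
    _ = C' * C * (wt i ^ k)⁻¹ * (wt m ^ k)⁻¹ * (wt j ^ l * (wt j ^ (l + 2))⁻¹) := by ring
    _ = _ := by rw [wt_pow_mul_inv]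

/-- The polynomial growth of B in its row index is absorbed by the decay of S in its column index.
-/
lemma RapidMatrix.mmul {S B : Matrix ℤ ℤ R} (hS : RapidMatrix S) (hB : RowTame B) :
    RapidMatrix (S ⊠ B) := by
  intro ν hν k
  obtain ⟨C, hC, h⟩ := hS.exists_mul_bound hB hν k
  refine ⟨C * ∑' j, (wt j ^ 2)⁻¹, fun i m => ?_⟩
  have h1 := hS.rowTame.norm_mmul_le hB hν (i := i) (m := m) fun j => h i j m
  have hp := pow_pos (wt_pos m) k
  have hp' := pow_pos (wt_pos i) k
  calc _ ≤ wt i ^ k * wt m ^ k * (C * (wt i ^ k)⁻¹ * (wt m ^ k)⁻¹ * ∑' j, (wt j ^ 2)⁻¹) :=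
        mul_le_mul_of_nonneg_left h1 (mul_pos hp' hp).le
    _ = (wt i ^ k * (wt i ^ k)⁻¹) * (wt m ^ k * (wt m ^ k)⁻¹) * (C * ∑' j, (wt j ^ 2)⁻¹) := by
        ring
    _ = _ := by rw [mul_inv_cancel₀ hp.ne', mul_inv_cancel₀ hp'.ne', one_mul, one_mul]

omit [MConvexRing R] in
lemma transpose_mmul {ι : Type*} (A B : Matrix ι ι R) :
    (A ⊠ B).transpose = B.transpose ⊠ A.transpose := by
  ext i j
  simp only [mmul, Matrix.transpose_apply]
  exact tsum_congr fun k => mul_comm _ _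

/-- Tameness is one-sided, so multiplication from the left needs a tame transpose. Toeplitz and
diagonal matrices in use here have it, whereas `FPlusInv 1` is only ever multiplied from the right.
-/
lemma RapidMatrix.mmul_left {S B : Matrix ℤ ℤ R} (hS : RapidMatrix S)
    (hB : RowTame B.transpose) : RapidMatrix (B ⊠ S) := by
  have h := (hS.transpose.mmul hB).transpose
  rwa [transpose_mmul, Matrix.transpose_transpose, Matrix.transpose_transpose] at h

lemma RapidMatrix.tripleSummable {S B : Matrix ℤ ℤ R} (hS : RapidMatrix S) (hB : RowTame B) :
    TripleSummable S B := by
  intro ν hν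
  obtain ⟨C, hC, h⟩ := hS.exists_mul_bound hB hν 2
  have h1 : Summable fun x : (ℤ × ℤ) × ℤ =>
      C * ((wt x.1.1 ^ 2)⁻¹ * (wt x.1.2 ^ 2)⁻¹ * (wt x.2 ^ 2)⁻¹) := by
    refine Summable.mul_left C ?_
    have h2 := summable_wt.mul_of_nonneg summable_wt (fun n => inv_wt_nonneg n 2)
      (fun n => inv_wt_nonneg n 2)
    exact h2.mul_of_nonneg summable_wt
      (fun n => mul_nonneg (inv_wt_nonneg _ 2) (inv_wt_nonneg _ 2)) (fun n => inv_wt_nonneg n 2)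
  refine h1.of_nonneg_of_le (fun x => mul_nonneg (apply_nonneg ν _) (apply_nonneg ν _))
    fun x => (h x.1.1 x.2 x.1.2).trans_eq (by ring)

lemma RapidMatrix.tripleSummable_left {S B : Matrix ℤ ℤ R} (hS : RapidMatrix S)
    (hB : RowTame B.transpose) : TripleSummable B S := by
  intro ν hν
  have h := hS.transpose.tripleSummable hB ν hν
  refine (((Equiv.prodComm ℤ ℤ).prodCongr (Equiv.refl ℤ)).summable_iff.2 h).congr fun x => ?_
  simp [mul_comm]

lemma RapidMatrix.nuclear {S : Matrix ℤ ℤ R} (hS : RapidMatrix S) : Nuclear S := by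
  intro ν hν
  obtain ⟨C, hC, h⟩ := hS.exists_bound hν 2
  have h2 := (summable_wt.mul_of_nonneg summable_wt (fun n => inv_wt_nonneg n 2)
    (fun n => inv_wt_nonneg n 2)).mul_left C
  exact h2.of_nonneg_of_le (fun x => apply_nonneg ν _)
    fun x => (h x.1 x.2).trans_eq (mul_assoc _ _ _)

variable [T2Space R]

/-- Fubini: choosing the decay of A B beyond the growth of D makes the double sum absolutely
convergent. -/
lemma RowTame.mmul_assoc {A B D : Matrix ℤ ℤ R} (hA : RowTame A) (hB : RowTame B)
    (hD : RowTame D) : A ⊠ B ⊠ D = A ⊠ (B ⊠ D) := by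
  ext i m
  have hs : Summable (Function.uncurry fun k j => A i j * B j k * D k m) := by
    refine summable_of_norms fun ν hν => ?_
    obtain ⟨l, C, hC, h1⟩ := hD.exists_bound hν 0
    obtain ⟨l', C', hC', h2⟩ := hA.exists_mul_bound hB hν (l + 2)
    have h3 := ((summable_wt.mul_of_nonneg summable_wt (fun n => inv_wt_nonneg n 2)
      (fun n => inv_wt_nonneg n 2)).mul_left (C * C' * wt i ^ l'))
    refine h3.of_nonneg_of_le (fun x => apply_nonneg ν _) fun x => ?_
    obtain ⟨k, j⟩ := x
    have h4 : ν (A i j * B j k) ≤ C' * wt i ^ l' * (wt k ^ (l + 2))⁻¹ * (wt j ^ 2)⁻¹ :=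
      (map_mul_le_mul ν _ _).trans (h2 i j k)
    calc ν (A i j * B j k * D k m) ≤ ν (A i j * B j k) * ν (D k m) := map_mul_le_mul ν _ _
      _ ≤ (C' * wt i ^ l' * (wt k ^ (l + 2))⁻¹ * (wt j ^ 2)⁻¹) * (C * wt k ^ l * (wt m ^ 0)⁻¹) :=
        mul_le_mul h4 (h1 k m) (apply_nonneg ν _) ((apply_nonneg ν _).trans h4)
      _ = C * C' * wt i ^ l' * ((wt k ^ l * (wt k ^ (l + 2))⁻¹) * (wt j ^ 2)⁻¹) := by ring
      _ = _ := by rw [wt_pow_mul_inv]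
  have h1 : ∀ k, Summable fun j => A i j * B j k * D k m :=
    fun k => (hA.summable hB i k).mul_right _
  have h2 : ∀ j, Summable fun k => A i j * B j k * D k m :=
    fun j => ((hB.summable hD j m).mul_left (A i j)).congr fun k => (mul_assoc _ _ _).symm
  have h3 := hs.tsum_comm' h1 h2
  simp only [WienerHopf.mmul]
  rw [tsum_congr fun k => ((hA.summable hB i k).tsum_mul_right (D k m)).symm, ← h3]
  refine tsum_congr fun j => ?_
  rw [← (hB.summable hD j m).tsum_mul_left]
  exact tsum_congr fun k => mul_assoc _ _ _

variable (R) in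
/-- The algebra of tame matrices. -/
@[ext] structure RowOp where
  val : Matrix ℤ ℤ R
  tame : RowTame val

namespace RowOp

instance : Zero (RowOp R) := ⟨⟨0, rowTame_zero⟩⟩
instance : One (RowOp R) := ⟨⟨1, rowTame_one⟩⟩
instance : Add (RowOp R) := ⟨fun a b => ⟨a.val + b.val, a.tame.add b.tame⟩⟩
instance : Neg (RowOp R) := ⟨fun a => ⟨-a.val, a.tame.neg⟩⟩
instance : Mul (RowOp R) := ⟨fun a b => ⟨a.val ⊠ b.val, a.tame.mmul b.tame⟩⟩

omit [T2Space R] in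
lemma val_mul (a b : RowOp R) : (a * b).val = a.val ⊠ b.val := rfl

omit [T2Space R] in
lemma val_add (a b : RowOp R) : (a + b).val = a.val + b.val := rfl

omit [T2Space R] in
lemma val_one : (1 : RowOp R).val = 1 := rfl

omit [T2Space R] in
lemma val_zero : (0 : RowOp R).val = 0 := rfl

omit [T2Space R] in
lemma val_neg (a : RowOp R) : (-a).val = -a.val := rfl

/-- With a ring structure on tame matrices, the matrix identities below become computations in a
noncommutative ring, with no further convergence questions. -/
instance : Ring (RowOp R) where
  add_assoc a b c := RowOp.ext (add_assoc _ _ _)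
  zero_add a := RowOp.ext (zero_add _)
  add_zero a := RowOp.ext (add_zero _)
  add_comm a b := RowOp.ext (add_comm _ _)
  neg_add_cancel a := RowOp.ext (neg_add_cancel _)
  nsmul := nsmulRec
  zsmul := zsmulRec
  mul_assoc a b c := RowOp.ext (a.tame.mmul_assoc b.tame c.tame)
  one_mul a := RowOp.ext <| by
    ext i j
    rw [val_mul, mmul, tsum_eq_single i]
    · simp [val_one]
    · intro k hk
      simp [val_one, Matrix.one_apply_ne hk.symm]
  mul_one a := RowOp.ext <| by
    ext i j
    rw [val_mul, mmul, tsum_eq_single j]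
    · simp [val_one]
    · intro k hk
      simp [val_one, Matrix.one_apply_ne hk]
  zero_mul a := RowOp.ext <| by
    ext i j
    simp [val_mul, val_zero, mmul]
  mul_zero a := RowOp.ext <| by
    ext i j
    simp [val_mul, val_zero, mmul]
  left_distrib a b c := RowOp.ext <| by
    ext i j
    simp only [val_mul, val_add, mmul, Matrix.add_apply, mul_add]
    exact (a.tame.summable b.tame i j).tsum_add (a.tame.summable c.tame i j)
  right_distrib a b c := RowOp.ext <| by
    ext i j
    simp only [val_mul, val_add, mmul, Matrix.add_apply, add_mul]
    exact (a.tame.summable c.tame i j).tsum_add (b.tame.summable c.tame i j)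

lemma val_sub (a b : RowOp R) : (a - b).val = a.val - b.val := by
  rw [sub_eq_add_neg, val_add, val_neg, sub_eq_add_neg]

end RowOp

/-- Conjugation invariance in the form of Sylvester's identity. -/
lemma RapidMatrix.idet_comm {S B : Matrix ℤ ℤ R} (hS : RapidMatrix S) (hB : RowTame B)
    (hB' : RowTame B.transpose) : idet (1 + S ⊠ B) = idet (1 + B ⊠ S) :=
  idet_one_add_mmul_comm (hS.tripleSummable hB) (hS.tripleSummable_left hB')

end Tame

/-! ### Determinants of finite blocks -/

section Blocks

variable {ι R : Type*} [CommRing R]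

/-- A block of a matrix that is unitriangular outside a smaller block. -/
lemma det_block_eq_of_subset [LinearOrder ι] {M : Matrix ι ι R} {S T : Finset ι} (hST : S ⊆ T)
    (h1 : ∀ i ∈ S, ∀ j ∉ S, M i j = 0) (h2 : ∀ i ∉ S, ∀ j ∉ S, j < i → M i j = 0)
    (h3 : ∀ j ∉ S, M j j = 1) : (block T M).det = (block S M).det := by
  rw [Matrix.twoBlockTriangular_det' (block T M) (fun i : T => i.1 ∈ S) fun i hi j hj => h1 _ hi _ hj]
  have e1 : ((block T M).toSquareBlockProp fun i : T => ¬ i.1 ∈ S).det = 1 := by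
    have hu : ((block T M).toSquareBlockProp fun i : T => ¬ i.1 ∈ S).BlockTriangular id :=
      fun i j hij => h2 _ i.2 _ j.2 hij
    rw [Matrix.det_of_isUpperTriangular hu]
    exact Finset.prod_eq_one fun i _ => h3 _ i.2
  rw [e1, mul_one]
  let e : S ≃ {i : T // i.1 ∈ S} :=
    { toFun := fun i => ⟨⟨i.1, hST i.2⟩, i.2⟩
      invFun := fun i => ⟨i.1.1, i.2⟩
      left_inv := fun i => rfl
      right_inv := fun i => rfl }
  rw [← Matrix.det_submatrix_equiv_self e]
  rfl

lemma block_transpose (T : Finset ι) (M : Matrix ι ι R) :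
    block T M.transpose = (block T M).transpose := rfl

lemma det_block_submatrix {κ : Type*} [DecidableEq ι] [DecidableEq κ] (e : κ ≃ ι)
    (M : Matrix ι ι R) (T : Finset κ) :
    (block T (M.submatrix e e)).det = (block (T.map e.toEmbedding) M).det := by
  rw [← Matrix.det_submatrix_equiv_self
    (e.subtypeEquiv (p := fun i => i ∈ T) (q := fun j => j ∈ T.map e.toEmbedding) (by simp))]
  rfl

lemma det_block_dconj [DecidableEq ι] (u : ι → Rˣ) (M : Matrix ι ι R) (T : Finset ι) :
    (block T (dconj u M)).det = (block T M).det := by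
  have h : block T (dconj u M) = Matrix.diagonal (fun i : T => (u i : R)) * block T M *
      Matrix.diagonal (fun i : T => (↑(u i)⁻¹ : R)) := by
    ext i j
    rw [Matrix.mul_diagonal, Matrix.diagonal_mul]
    rfl
  rw [h, Matrix.det_mul, Matrix.det_mul, Matrix.det_diagonal, Matrix.det_diagonal]
  have h2 : (∏ i : T, (u i : R)) * ∏ i : T, (↑(u i)⁻¹ : R) = 1 := by
    rw [← Finset.prod_mul_distrib]
    exact Finset.prod_eq_one fun i _ => Units.mul_inv _
  linear_combination (block T M).det * h2

end Blocks

/-! ### Toeplitz matrices -/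

section Toeplitz

variable {R : Type*} [CommRing R] [TopologicalSpace R] [MConvexRing R]

/-- Rapidly decreasing sequences. -/
def RapidSeq (u : ℤ → R) : Prop :=
  ∀ ν ∈ norms (R := R), ∀ k : ℕ, ∃ C : ℝ, ∀ n, wt n ^ k * ν (u n) ≤ C

/-- Units whose powers grow at most polynomially. -/
def PowGrowth (x : Rˣ) : Prop :=
  ∀ ν ∈ norms (R := R), ∃ (k : ℕ) (C : ℝ), ∀ n : ℤ, ν (↑(x ^ n) : R) ≤ C * wt n ^ k

omit [CommRing R] [TopologicalSpace R] [MConvexRing R] in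
/-- The Toeplitz matrix with entries `u (n - m)`. -/
def toep (u : ℤ → R) : Matrix ℤ ℤ R := fun n m => u (n - m)

lemma RapidSeq.comp_neg {u : ℤ → R} (hu : RapidSeq u) : RapidSeq fun n => u (-n) :=
  fun ν hν k => by
    obtain ⟨C, hC⟩ := hu ν hν k
    exact ⟨C, fun n => by rw [← wt_neg]; exact hC (-n)⟩

lemma RapidSeq.rowTame {u : ℤ → R} (hu : RapidSeq u) : RowTame (toep u) := by
  intro ν hν k
  obtain ⟨C, hC⟩ := hu ν hν k
  refine ⟨k, C, fun i j => ?_⟩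
  have h1 : wt j ^ k ≤ wt (i - j) ^ k * wt i ^ k := by
    rw [← mul_pow, ← wt_neg (i - j)]
    refine pow_le_pow_left₀ (wt_pos j).le ?_ k
    simpa using wt_add (-(i - j)) i
  calc _ ≤ (wt (i - j) ^ k * wt i ^ k) * ν (u (i - j)) :=
        mul_le_mul_of_nonneg_right h1 (apply_nonneg ν _)
    _ = (wt (i - j) ^ k * ν (u (i - j))) * wt i ^ k := by ring
    _ ≤ _ := mul_le_mul_of_nonneg_right (hC _) (pow_pos (wt_pos i) k).le

omit [CommRing R] [TopologicalSpace R] [MConvexRing R] in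
lemma toep_transpose (u : ℤ → R) : (toep u).transpose = toep fun n => u (-n) := by
  ext i j
  simp [toep]

lemma RapidSeq.rowTame_transpose {u : ℤ → R} (hu : RapidSeq u) :
    RowTame (toep u).transpose := by
  rw [toep_transpose]
  exact hu.comp_neg.rowTame

/-- This is the symbol obtained from u by conjugation with the diagonal matrix of the powers of x;
rapid decrease absorbs the polynomial growth. -/
lemma RapidSeq.twist {u : ℤ → R} (hu : RapidSeq u) {x : Rˣ} (hx : PowGrowth x) :
    RapidSeq fun n => ↑(x ^ n) * u n := by
  intro ν hν k
  obtain ⟨l, C, hC⟩ := hx ν hν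
  obtain ⟨D, hD⟩ := hu ν hν (k + l)
  have h0 : 0 ≤ C := by
    have := (apply_nonneg ν _).trans (hC 0)
    simpa [wt] using this
  refine ⟨C * D, fun n => ?_⟩
  have hp := pow_pos (wt_pos n) k
  calc _ ≤ wt n ^ k * ((C * wt n ^ l) * ν (u n)) :=
        mul_le_mul_of_nonneg_left ((map_mul_le_mul ν _ _).trans
          (mul_le_mul_of_nonneg_right (hC n) (apply_nonneg ν _))) hp.le
    _ = C * (wt n ^ (k + l) * ν (u n)) := by ring
    _ ≤ _ := mul_le_mul_of_nonneg_left (hD n) h0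

/-- A matrix whose entries are bounded by those of a Toeplitz matrix and vanish unless the indices
have opposite signs decreases rapidly. -/
lemma RapidSeq.rapidMatrix {u : ℤ → R} (hu : RapidSeq u) {K : Matrix ℤ ℤ R} (c : ℤ)
    (h : ∀ n m, K n m = 0 ∨ (|n| ≤ |n + c - m| ∧ |m| ≤ |n + c - m|) ∧
      (K n m = u (n + c - m) ∨ K n m = -u (n + c - m))) : RapidMatrix K := by
  intro ν hν k
  -- Each of the two weights is at most the weight of `n + c - m`, hence the exponent k + k.
  obtain ⟨C, hC⟩ := hu ν hν (k + k)
  refine ⟨C, fun n m => ?_⟩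
  rcases h n m with h | ⟨⟨h1, h2⟩, h3⟩
  · rw [h, map_zero, mul_zero]
    exact (mul_nonneg (pow_pos (wt_pos 0) _).le (apply_nonneg ν _)).trans (hC 0)
  · have e : ν (K n m) = ν (u (n + c - m)) := by
      rcases h3 with h3 | h3 <;> simp [h3]
    rw [e]
    refine le_trans (mul_le_mul_of_nonneg_right ?_ (apply_nonneg ν _)) (hC (n + c - m))
    rw [pow_add]
    exact mul_le_mul (pow_le_pow_left₀ (wt_pos _).le (wt_le_of_abs_le h1) k)
      (pow_le_pow_left₀ (wt_pos _).le (wt_le_of_abs_le h2) k) (pow_pos (wt_pos _) k).le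
      (pow_pos (wt_pos _) k).le

lemma RapidMatrix.sub {A B : Matrix ℤ ℤ R} (hA : RapidMatrix A) (hB : RapidMatrix B) :
    RapidMatrix (A - B) := by
  intro ν hν k
  obtain ⟨C, hC⟩ := hA ν hν k
  obtain ⟨D, hD⟩ := hB ν hν k
  refine ⟨C + D, fun i j => ?_⟩
  refine le_trans (mul_le_mul_of_nonneg_left (map_sub_le_add ν (A i j) (B i j))
    (mul_pos (pow_pos (wt_pos i) k) (pow_pos (wt_pos j) k)).le) ?_
  rw [mul_add]
  exact add_le_add (hC i j) (hD i j)

end Toeplitz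

/-! ### The holomorphic part -/

section Plus

variable {A : Type u} [CommRing A] [TopologicalSpace A] [StrongPolymetricRing A]
  [SequentiallyComplete A] [T2Space A]
variable {R : Type*} [CommRing R] [TopologicalSpace R]

lemma FPlus_mmul_apply (f : A →+* R) (x : R) (M : Matrix ℤ ℤ R) (n m : ℤ) :
    (FPlus f x ⊠ M) n m = M n m - if n < 0 then x * M (n + 1) m else 0 := by
  rw [mmul, tsum_eq_sum (s := {n, n + 1}), Finset.sum_pair (by omega)]
  · simp only [FPlus_apply]
    by_cases h0 : n < 0 <;> simp [h0, sub_eq_add_neg]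
  · intro j hj
    simp only [Finset.mem_insert, Finset.mem_singleton, not_or] at hj
    simp [FPlus_apply, Ne.symm hj.1, hj.2]

lemma mmul_FPlus_apply (f : A →+* R) (x : R) (M : Matrix ℤ ℤ R) (n m : ℤ) :
    (M ⊠ FPlus f x) n m = M n m - if m ≤ 0 then M n (m - 1) * x else 0 := by
  rw [mmul, tsum_eq_sum (s := {m, m - 1}), Finset.sum_pair (by omega)]
  · have h1 : ¬ (m - 1 = m) := by omega
    by_cases h0 : m ≤ 0
    · have h2 : m < 1 := by omega
      simp [FPlus_apply, h0, h2, sub_eq_add_neg]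
    · have h2 : ¬ m < 1 := by omega
      simp [FPlus_apply, h0, h1, h2]
  · intro j hj
    simp only [Finset.mem_insert, Finset.mem_singleton, not_or] at hj
    have : m ≠ j + 1 := by omega
    simp [FPlus_apply, hj.1, this]

lemma dconj_toep (x : Rˣ) (u : ℤ → R) :
    dconj (fun i => x ^ i) (toep u) = toep fun n => ↑(x ^ n) * u n := by
  ext i j
  simp only [dconj, toep, zpow_sub, Units.val_mul]
  ring

/-- The off-diagonal entries sit one step above the diagonal, where conjugation by the powers of x
divides by x. Infinitely many entries of seminorm above 1 are thereby avoided. -/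
lemma dconj_FPlus (f : A →+* R) (x : Rˣ) : dconj (fun i => x ^ i) (FPlus f (x : R)) = FPlus f 1 := by
  ext i j
  have h1 : (↑(x ^ i) : R) * ↑(x ^ i)⁻¹ = 1 := Units.mul_inv _
  have h2 : (x ^ i * x * (x ^ (i + 1))⁻¹ : Rˣ) = 1 := by rw [zpow_add_one, mul_inv_cancel]
  have h3 : (↑(x ^ i) : R) * x * ↑(x ^ (i + 1))⁻¹ = 1 := by
    simpa only [Units.val_mul, Units.val_one] using congrArg Units.val h2
  simp only [dconj, FPlus_apply]
  by_cases hij : i = j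
  · subst hij
    simp [h1]
  · by_cases hc : i < 0 ∧ j = i + 1
    · obtain ⟨h0, rfl⟩ := hc
      simp [h0, h3]
    · simp [hij, hc]

lemma dconj_FPlusInv (x : Rˣ) :
    dconj (fun i => x ^ i) (FPlusInv (x : R)) = FPlusInv (1 : R) := by
  ext i j
  have h1 : (↑(x ^ i) : R) * ↑(x ^ i)⁻¹ = 1 := Units.mul_inv _
  simp only [dconj, FPlusInv]
  by_cases hij : i = j
  · subst hij
    simp [h1]
  · by_cases hc : i < j ∧ j ≤ 0
    · have h2 : (x ^ i * x ^ (j - i).toNat * (x ^ j)⁻¹ : Rˣ) = 1 := by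
        rw [← zpow_natCast, ← zpow_add, ← zpow_neg, ← zpow_add]
        have : i + ((j - i).toNat : ℤ) + -j = 0 := by omega
        rw [this, zpow_zero]
      have h3 : (↑(x ^ i) : R) * x ^ (j - i).toNat * ↑(x ^ j)⁻¹ = 1 := by
        simpa only [Units.val_mul, Units.val_one, Units.val_pow_eq_pow_val] using
          congrArg Units.val h2
      simp only [hij, hc, if_true, if_false, and_self, one_pow, h3]
    · simp only [hij, hc, if_false, mul_zero, zero_mul]

/-- The pairs of indices where `F⁺` may have nonzero entries. -/
def StepRel (i j : ℤ) : Prop := j = i ∨ (i < 0 ∧ j = i + 1)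

/-- Consider the largest i where σ and τ differ. Both must be on the relation there, so one fixes i
and the other sends it to i + 1. Where the first takes the value i + 1 then leads to a
contradiction: at i + 1 the two agree by maximality, and at any other place the step is off the
relation, where they agree by hypothesis. -/
lemma stepRel_inj (σ τ : FinPerm ℤ)
    (h : ∀ i, (¬ StepRel i (σ.1 i) ∨ ¬ StepRel i (τ.1 i)) → σ.1 i = τ.1 i) : σ = τ := by
  by_contra hne
  have hfin : {i | σ.1 i ≠ τ.1 i}.Finite := (σ.2.union τ.2).subset fun i hi => by
    by_contra hc
    simp only [Set.mem_union, Set.mem_ofPred_eq, not_or, not_not] at hc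
    exact hi (hc.1.trans hc.2.symm)
  have hnon : {i | σ.1 i ≠ τ.1 i}.Nonempty := by
    by_contra hc
    rw [Set.not_nonempty_iff_eq_empty] at hc
    refine hne (Subtype.ext (Equiv.ext fun i => ?_))
    by_contra hi
    have : i ∈ {i | σ.1 i ≠ τ.1 i} := hi
    rw [hc] at this
    exact this
  obtain ⟨i, hi, hmax⟩ := hfin.exists_maximal hnon
  have key : ∀ σ τ : FinPerm ℤ,
      (∀ i, (¬ StepRel i (σ.1 i) ∨ ¬ StepRel i (τ.1 i)) → σ.1 i = τ.1 i) →
      (∀ j, i < j → σ.1 j = τ.1 j) → σ.1 i = i → τ.1 i = i + 1 → False := by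
    intro σ τ h hj h1 h2
    obtain ⟨k, hk⟩ := σ.1.surjective (i + 1)
    have hki : k ≠ i := fun hk' => by rw [hk'] at hk; omega
    by_cases hs : StepRel k (σ.1 k)
    · rcases hs with hs | hs
      · have h3 : σ.1 (i + 1) = i + 1 := by
          have : k = i + 1 := by omega
          rw [this] at hk
          exact hk
        have h4 := hj (i + 1) (by omega)
        rw [h3, ← h2] at h4
        have := τ.1.injective h4
        omega
      · omega
    · have h3 := h k (Or.inl hs)
      rw [hk, ← h2] at h3
      exact hki (τ.1.injective h3).symm
  have hgt : ∀ j, i < j → σ.1 j = τ.1 j := fun j hj => by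
    by_contra hc
    have := hmax (y := j) hc hj.le
    omega
  have hσ : StepRel i (σ.1 i) := by
    by_contra hc
    exact hi (h i (Or.inl hc))
  have hτ : StepRel i (τ.1 i) := by
    by_contra hc
    exact hi (h i (Or.inr hc))
  have hi' : σ.1 i ≠ τ.1 i := hi
  rcases hσ with h1 | h1 <;> rcases hτ with h2 | h2
  · exact hi' (h1.trans h2.symm)
  · exact key σ τ h hgt h1 h2.2
  · exact key τ σ (fun i hi => (h i hi.symm).symm) (fun j hj => (hgt j hj).symm) h2 h1.2
  · exact hi' (h1.2.trans h2.2.symm)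

variable [MConvexRing R]

lemma control_stepRel : Control R StepRel fun _ _ => 0 where
  refl _ := Or.inl rfl
  inj := stepRel_inj
  nonneg _ _ _ := le_rfl
  summable _ _ := summable_zero

lemma norm_ite_le_one {ν : RingSeminorm R} (hν : ν ∈ norms (R := R)) (p : Prop) [Decidable p] :
    ν (if p then 1 else 0) ≤ 1 := by
  split_ifs
  · exact MConvexRing.norm_one_le ν hν
  · simp

/-- Since the diagonal is exactly 1, the support is `StepRel` and no entry exceeds 1 in seminorm,
the weights can be taken to be 0. -/
lemma good_FPlus (f : A →+* R) : Good StepRel (fun _ _ => 0) (FPlus f (1 : R)) where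
  diag ν hν i := by simp [FPlus_apply]
  le_one_add ν hν i j := by
    rw [FPlus_apply, add_zero]
    by_cases h : i = j
    · have h1 : ¬ (i < 0 ∧ j = i + 1) := by omega
      rw [if_neg h1, sub_zero]
      exact norm_ite_le_one hν _
    · rw [if_neg h, zero_sub, map_neg_eq_map]
      exact norm_ite_le_one hν _
  le ν hν i j h := by
    unfold StepRel at h
    have h1 : ¬ (i < 0 ∧ j = i + 1) := fun h1 => h (Or.inr h1)
    have h2 : i ≠ j := fun h2 => h (Or.inl h2.symm)
    simp [FPlus_apply, h1, h2]

lemma norm_FPlus_le (f : A →+* R) {ν : RingSeminorm R} (hν : ν ∈ norms (R := R)) (i j : ℤ) :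
    ν (FPlus f (1 : R) i j) ≤ 1 := by
  simpa using (good_FPlus f).le_one_add ν hν i j

lemma wt_sub_le_two {i j : ℤ} (h : |i - j| ≤ 1) : wt (i - j) ≤ 2 := by
  unfold wt
  have : (|((i - j : ℤ) : ℝ)| : ℝ) ≤ 1 := by exact_mod_cast h
  linarith

lemma FPlus_eq_zero (f : A →+* R) (x : R) {i j : ℤ} (h : ¬ |i - j| ≤ 1) : FPlus f x i j = 0 := by
  have h1 : i ≠ j := fun h1 => h (by simp [h1])
  have h2 : ¬ (i < 0 ∧ j = i + 1) := fun h2 => h (by simp [h2.2])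
  simp [FPlus_apply, h1, h2]

lemma rowTame_FPlus (f : A →+* R) : RowTame (FPlus f (1 : R)) :=
  rowTame_of_bounded (fun i j => by
    by_cases h : |i - j| ≤ 1
    · exact Or.inl (wt_sub_le_two h)
    · exact Or.inr (Or.inr (FPlus_eq_zero f 1 h))) fun ν hν => ⟨1, norm_FPlus_le f hν⟩

/-- Off the diagonal, row i is supported on i < j ≤ 0, where |j| ≤ |i|. The columns are infinite
without decay, so the transpose need not be tame; this is why tameness is one-sided. -/
lemma rowTame_FPlusInv : RowTame (FPlusInv (1 : R)) := by
  refine rowTame_of_bounded (fun i j => ?_) fun ν hν => ⟨1, fun i j => ?_⟩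
  · by_cases h : i = j
    · left
      simp [h, wt]
    · by_cases h1 : i < j ∧ j ≤ 0
      · right; left
        have : wt j ≤ wt i := wt_le_of_abs_le (by
          rw [abs_of_nonpos h1.2, abs_of_nonpos (by omega)]; omega)
        linarith [wt_pos i]
      · right; right
        simp only [FPlusInv, h, h1, if_false]
  · unfold FPlusInv
    rw [one_pow]
    split_ifs
    · exact MConvexRing.norm_one_le ν hν
    · exact MConvexRing.norm_one_le ν hν
    · simp

/-- Both products subtract the same number `u (n + 1 - m)`, one for n < 0 and the other for m ≤ 0.
It survives only if exactly one of the conditions holds, that is, on opposite sides of 0. -/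
lemma rapid_FPlus_comm (f : A →+* R) {u : ℤ → R} (hu : RapidSeq u) :
    RapidMatrix (FPlus f (1 : R) ⊠ toep u - toep u ⊠ FPlus f (1 : R)) := by
  refine hu.rapidMatrix 1 fun n m => ?_
  rw [Matrix.sub_apply, FPlus_mmul_apply, mmul_FPlus_apply]
  have e1 : toep u (n + 1) m = u (n + 1 - m) := rfl
  have e2 : toep u n (m - 1) = u (n + 1 - m) := by
    simp only [toep]
    congr 1
    ring
  rw [e1, e2, one_mul, mul_one]
  by_cases hn : n < 0 <;> by_cases hm : m ≤ 0
  · left; simp [hn, hm]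
  · right
    refine ⟨?_, Or.inr (by simp [hn, hm])⟩
    rw [abs_of_neg hn, abs_of_pos (not_le.1 hm), abs_of_nonpos (by omega)]
    omega
  · right
    refine ⟨?_, Or.inl (by simp [hn, hm])⟩
    rw [abs_of_nonneg (not_lt.1 hn), abs_of_nonpos hm, abs_of_nonneg (by omega)]
    omega
  · left; simp [hn, hm]

variable [T2Space R]

/-- All finite blocks are upper unitriangular. -/
lemma idet_FPlus (f : A →+* R) : idet (FPlus f (1 : R)) = 1 := by
  refine (good_FPlus f).idet_eq_of_block control_stepRel ∅ fun T hT => ?_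
  rw [det_block_eq_of_subset hT (by simp) (fun i _ j _ hij => ?_) fun j _ => ?_]
  · simp
  · have h1 : i ≠ j := by omega
    have h2 : ¬ (i < 0 ∧ j = i + 1) := by omega
    simp [FPlus_apply, h1, h2]
  · simp [FPlus_apply]

/-- With K = FU - UF, P = F⁻¹ and V = U⁻¹, the two matrices are 1 + (KP)V and (1 + V(KP))F.
Sylvester's identity and det F = 1 give the same value for both. -/
lemma exists_det_plus_one (f : A →+* R) {u v : ℤ → R} (hu : RapidSeq u) (hv : RapidSeq v)
    (huv : toep u ⊠ toep v = 1) (hvu : toep v ⊠ toep u = 1) :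
    ∃ d, HasDet (FPlus f (1 : R) ⊠ toep u ⊠ FPlusInv 1 ⊠ toep v) d ∧
      HasDet (toep v ⊠ FPlus f (1 : R) ⊠ toep u) d ∧
      Tendsto (fun T => (block T (toep v ⊠ FPlus f (1 : R) ⊠ toep u)).det) atTop (𝓝 d) := by
  let U : RowOp R := ⟨toep u, hu.rowTame⟩
  let V : RowOp R := ⟨toep v, hv.rowTame⟩
  let F : RowOp R := ⟨FPlus f 1, rowTame_FPlus f⟩
  let P : RowOp R := ⟨FPlusInv 1, rowTame_FPlusInv⟩
  have hUV : U * V = 1 := RowOp.ext huv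
  have hVU : V * U = 1 := RowOp.ext hvu
  have hFP : F * P = 1 := RowOp.ext (FPlus_mul_inv f 1)
  have hPF : P * F = 1 := RowOp.ext (FPlus_inv_mul f 1)
  have hK : RapidMatrix (F * U - U * F).val := by
    rw [RowOp.val_sub]
    exact rapid_FPlus_comm f hu
  -- P is attached from the right before V is moved across, so that only the Toeplitz matrix V needs
  -- a tame transpose.
  have hKP : RapidMatrix ((F * U - U * F) * P).val := hK.mmul P.tame
  have hS : RapidMatrix (V * ((F * U - U * F) * P)).val := hKP.mmul_left hv.rowTame_transpose
  have e1 : F * U * P * V = 1 + (F * U - U * F) * P * V := by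
    rw [sub_mul, mul_assoc U F P, hFP, mul_one, sub_mul, hUV]
    abel
  have e2 : V * F * U = F + V * ((F * U - U * F) * P) * F := by
    have h : V * ((F * U - U * F) * P) * F = V * (F * U - U * F) := by
      rw [mul_assoc, mul_assoc, hPF, mul_one]
    rw [h, mul_sub, ← mul_assoc V U F, hVU, one_mul, mul_assoc V F U]
    abel
  have h1 := (good_FPlus f).hasDet_add_mmul control_stepRel hS.nuclear (hS.tripleSummable F.tame)
  rw [idet_FPlus, mul_one] at h1
  have h2 : HasDet (1 + (F * U - U * F) * P * V).val
      (idet (1 + (V * ((F * U - U * F) * P)).val)) := by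
    have h3 := hKP.idet_comm V.tame hv.rowTame_transpose
    rw [RowOp.val_mul V, ← h3]
    exact (hKP.mmul V.tame).nuclear.hasDet
  refine ⟨idet (1 + (V * ((F * U - U * F) * P)).val), ?_, ?_⟩
  · have h4 := h2
    rw [← e1] at h4
    exact h4
  · have h4 : (F + V * ((F * U - U * F) * P) * F).val = toep v ⊠ FPlus f 1 ⊠ toep u := by
      rw [← e2]; rfl
    rw [← h4]
    exact h1

lemma exists_det_plus (f : A →+* R) {u v : ℤ → R} (hu : RapidSeq u) (hv : RapidSeq v)
    (huv : toep u ⊠ toep v = 1) (hvu : toep v ⊠ toep u = 1) {x : Rˣ} (hx : PowGrowth x) :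
    ∃ d, HasDet (FPlus f (x : R) ⊠ toep u ⊠ FPlusInv (x : R) ⊠ toep v) d ∧
      HasDet (toep v ⊠ FPlus f (x : R) ⊠ toep u) d ∧
      Tendsto (fun T => (block T (toep v ⊠ FPlus f (x : R) ⊠ toep u)).det) atTop (𝓝 d) := by
  have hone : dconj (fun i : ℤ => x ^ i) (1 : Matrix ℤ ℤ R) = 1 := by
    ext i j
    rw [dconj]
    by_cases h : i = j
    · subst h
      rw [Matrix.one_apply_eq, mul_one, Units.mul_inv]
    · rw [Matrix.one_apply_ne h, mul_zero, zero_mul]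
  -- Conjugation by the powers of x reduces to the parameter 1 with twisted symbols, and changes
  -- neither the determinants nor those of the blocks.
  obtain ⟨d, h1, h2, h3⟩ := exists_det_plus_one f (hu.twist hx) (hv.twist hx)
    (by rw [← dconj_toep, ← dconj_toep, ← dconj_mmul, huv, hone])
    (by rw [← dconj_toep, ← dconj_toep, ← dconj_mmul, hvu, hone])
  rw [← dconj_toep, ← dconj_toep, ← dconj_FPlus f x] at h1 h2 h3
  rw [← dconj_FPlusInv] at h1
  rw [← dconj_mmul, ← dconj_mmul] at h1 h2 h3
  rw [← dconj_mmul] at h1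
  simp only [det_block_dconj] at h3
  exact ⟨d, (hasDet_dconj_iff _).1 h1, (hasDet_dconj_iff _).1 h2, h3⟩

/-- The determinant of `U(a⁻¹) F⁺ U(a)` for a Laurent polynomial `a` is that of a finite block. -/
lemma det_plus_eq_block (f : A →+* R) {u v : ℤ → R} (hu : RapidSeq u) (hv : RapidSeq v)
    (huv : toep u ⊠ toep v = 1) (hvu : toep v ⊠ toep u = 1) {x : Rˣ} (hx : PowGrowth x)
    {p q : ℕ} (hpq : ∀ n : ℤ, n < -p ∨ q < n → u n = 0) {d : R}
    (hd : HasDet (toep v ⊠ FPlus f (x : R) ⊠ toep u) d) :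
    d = (block (Finset.Ioc (-q : ℤ) p) (toep v ⊠ FPlus f (x : R) ⊠ toep u)).det := by
  obtain ⟨d', -, h2, h3⟩ := exists_det_plus f hu hv huv hvu hx
  rw [← hd.idet_eq, h2.idet_eq]
  have hF : ∀ n m, ∀ j, (toep v ⊠ FPlus f (x : R)) n j * toep u j m =
      (toep v n j - if j ≤ 0 then toep v n (j - 1) * x else 0) * u (j - m) := fun n m j => by
    rw [mmul_FPlus_apply]; rfl
  -- For m ≤ -q, column m of U lives on indices j ≤ 0, where the cutoff in F is always active; for m
  -- > p it lives on j > 0, where it never is. In both cases F acts on the column as a matrix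
  -- commuting with U would, which leaves column m of F.
  have hcol : ∀ m ∉ Finset.Ioc (-q : ℤ) p, ∀ n,
      (toep v ⊠ FPlus f (x : R) ⊠ toep u) n m = FPlus f (x : R) n m := by
    intro m hm n
    have h1 := congrFun₂ hvu n m
    have h2 := congrFun₂ hvu n (m - 1)
    have hs1 := hv.rowTame.summable hu.rowTame n m
    have hs2 := hv.rowTame.summable hu.rowTame n (m - 1)
    rw [mmul] at h1 h2
    rw [mmul, FPlus_apply]
    simp only [Finset.mem_Ioc, not_and_or, not_lt, not_le] at hm
    have e2 : (∑' j, toep v n (j - 1) * x * u (j - m)) = (1 : Matrix ℤ ℤ R) n (m - 1) * x := by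
      rw [← h2, ← hs2.tsum_mul_right, ← (Equiv.addRight (1 : ℤ)).tsum_eq]
      refine tsum_congr fun j => ?_
      simp only [Equiv.coe_addRight, toep]
      rw [show j + 1 - m = j - (m - 1) by ring, add_sub_cancel_right]
      ring
    have hs3 : Summable fun j => toep v n (j - 1) * x * u (j - m) := by
      refine ((Equiv.subRight (1 : ℤ)).summable_iff.2 (hs2.mul_right (x : R))).congr fun j => ?_
      simp only [Function.comp_apply, Equiv.subRight_apply, toep]
      rw [show j - 1 - (m - 1) = j - m by ring]
      ring
    rcases hm with hm | hm
    · have hm0 : m ≤ 0 := by omega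
      have e3 : ∀ j, (toep v ⊠ FPlus f (x : R)) n j * toep u j m =
          toep v n j * toep u j m - toep v n (j - 1) * x * u (j - m) := by
        intro j
        rw [hF]
        by_cases hj : j ≤ 0
        · rw [if_pos hj, sub_mul]; rfl
        · rw [if_neg hj]
          have : u (j - m) = 0 := hpq _ (by omega)
          simp [toep, this]
      rw [tsum_congr e3, hs1.tsum_sub hs3, h1, e2, Matrix.one_apply, Matrix.one_apply]
      congr 1
      by_cases hc : n = m - 1
      · have h5 : n < 0 ∧ m = n + 1 := by omega
        rw [if_pos hc, if_pos h5, one_mul]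
      · have h5 : ¬ (n < 0 ∧ m = n + 1) := by omega
        rw [if_neg hc, if_neg h5, zero_mul]
    · have e3 : ∀ j, (toep v ⊠ FPlus f (x : R)) n j * toep u j m =
          toep v n j * toep u j m := by
        intro j
        rw [hF]
        by_cases hj : j ≤ 0
        · have : u (j - m) = 0 := hpq _ (by omega)
          simp [toep, this]
        · rw [if_neg hj, sub_zero]; rfl
      have h5 : ¬ (n < 0 ∧ m = n + 1) := by omega
      rw [tsum_congr e3, h1, Matrix.one_apply, if_neg h5, sub_zero]
  refine tendsto_nhds_unique h3 (tendsto_const_nhds.congr' ?_)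
  filter_upwards [eventually_ge_atTop (Finset.Ioc (-q : ℤ) p)] with T hT
  refine (det_block_eq_of_subset hT (fun i hi j hj => ?_) (fun i _ j hj hij => ?_)
    fun j hj => ?_).symm
  · rw [hcol j hj, FPlus_apply]
    -- The step from i to i + 1 does not leave the window: it requires i < 0, and then i + 1 ≤ 0 ≤
    -- p.
    simp only [Finset.mem_Ioc] at hi hj
    have h1 : i ≠ j := by rintro rfl; exact hj hi
    have h2 : ¬ (i < 0 ∧ j = i + 1) := by omega
    rw [if_neg h1, if_neg h2, sub_zero]
  · rw [hcol j hj, FPlus_apply, if_neg (by omega), if_neg (by omega), sub_zero]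
  · rw [hcol j hj, FPlus_apply, if_pos rfl, if_neg (by omega), sub_zero]

end Plus

open RapidLaurent (C X)

/-! ### Rapidly decreasing sequences, the powers of w and the embedding of constants. -/

section Sequences

variable {A : Type u} [CommRing A] [TopologicalSpace A] [StrongPolymetricRing A]
  [SequentiallyComplete A] [T2Space A]

lemma RapidSeq.summable_comp {R : Type*} [CommRing R] [TopologicalSpace R] [MConvexRing R]
    {u : ℤ → R} (hu : RapidSeq u) {e : ℕ → ℤ} (he : Function.Injective e) :
    Summable fun k => u (e k) := by
  refine summable_of_norms fun ν hν => ?_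
  obtain ⟨C, hC⟩ := hu ν hν 2
  refine ((summable_wt.comp_injective he).mul_left C).of_nonneg_of_le
    (fun n => apply_nonneg ν _) fun n => ?_
  rw [Function.comp_apply, ← div_eq_mul_inv, le_div_iff₀ (pow_pos (wt_pos _) 2), mul_comm]
  exact hC _

omit [T2Space A] in
lemma RapidLaurent.rapidSeq_coeff (a : RapidLaurent A) : RapidSeq a.coeff := fun ν hν k =>
  ⟨_, fun n => (a.summable_weight_norm hν k).le_tsum n
    fun m _ => mul_nonneg (pow_pos (wt_pos m) k).le (apply_nonneg ν _)⟩

lemma RapidSeq.map_C {u : ℤ → A} (hu : RapidSeq u) : RapidSeq fun n => C (u n) := by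
  rintro _ ⟨ν, hν, K, rfl⟩ k
  obtain ⟨c, hc⟩ := hu ν hν k
  exact ⟨c, fun n => by rw [RapidLaurent.weightedNorm_C]; exact hc n⟩

lemma X_zpow (n : ℤ) : (↑(X A ^ n) : RapidLaurent A) = RapidLaurent.single n 1 := by
  induction n with
  | zero => simp; rfl
  | succ n ih =>
    rw [zpow_add_one, Units.val_mul, ih]
    exact (RapidLaurent.single_mul_single _ _ _ _).trans (by rw [one_mul])
  | pred n ih =>
    rw [zpow_sub_one, Units.val_mul, ih]
    exact (RapidLaurent.single_mul_single _ _ _ _).trans (by rw [one_mul]; rfl)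

/-- The K-th weighted seminorm of wⁿ is (1 + |n|)^K times that of 1. -/
lemma powGrowth_X : PowGrowth (X A) := by
  rintro _ ⟨ν, hν, K, rfl⟩
  refine ⟨K, 1, fun n => ?_⟩
  rw [X_zpow, RapidLaurent.weightedNorm_single, one_mul]
  exact mul_le_of_le_one_right (pow_pos (wt_pos n) K).le (MConvexRing.norm_one_le ν hν)

lemma PowGrowth.inv {R : Type*} [CommRing R] [TopologicalSpace R] [MConvexRing R] {x : Rˣ}
    (hx : PowGrowth x) : PowGrowth x⁻¹ := by
  intro ν hν
  obtain ⟨k, C, h⟩ := hx ν hν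
  refine ⟨k, C, fun n => ?_⟩
  rw [inv_zpow', ← wt_neg]
  exact h (-n)

lemma map_C_mmul {M N : Matrix ℤ ℤ A} (hM : RowTame M) (hN : RowTame N) :
    (M ⊠ N).map C = M.map C ⊠ N.map C := by
  ext1 i j
  simp only [Matrix.map_apply, mmul]
  rw [(hM.summable hN i j).map_tsum (C : A →+* RapidLaurent A) continuous_C]
  simp

end Sequences

/-! ### Substitution of `t = 1` -/

section Substitution

variable {A : Type u} [CommRing A] [TopologicalSpace A] [StrongPolymetricRing A]
  [SequentiallyComplete A] [T2Space A]

lemma FPlusInv_apply_of_pos {R : Type*} [CommRing R] (y : R) {m : ℤ} (hm : 0 < m) (j : ℤ) :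
    FPlusInv y j m = if j = m then 1 else 0 := by
  have : ¬ (j < m ∧ m ≤ 0) := by omega
  simp [FPlusInv, this]

lemma FPlusInv_apply_sub {R : Type*} [CommRing R] (y : R) {m : ℤ} (hm : m ≤ 0) (k : ℕ) :
    FPlusInv y (m - k) m = y ^ k := by
  unfold FPlusInv
  rcases Nat.eq_zero_or_pos k with rfl | hk
  · simp
  · have h1 : ¬ (m - (k : ℤ) = m) := by omega
    have h2 : m - (k : ℤ) < m ∧ m ≤ 0 := by omega
    have h3 : (m - (m - (k : ℤ))).toNat = k := by omega
    rw [if_neg h1, if_pos h2, h3]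

lemma FPlusInv_apply_of_lt {R : Type*} [CommRing R] (y : R) {j m : ℤ} (h : m < j) :
    FPlusInv y j m = 0 := by
  have h1 : ¬ (j = m) := by omega
  have h2 : ¬ (j < m ∧ m ≤ 0) := by omega
  simp only [FPlusInv, h1, h2, if_false]

/-- The entries of `F⁺ U F⁺⁻¹` in the columns `m ≤ 0`. -/
lemma hasSum_FPlus_conj {R : Type*} [CommRing R] [TopologicalSpace R] [IsTopologicalRing R]
    (f : A →+* R) (y : R) (u : ℤ → R) {n m : ℤ} (hm : m ≤ 0) {s : R}
    (hs : HasSum (fun k : ℕ => u (n - m + k) * y ^ k) s) :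
    HasSum (fun j => (FPlus f y ⊠ toep u) n j * FPlusInv y j m)
      (if n < 0 then u (n - m) else s) := by
  have hinj : Function.Injective fun k : ℕ => m - (k : ℤ) := fun k l h => by
    have : m - (k : ℤ) = m - l := h
    omega
  have h0 : ∀ j ∉ Set.range fun k : ℕ => m - (k : ℤ),
      (FPlus f y ⊠ toep u) n j * FPlusInv y j m = 0 := fun j hj => by
    rw [FPlusInv_apply_of_lt, mul_zero]
    by_contra hc
    exact hj ⟨(m - j).toNat, by simp only; omega⟩
  rw [← hinj.hasSum_iff h0]
  have e1 : ∀ k : ℕ, toep u n (m - k) = u (n - m + k) := fun k => by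
    unfold toep
    congr 1
    ring
  have e2 : ∀ k : ℕ, toep u (n + 1) (m - k) = u (n - m + (k + 1 : ℕ)) := fun k => by
    unfold toep
    congr 1
    push_cast
    ring
  by_cases hn : n < 0
  · rw [if_pos hn]
    -- For n < 0 the row of F takes differences of consecutive terms, and the series telescopes to
    -- its first term.
    have h1 := hs.sub ((hasSum_nat_add_iff' 1).2 hs)
    rw [Finset.sum_range_one, sub_sub_cancel, pow_zero, mul_one, Nat.cast_zero, add_zero] at h1
    refine h1.congr_fun fun k => ?_
    rw [Function.comp_apply, FPlus_mmul_apply, FPlusInv_apply_sub _ hm, if_pos hn, e1, e2]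
    ring
  · rw [if_neg hn]
    refine hs.congr_fun fun k => ?_
    rw [Function.comp_apply, FPlus_mmul_apply, FPlusInv_apply_sub _ hm, if_neg hn, e1, sub_zero]

lemma mmul_FPlusInv_of_pos {R : Type*} [CommRing R] [TopologicalSpace R] (M : Matrix ℤ ℤ R) (y : R)
    (n : ℤ) {m : ℤ} (hm : 0 < m) : (M ⊠ FPlusInv y) n m = M n m := by
  rw [mmul, tsum_eq_single m]
  · simp [FPlusInv_apply_of_pos y hm]
  · intro j hj
    simp [FPlusInv_apply_of_pos y hm, hj]

/-- The coefficients of `F⁺(t, x) U F⁺(t, x)⁻¹` sum up to the value at `t = 1`. -/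
lemma hasSum_coeff_FPlus_conj {x : (RapidLaurent A)ˣ} (hx : PowGrowth x) {u : ℤ → A}
    (hu : RapidSeq u) (n m : ℤ) :
    HasSum (fun d => PowerSeries.coeff d
        ((FPlus (CC A) (PowerSeries.X * PowerSeries.C (x : RapidLaurent A)) ⊠
          (toep u).map (CC A) ⊠
          FPlusInv (PowerSeries.X * PowerSeries.C (x : RapidLaurent A))) n m))
      ((FPlus C (x : RapidLaurent A) ⊠ (toep u).map C ⊠ FPlusInv (x : RapidLaurent A)) n m) := by
  have et : (toep u).map (CC A) = toep fun n => CC A (u n) := rfl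
  have et' : (toep u).map C = toep fun n => C (u n) := rfl
  have hCC : ∀ (c : A), HasSum (fun d => PowerSeries.coeff d (CC A c)) (C c) := fun c => by
    have h1 := hasSum_single (f := fun d => PowerSeries.coeff d (CC A c)) 0 fun d hd => by
      rw [CC, RingHom.comp_apply, PowerSeries.coeff_C, if_neg hd]
    simpa [CC] using h1
  have hXC : ∀ (c : A), HasSum (fun d => PowerSeries.coeff d
      (PowerSeries.X * PowerSeries.C (x : RapidLaurent A) * CC A c)) (x * C c) := fun c => by
    have e : PowerSeries.X * PowerSeries.C (x : RapidLaurent A) * CC A c =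
        PowerSeries.C ((x : RapidLaurent A) * C c) * PowerSeries.X ^ 1 := by
      rw [CC, RingHom.comp_apply, map_mul]
      ring
    have h1 := hasSum_single (f := fun d => PowerSeries.coeff d
      (PowerSeries.X * PowerSeries.C (x : RapidLaurent A) * CC A c)) 1 fun d hd => by
        rw [e, PowerSeries.coeff_C_mul_X_pow, if_neg hd]
    rw [e, PowerSeries.coeff_C_mul_X_pow, if_pos rfl] at h1
    rw [e]
    exact h1
  rw [et, et']
  rcases lt_or_ge 0 m with hm | hm
  · rw [mmul_FPlusInv_of_pos _ _ _ hm, mmul_FPlusInv_of_pos _ _ _ hm, FPlus_mmul_apply,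
      FPlus_mmul_apply]
    simp only [map_sub]
    refine (hCC _).sub ?_
    split_ifs
    · exact hXC _
    · simp [hasSum_zero]
  -- Up to a power of x, this is a part of the twisted sequence `x ^ j * u j`, which still decreases
  -- rapidly.
  · have hsum : Summable fun k : ℕ => C (u (n - m + k)) * (x : RapidLaurent A) ^ k := by
      have h2 : Function.Injective fun k : ℕ => n - m + (k : ℤ) := fun k l h => by
        have : n - m + (k : ℤ) = n - m + l := h
        omega
      refine (((hu.map_C.twist hx).summable_comp h2).mul_left (↑(x ^ (-(n - m))) : RapidLaurent A)).congr
        fun k => ?_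
      rw [← mul_assoc, ← Units.val_mul, ← zpow_add, neg_add_cancel_left,
        zpow_natCast, Units.val_pow_eq_pow_val, mul_comm]
    have h1 := hasSum_FPlus_conj C (x : RapidLaurent A) (fun n => C (u n)) (n := n) hm hsum.hasSum
    -- With t restored, the k-th term is a monomial of degree k in t. The series converges in the
    -- power series ring, and its coefficients are the terms of the series at t = 1.
    have h2 : HasSum (fun k : ℕ => CC A (u (n - m + k)) *
        (PowerSeries.X * PowerSeries.C (x : RapidLaurent A)) ^ k)
        (PowerSeries.mk fun k : ℕ => C (u (n - m + k)) * (x : RapidLaurent A) ^ k) := by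
      refine (PowerSeries.hasSum_of_monomials_self (PowerSeries.mk fun k : ℕ =>
        C (u (n - m + k)) * (x : RapidLaurent A) ^ k)).congr_fun fun k => ?_
      rw [PowerSeries.coeff_mk, PowerSeries.monomial_eq_C_mul_X_pow, map_mul, map_pow, mul_pow, CC, RingHom.comp_apply]
      ring
    have h3 := hasSum_FPlus_conj (CC A) _ (fun n => CC A (u n)) (n := n) hm h2
    rw [mmul, mmul, h1.tsum_eq, h3.tsum_eq]
    split_ifs
    · exact hCC _
    · simpa using hsum.hasSum

end Substitution

/-! ### Diagonal matrices -/

section Diagonal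

variable {ι R : Type*} [CommRing R] [TopologicalSpace R] [DecidableEq ι]

lemma diagonal_mmul_apply (d : ι → R) (M : Matrix ι ι R) (i j : ι) :
    (Matrix.diagonal d ⊠ M) i j = d i * M i j := by
  rw [mmul, tsum_eq_single i]
  · rw [Matrix.diagonal_apply_eq]
  · intro k hk
    rw [Matrix.diagonal_apply_ne _ hk.symm, zero_mul]

lemma mmul_diagonal_apply (d : ι → R) (M : Matrix ι ι R) (i j : ι) :
    (M ⊠ Matrix.diagonal d) i j = M i j * d j := by
  rw [mmul, tsum_eq_single j]
  · rw [Matrix.diagonal_apply_eq]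
  · intro k hk
    rw [Matrix.diagonal_apply_ne _ hk, mul_zero]

lemma mmul_diagonal_mmul_apply (d : ι → R) (M N : Matrix ι ι R) (i j : ι) :
    (M ⊠ Matrix.diagonal d ⊠ N) i j = ∑' k, M i k * d k * N k j :=
  tsum_congr fun k => by rw [mmul_diagonal_apply]

lemma rowTame_diagonal {R : Type*} [CommRing R] [TopologicalSpace R] [MConvexRing R] {d : ℤ → R}
    (hd : ∀ ν ∈ norms (R := R), ∃ c : ℝ, ∀ i, ν (d i) ≤ c) : RowTame (Matrix.diagonal d) := by
  refine rowTame_of_bounded (fun i j => ?_) fun ν hν => ?_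
  · by_cases h : i = j
    · left
      simp [h, wt]
    · exact Or.inr (Or.inr (Matrix.diagonal_apply_ne _ h))
  · obtain ⟨c, hc⟩ := hd ν hν
    refine ⟨c, fun i j => ?_⟩
    rw [Matrix.diagonal_apply]
    split_ifs
    · exact hc i
    · rw [map_zero]
      exact (apply_nonneg ν _).trans (hc 0)

lemma rowTame_diagonal_ite {R : Type*} [CommRing R] [TopologicalSpace R] [MConvexRing R]
    (p : ℤ → Prop) [DecidablePred p] (x y : R) :
    RowTame (Matrix.diagonal fun i => if p i then x else y) :=
  rowTame_diagonal fun ν _ => ⟨max (ν x) (ν y), fun i => by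
    split_ifs
    · exact le_max_left _ _
    · exact le_max_right _ _⟩

lemma oneOn_negZ (R : Type*) [Semiring R] :
    oneOn R negZ = Matrix.diagonal fun i => if i < 0 then 1 else 0 := by
  ext i j
  simp only [oneOn, negZ, Set.mem_ofPred_eq, Matrix.diagonal_apply]
  by_cases hij : i = j <;> by_cases hi : i < 0 <;> simp [hij, hi]

lemma oneOn_posZ (R : Type*) [Semiring R] :
    oneOn R posZ = (oneOn R negZ).submatrix (Equiv.neg ℤ) (Equiv.neg ℤ) := by
  ext i j
  by_cases hij : i = j <;> by_cases hi : 0 < i <;> simp [oneOn, posZ, negZ, hij, hi]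

end Diagonal

/-! ### The matrices `U(a⁻¹) 1_{ℤ⁻} U(a)` -/

section ConjNeg

variable {A : Type u} [CommRing A] [TopologicalSpace A] [StrongPolymetricRing A]
  [SequentiallyComplete A] [T2Space A]

lemma rowTame_oneOn_negZ : RowTame (oneOn A negZ) := by
  rw [oneOn_negZ]
  exact rowTame_diagonal_ite _ _ _

lemma hasSum_conjNeg {u v : ℤ → A} (hu : RapidSeq u) (hv : RapidSeq v) (n m : ℤ) :
    HasSum (fun j => v (n - j) * (if j < 0 then 1 else 0) * u (j - m))
      ((toep v ⊠ oneOn A negZ ⊠ toep u) n m) := by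
  have h := ((hv.rowTame.mmul rowTame_oneOn_negZ).summable hu.rowTame n m).hasSum
  rw [oneOn_negZ] at h ⊢
  simp only [mmul_diagonal_apply] at h
  rw [mmul_diagonal_mmul_apply]
  exact h

/-- Column m of U is supported on m - p ≤ j ≤ m + q. If m < -q, all these j are negative, the cutoff
does nothing and V U = 1 remains; if m ≥ p, they are all nonnegative and the cutoff kills the
column. -/
lemma conjNeg_apply_eq {u v : ℤ → A} (hu : RapidSeq u) (hv : RapidSeq v)
    (hvu : toep v ⊠ toep u = 1) {p q : ℕ} (hpq : ∀ n : ℤ, n < -p ∨ q < n → u n = 0) (n m : ℤ)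
    (hm : m ∉ Finset.Ico (-q : ℤ) p) :
    (toep v ⊠ oneOn A negZ ⊠ toep u) n m = oneOn A negZ n m := by
  rw [← (hasSum_conjNeg hu hv n m).tsum_eq, oneOn_negZ]
  simp only [Finset.mem_Ico, not_and_or, not_le, not_lt] at hm
  rcases hm with hm | hm
  · rw [Matrix.diagonal_apply]
    have h1 := congrFun₂ hvu n m
    rw [mmul, Matrix.one_apply] at h1
    have h2 : (if n = m then if n < 0 then (1 : A) else 0 else 0) = if n = m then 1 else 0 := by
      split_ifs <;> first | rfl | omega
    rw [h2, ← h1]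
    refine tsum_congr fun j => ?_
    by_cases hj : j < 0
    · rw [if_pos hj, mul_one]; rfl
    · have h3 : u (j - m) = 0 := hpq _ (by omega)
      simp [toep, h3]
  · have h2 : Matrix.diagonal (fun i : ℤ => if i < 0 then (1 : A) else 0) n m = 0 := by
      rw [Matrix.diagonal_apply]
      split_ifs <;> first | rfl | omega
    rw [h2]
    refine (tsum_congr fun j => ?_).trans tsum_zero
    by_cases hj : j < 0
    · have h3 : u (j - m) = 0 := hpq _ (by omega)
      rw [h3, mul_zero]
    · rw [if_neg hj, mul_zero, zero_mul]

lemma mmul_U_X_inv_apply (M : Matrix ℤ ℤ A) (n m : ℤ) :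
    (M ⊠ U (↑(X A)⁻¹ : RapidLaurent A)) n m = M n (m - 1) := by
  have e : ∀ j, U (↑(X A)⁻¹ : RapidLaurent A) j m = if j - m = -1 then 1 else 0 := fun j => rfl
  rw [mmul, tsum_eq_single (m - 1)]
  · rw [e, if_pos (by ring), mul_one]
  · intro j hj
    rw [e, if_neg (by omega), mul_zero]

/-- The shift U(z⁻¹) commutes with the Toeplitz matrix and may be moved to the far right. -/
lemma conj_FPlus_eq {u v : ℤ → A} (hu : RapidSeq u) (hv : RapidSeq v)
    (hvu : toep v ⊠ toep u = 1) (x : RapidLaurent A) :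
    (toep v).map C ⊠ FPlus C x ⊠ (toep u).map C =
      1 - x • (toep v ⊠ oneOn A negZ ⊠ toep u ⊠ U (↑(X A)⁻¹ : RapidLaurent A)).map C := by
  ext1 n m
  have h1 : HasSum (fun j => C (v (n - j)) * C (u (j - m)))
      ((1 : Matrix ℤ ℤ (RapidLaurent A)) n m) := by
    have h := (hv.map_C.rowTame.summable hu.map_C.rowTame n m).hasSum
    have e : ((toep v).map C ⊠ (toep u).map C) n m = (1 : Matrix ℤ ℤ (RapidLaurent A)) n m := by
      rw [← map_C_mmul hv.rowTame hu.rowTame, hvu]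
      simp [Matrix.one_apply, apply_ite (C : A →+* RapidLaurent A)]
    rw [← e]
    exact h
  have h2 := ((hasSum_conjNeg hu hv n (m - 1)).map (C : A →+* RapidLaurent A) continuous_C).mul_left
    x
  -- The shift of the summation index turns the condition j < 0 of the cutoff into the condition j ≤
  -- 0 on the columns of F.
  rw [← (Equiv.subRight (1 : ℤ)).hasSum_iff] at h2
  have h3 := h1.sub h2
  rw [Matrix.sub_apply, Matrix.smul_apply, Matrix.map_apply, mmul_U_X_inv_apply, smul_eq_mul,
    ← h3.tsum_eq, mmul]
  refine tsum_congr fun j => ?_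
  rw [mmul_FPlus_apply]
  simp only [Matrix.map_apply, toep, Function.comp_apply, Equiv.subRight_apply, map_mul]
  rw [show j - 1 - (m - 1) = j - m by ring]
  by_cases hj : j ≤ 0
  · have hj' : j - 1 < 0 := by omega
    rw [if_pos hj, if_pos hj', map_one]
    ring
  · have hj' : ¬ (j - 1 < 0) := by omega
    rw [if_neg hj, if_neg hj', map_zero]
    ring

end ConjNeg

/-! ### The orthogonal part -/

section SkipZero

lemma skipZero_injective : Function.Injective skipZero := by
  intro x y h
  unfold skipZero at h
  split_ifs at h <;> omega

lemma skipZero_ne_zero (n : ℤ) : skipZero n ≠ 0 := by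
  unfold skipZero
  split_ifs <;> omega

lemma exists_skipZero {n : ℤ} (hn : n ≠ 0) : ∃ k, n = skipZero k := by
  unfold skipZero
  by_cases h : n < 0
  · exact ⟨n, by simp [h]⟩
  · refine ⟨n - 1, ?_⟩
    rw [if_neg (by omega)]
    ring

variable {R : Type*} [CommRing R]

variable (R) in
/-- The matrix of the inclusion `skipZero`. -/
def skipMatrix : Matrix ℤ ℤ R := fun i j => if i = skipZero j then 1 else 0

variable (R) in
/-- The elementary matrix with entry `1` at the index `(0, 0)`. -/
def zeroUnit : Matrix ℤ ℤ R := Matrix.diagonal fun i => if i = 0 then 1 else 0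

variable [TopologicalSpace R]

lemma skipMatrix_mmul_skip (M : Matrix ℤ ℤ R) (k j : ℤ) :
    (skipMatrix R ⊠ M) (skipZero k) j = M k j := by
  rw [mmul, tsum_eq_single k]
  · simp [skipMatrix]
  · intro l hl
    have : skipZero k ≠ skipZero l := fun h => hl (skipZero_injective h).symm
    simp [skipMatrix, this]

lemma skipMatrix_mmul_zero (M : Matrix ℤ ℤ R) (j : ℤ) : (skipMatrix R ⊠ M) 0 j = 0 := by
  rw [mmul]
  refine (tsum_congr fun k => ?_).trans tsum_zero
  simp [skipMatrix, (skipZero_ne_zero k).symm]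

lemma mmul_skipMatrix_skip (M : Matrix ℤ ℤ R) (i k : ℤ) :
    (M ⊠ (skipMatrix R).transpose) i (skipZero k) = M i k := by
  have := skipMatrix_mmul_skip M.transpose k i
  rwa [← Matrix.transpose_transpose (skipMatrix R), ← transpose_mmul] at this

lemma mmul_skipMatrix_zero (M : Matrix ℤ ℤ R) (i : ℤ) :
    (M ⊠ (skipMatrix R).transpose) i 0 = 0 := by
  have := skipMatrix_mmul_zero M.transpose i
  rwa [← Matrix.transpose_transpose (skipMatrix R), ← transpose_mmul] at this

/-- The inclusion J of ℤ as the nonzero integers satisfies Jᵗ J = 1, and J Jᵗ is complementary to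
the unit at the index 0, which it annihilates. These relations are all that is needed of J. -/
lemma skipMatrix_transpose_mmul : (skipMatrix R).transpose ⊠ skipMatrix R = 1 := by
  ext i j
  rw [mmul, tsum_eq_single (skipZero i)]
  · simp [skipMatrix, Matrix.one_apply, skipZero_injective.eq_iff]
  · intro k hk
    simp [skipMatrix, hk]

lemma zeroUnit_add_skipMatrix : zeroUnit R + skipMatrix R ⊠ (skipMatrix R).transpose = 1 := by
  ext i j
  rw [Matrix.add_apply, zeroUnit, Matrix.diagonal_apply, Matrix.one_apply]
  by_cases hi : i = 0
  · subst hi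
    rw [skipMatrix_mmul_zero]
    simp
  · obtain ⟨k, rfl⟩ := exists_skipZero hi
    rw [skipMatrix_mmul_skip]
    simp [skipMatrix, hi, eq_comm]

lemma zeroUnit_mmul_zeroUnit : zeroUnit R ⊠ zeroUnit R = zeroUnit R := by
  ext i j
  rw [zeroUnit, diagonal_mmul_apply, Matrix.diagonal_apply]
  split_ifs <;> simp

lemma zeroUnit_mmul_skipMatrix : zeroUnit R ⊠ skipMatrix R = 0 := by
  ext i j
  rw [zeroUnit, diagonal_mmul_apply, skipMatrix]
  by_cases h : i = skipZero j
  · rw [if_neg (h ▸ skipZero_ne_zero j), zero_mul, Matrix.zero_apply]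
  · rw [if_neg h, mul_zero, Matrix.zero_apply]

lemma skipMatrix_transpose_mmul_zeroUnit : (skipMatrix R).transpose ⊠ zeroUnit R = 0 := by
  have h := congrArg Matrix.transpose (zeroUnit_mmul_skipMatrix (R := R))
  rwa [transpose_mmul, zeroUnit, Matrix.diagonal_transpose, Matrix.transpose_zero] at h

variable [MConvexRing R]

lemma wt_sub_skipZero (j : ℤ) : wt (skipZero j - j) ≤ 2 := by
  refine wt_sub_le_two ?_
  unfold skipZero
  split_ifs <;> simp

lemma rowTame_skipMatrix : RowTame (skipMatrix R) := by
  refine rowTame_of_bounded (fun i j => ?_) fun ν hν => ⟨1, fun i j => norm_ite_le_one hν _⟩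
  by_cases h : i = skipZero j
  · exact Or.inl (h ▸ wt_sub_skipZero j)
  · exact Or.inr (Or.inr (if_neg h))

lemma rowTame_skipMatrix_transpose : RowTame (skipMatrix R).transpose := by
  refine rowTame_of_bounded (fun i j => ?_) fun ν hν => ⟨1, fun i j => norm_ite_le_one hν _⟩
  by_cases h : j = skipZero i
  · left
    rw [← wt_neg, neg_sub]
    exact h ▸ wt_sub_skipZero i
  · exact Or.inr (Or.inr (if_neg h))

end SkipZero

/-! ### Diagonal matrices with a jump at 0. -/

section Sign

variable {R : Type*} [CommRing R]

/-- The diagonal matrix with entries `x` at the negative and `1` at the other indices. -/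
def signDiag (x : R) : Matrix ℤ ℤ R := Matrix.diagonal fun i => if i < 0 then x else 1

lemma signDiag_mmul [TopologicalSpace R] (x y : R) :
    signDiag x ⊠ signDiag y = signDiag (x * y) := by
  ext i j
  rw [signDiag, signDiag, diagonal_mmul_apply, signDiag, Matrix.diagonal_apply,
    Matrix.diagonal_apply]
  split_ifs <;> simp

lemma signDiag_one : signDiag (1 : R) = 1 := by
  ext i j
  simp [signDiag, Matrix.diagonal_apply, Matrix.one_apply]

lemma rowTame_signDiag [TopologicalSpace R] [MConvexRing R] (x : R) : RowTame (signDiag x) :=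
  rowTame_diagonal_ite _ _ _

lemma signDiag_transpose (x : R) : (signDiag x).transpose = signDiag x :=
  Matrix.diagonal_transpose _

variable [TopologicalSpace R] [MConvexRing R]

lemma RapidSeq.const_mul {u : ℤ → R} (hu : RapidSeq u) (c : R) : RapidSeq fun n => c * u n := by
  intro ν hν k
  obtain ⟨D, hD⟩ := hu ν hν k
  refine ⟨ν c * D, fun n => ?_⟩
  calc _ ≤ wt n ^ k * (ν c * ν (u n)) :=
        mul_le_mul_of_nonneg_left (map_mul_le_mul ν _ _) (pow_pos (wt_pos n) k).le
    _ = ν c * (wt n ^ k * ν (u n)) := by ring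
    _ ≤ _ := mul_le_mul_of_nonneg_left (hD n) (apply_nonneg ν _)

/-- The commutator has entries ±(x - 1) u(n - m) where exactly one index is negative, and vanishes
elsewhere. -/
lemma rapid_signDiag_comm (x : R) {u : ℤ → R} (hu : RapidSeq u) :
    RapidMatrix (signDiag x ⊠ toep u - toep u ⊠ signDiag x) := by
  refine (hu.const_mul (x - 1)).rapidMatrix 0 fun n m => ?_
  rw [Matrix.sub_apply, signDiag, diagonal_mmul_apply, mmul_diagonal_apply, toep, add_zero]
  by_cases hn : n < 0 <;> by_cases hm : m < 0
  · left; simp only [hn, hm, if_true]; ring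
  · right
    refine ⟨?_, Or.inl (by simp only [hn, hm, if_true, if_false]; ring)⟩
    rw [abs_of_neg hn, abs_of_nonneg (not_lt.1 hm), abs_of_neg (by omega)]
    omega
  · right
    refine ⟨?_, Or.inr (by simp only [hn, hm, if_true, if_false]; ring)⟩
    rw [abs_of_nonneg (not_lt.1 hn), abs_of_neg hm, abs_of_pos (by omega)]
    omega
  · left; simp only [hn, hm, if_false]; ring

lemma RapidMatrix.add {A B : Matrix ℤ ℤ R} (hA : RapidMatrix A) (hB : RapidMatrix B) :
    RapidMatrix (A + B) := by
  intro ν hν k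
  obtain ⟨C, hC⟩ := hA ν hν k
  obtain ⟨D, hD⟩ := hB ν hν k
  refine ⟨C + D, fun i j => ?_⟩
  refine le_trans (mul_le_mul_of_nonneg_left (map_add_le_add ν (A i j) (B i j))
    (mul_pos (pow_pos (wt_pos i) k) (pow_pos (wt_pos j) k)).le) ?_
  rw [mul_add]
  exact add_le_add (hC i j) (hD i j)

lemma rapidMatrix_zeroUnit : RapidMatrix (zeroUnit R) := by
  intro ν hν k
  refine ⟨1, fun i j => ?_⟩
  rw [zeroUnit, Matrix.diagonal_apply]
  by_cases hi : i = 0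
  · by_cases hj : i = j
    · rw [if_pos hj, if_pos hi, ← hj, hi]
      simpa [wt] using MConvexRing.norm_one_le ν hν
    · simp [hj]
  · simp [hi]

end Sign

/-! ### The factorization of the orthogonal part. -/

section Tilde

variable {A : Type u} [CommRing A] [TopologicalSpace A] [StrongPolymetricRing A]
  [SequentiallyComplete A] [T2Space A]

/-- Closing the gap at 0 absorbs the shifts n - m ± 1 in the mixed quadrants, and the factors -w and
-w⁻¹ there are those of a conjugation by the diagonal matrix with -w at negative and 1 at other
indices. -/
lemma UTilde_eq (a : RapidLaurent A) (w : (RapidLaurent A)ˣ) :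
    UTilde a w = zeroUnit _ + skipMatrix _ ⊠ (signDiag (-(w : RapidLaurent A)) ⊠ (U a).map C ⊠
      signDiag (-(↑w⁻¹ : RapidLaurent A))) ⊠ (skipMatrix _).transpose := by
  ext1 n m
  rw [Matrix.add_apply]
  by_cases hm : m = 0
  · subst hm
    rw [mmul_skipMatrix_zero, add_zero, zeroUnit, Matrix.diagonal_apply]
    simp only [UTilde, or_true, if_true]
    split_ifs <;> rfl
  · obtain ⟨m, rfl⟩ := exists_skipZero hm
    rw [mmul_skipMatrix_skip]
    by_cases hn : n = 0
    · subst hn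
      rw [skipMatrix_mmul_zero, add_zero, zeroUnit, Matrix.diagonal_apply]
      simp only [UTilde, true_or, if_true]
    · obtain ⟨n, rfl⟩ := exists_skipZero hn
      rw [skipMatrix_mmul_skip, UTilde_skipZero, zeroUnit, Matrix.diagonal_apply, if_neg hn,
        ite_self, zero_add, signDiag, signDiag, mmul_diagonal_apply, diagonal_mmul_apply,
        Matrix.map_apply, U]
      have hw : (w : RapidLaurent A) * ↑w⁻¹ = 1 := w.mul_inv
      split_ifs <;> first
        | omega
        | ring1
        | linear_combination (-C (a.coeff (n - m))) * hw

/-- The matrices agree for n m > 0. The difference is written as four pieces: U on the axes and in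
the mixed quadrants, the shifted entries of Ũ in each mixed quadrant, and the entry 1 at (0, 0). -/
lemma rapid_U_sub_UTilde (a : RapidLaurent A) :
    RapidMatrix ((U a).map C - UTilde a 1) := by
  have hu := a.rapidSeq_coeff.map_C
  have h0 : RapidMatrix fun n m : ℤ =>
      if (n ≤ 0 ∧ 0 ≤ m) ∨ (0 ≤ n ∧ m ≤ 0) then C (a.coeff (n + 0 - m)) else 0 :=
    hu.rapidMatrix 0 fun n m => by
      by_cases h : (n ≤ 0 ∧ 0 ≤ m) ∨ (0 ≤ n ∧ m ≤ 0)
      · right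
        rw [if_pos h]
        refine ⟨?_, Or.inl rfl⟩
        rcases h with h | h
        · rw [abs_of_nonpos h.1, abs_of_nonneg h.2, abs_of_nonpos (by omega)]
          omega
        · rw [abs_of_nonneg h.1, abs_of_nonpos h.2, abs_of_nonneg (by omega)]
          omega
      · exact Or.inl (if_neg h)
  have h1 : RapidMatrix fun n m : ℤ => if n < 0 ∧ 0 < m then C (a.coeff (n + 1 - m)) else 0 :=
    hu.rapidMatrix 1 fun n m => by
      by_cases h : n < 0 ∧ 0 < m
      · right
        rw [if_pos h]
        refine ⟨?_, Or.inl rfl⟩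
        rw [abs_of_neg h.1, abs_of_pos h.2, abs_of_nonpos (by omega)]
        omega
      · exact Or.inl (if_neg h)
  have h2 : RapidMatrix fun n m : ℤ => if 0 < n ∧ m < 0 then C (a.coeff (n + -1 - m)) else 0 :=
    hu.rapidMatrix (-1) fun n m => by
      by_cases h : 0 < n ∧ m < 0
      · right
        rw [if_pos h]
        refine ⟨?_, Or.inl rfl⟩
        rw [abs_of_pos h.1, abs_of_neg h.2, abs_of_nonneg (by omega)]
        omega
      · exact Or.inl (if_neg h)
  have h3 := ((h0.add h1).add h2).sub (rapidMatrix_zeroUnit (R := RapidLaurent A))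
  convert h3 using 1
  ext1 n m
  change C (a.coeff (n - m)) - UTilde a 1 n m =
    (if (n ≤ 0 ∧ 0 ≤ m) ∨ (0 ≤ n ∧ m ≤ 0) then C (a.coeff (n + 0 - m)) else 0) +
      (if n < 0 ∧ 0 < m then C (a.coeff (n + 1 - m)) else 0) +
      (if 0 < n ∧ m < 0 then C (a.coeff (n + -1 - m)) else 0) - zeroUnit _ n m
  simp only [UTilde, zeroUnit, Matrix.diagonal_apply, Units.val_one, inv_one, one_mul, add_zero]
  rw [show n - m + 1 = n + 1 - m by ring, show n - m - 1 = n + -1 - m by ring]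
  split_ifs <;> first | omega | ring1

/-- The analogue of `commMatrix` with integer indices. -/
def commMatrixInt (a w : (RapidLaurent A)ˣ) : Matrix ℤ ℤ (RapidLaurent A) :=
  (U (↑a⁻¹ : RapidLaurent A)).map C ⊠ signDiag (↑w⁻¹ : RapidLaurent A) ⊠
    (U (a : RapidLaurent A)).map C ⊠ signDiag (w : RapidLaurent A)

lemma RowOp.transpose_mul {R : Type*} [CommRing R] [TopologicalSpace R] [MConvexRing R]
    {a b : RowOp R} (ha : RowTame a.val.transpose) (hb : RowTame b.val.transpose) :
    RowTame (a * b).val.transpose := by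
  rw [RowOp.val_mul, transpose_mmul]
  exact hb.mmul ha

lemma map_C_one : (1 : Matrix ℤ ℤ A).map C = (1 : Matrix ℤ ℤ (RapidLaurent A)) :=
  Matrix.map_one _ (map_zero C) (map_one C)

lemma U_map_C_mmul (a b : RapidLaurent A) :
    (U a).map C ⊠ (U b).map C = (U (a * b)).map C := by
  rw [← U_mul]
  exact (map_C_mmul (M := U a) (N := U b) a.rapidSeq_coeff.rowTame b.rapidSeq_coeff.rowTame).symm

/-- With T = Ũ(a, 1), one writes U Ũ(a, w)⁻¹ = (U T⁻¹)(T Ũ(a, w)⁻¹). The first factor is nuclear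
perturbation of 1 because U - T decreases rapidly; the second is intertwined with the commutator
matrix. -/
lemma tilde_factorization (a w : (RapidLaurent A)ˣ) :
    ∃ d₁ d₂ : RapidLaurent A, HasDet (tildeMatrix a 1) d₁ ∧
      Tendsto (fun T => (block T (tildeMatrix a 1)).det) atTop (𝓝 d₁) ∧
      HasDet (commMatrixInt a w) d₂ ∧
      Tendsto (fun T => (block T (commMatrixInt a w)).det) atTop (𝓝 d₂) ∧
      HasDet (tildeMatrix a w) (d₁ * d₂) := by
  have hu := (a : RapidLaurent A).rapidSeq_coeff.map_C
  have hv := (↑a⁻¹ : RapidLaurent A).rapidSeq_coeff.map_C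
  let U' : RowOp (RapidLaurent A) := ⟨(U (a : RapidLaurent A)).map C, hu.rowTame⟩
  let V : RowOp (RapidLaurent A) := ⟨(U (↑a⁻¹ : RapidLaurent A)).map C, hv.rowTame⟩
  let J : RowOp (RapidLaurent A) := ⟨skipMatrix _, rowTame_skipMatrix⟩
  let Jt : RowOp (RapidLaurent A) := ⟨(skipMatrix _).transpose, rowTame_skipMatrix_transpose⟩
  let Z : RowOp (RapidLaurent A) := ⟨zeroUnit _, rapidMatrix_zeroUnit.rowTame⟩
  let D : RowOp (RapidLaurent A) := ⟨signDiag (w : RapidLaurent A), rowTame_signDiag _⟩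
  let Di : RowOp (RapidLaurent A) := ⟨signDiag (↑w⁻¹ : RapidLaurent A), rowTame_signDiag _⟩
  let E : RowOp (RapidLaurent A) := ⟨signDiag (-1), rowTame_signDiag _⟩
  have hUV : U' * V = 1 := RowOp.ext <| by
    rw [RowOp.val_mul, U_map_C_mmul, Units.mul_inv, U_one, map_C_one]; rfl
  have hVU : V * U' = 1 := RowOp.ext <| by
    rw [RowOp.val_mul, U_map_C_mmul, Units.inv_mul, U_one, map_C_one]; rfl
  have hDDi : D * Di = 1 := RowOp.ext <| by
    rw [RowOp.val_mul, signDiag_mmul, Units.mul_inv, signDiag_one]; rfl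
  have hDiD : Di * D = 1 := RowOp.ext <| by
    rw [RowOp.val_mul, signDiag_mmul, Units.inv_mul, signDiag_one]; rfl
  have hEE : E * E = 1 := RowOp.ext <| by
    rw [RowOp.val_mul, signDiag_mmul, neg_mul_neg, one_mul, signDiag_one]; rfl
  have hED : (E * D).val = signDiag (-(w : RapidLaurent A)) := by
    rw [RowOp.val_mul, signDiag_mmul, neg_one_mul]
  have hDE : (Di * E).val = signDiag (-(↑w⁻¹ : RapidLaurent A)) := by
    rw [RowOp.val_mul, signDiag_mmul, mul_neg_one]
  have hJ : Jt * J = 1 := RowOp.ext skipMatrix_transpose_mmul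
  have hZJ : Z + J * Jt = 1 := RowOp.ext zeroUnit_add_skipMatrix
  have hZZ : Z * Z = Z := RowOp.ext zeroUnit_mmul_zeroUnit
  have hZJ0 : Z * J = 0 := RowOp.ext zeroUnit_mmul_skipMatrix
  have hJZ0 : Jt * Z = 0 := RowOp.ext skipMatrix_transpose_mmul_zeroUnit
  have hT1 : (Z + J * (E * U' * E) * Jt).val = UTilde (a : RapidLaurent A) 1 := by
    rw [UTilde_eq, Units.val_one, inv_one, Units.val_one]; rfl
  have hT1i : (Z + J * (E * V * E) * Jt).val = UTilde (↑a⁻¹ : RapidLaurent A) 1 := by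
    rw [UTilde_eq, Units.val_one, inv_one, Units.val_one]; rfl
  have hTwi : (Z + J * (E * D * V * (Di * E)) * Jt).val = UTilde (↑a⁻¹ : RapidLaurent A) w := by
    rw [UTilde_eq, ← hED, ← hDE]; rfl
  set T := Z + J * (E * U' * E) * Jt with hT
  set Ti := Z + J * (E * V * E) * Jt
  set Twi := Z + J * (E * D * V * (Di * E)) * Jt with hTw
  have hTi : Ti * T = 1 := RowOp.ext <| by
    rw [RowOp.val_mul, hT1, hT1i]
    exact (UTilde_inv a 1).2
  have hTi' : T * Ti = 1 := RowOp.ext <| by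
    rw [RowOp.val_mul, hT1, hT1i]
    exact (UTilde_inv a 1).1
  -- Q is the deviation of U⁻¹ D⁻¹ U D from 1. It contains a commutator of U with a jump matrix and
  -- therefore decreases rapidly.
  let Q := V * (Di * U' - U' * Di) * D
  have hQ : V * Di * U' * D = 1 + Q := by
    have : V * (U' * Di) * D = 1 := by rw [← mul_assoc, hVU, one_mul, hDiD]
    simp only [Q, mul_sub, sub_mul, ← mul_assoc]
    rw [mul_assoc V U' Di, this]
    abel
  have hQr : RapidMatrix Q.val := by
    have h1 : RapidMatrix (Di * U' - U' * Di).val := by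
      rw [RowOp.val_sub]
      exact rapid_signDiag_comm _ hu
    exact (h1.mmul_left hv.rowTame_transpose).mmul D.tame
  -- L and M are chosen such that M L = 1 and L M = J Jᵗ, so conjugation by them transplants Q to
  -- the nonzero indices.
  let L := J * E * U' * D
  let M := Di * V * E * Jt
  have hML : M * L = 1 := by
    simp only [M, L, mul_assoc]
    rw [← mul_assoc Jt J, hJ, one_mul, ← mul_assoc E E, hEE, one_mul, ← mul_assoc V U', hVU,
      one_mul, hDiD]
  have hLM : L * M = J * Jt := by
    simp only [M, L, mul_assoc]
    rw [← mul_assoc D Di, hDDi, one_mul, ← mul_assoc U' V, hUV, one_mul, ← mul_assoc E E, hEE,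
      one_mul]
  -- On the nonzero indices T Ũ(a, w)⁻¹ is L (1 + Q) M, and at 0 it is 1; since Z + L M = 1, only L
  -- Q M remains.
  have hN : T * Twi = 1 + L * Q * M := by
    have h1 : L * Q * M = L * (V * Di * U' * D) * M - L * M := by
      rw [hQ]; noncomm_ring
    have h2 : U' * D * M = E * Jt := by
      simp only [M, ← mul_assoc]
      rw [mul_assoc U' D Di, hDDi, mul_one, hUV, one_mul]
    have h3 : L * (V * Di * U' * D) * M = J * E * U' * D * V * Di * (E * Jt) := by
      rw [← h2]; simp only [L, mul_assoc]
    have h4 : T * Twi = Z + J * E * U' * D * V * Di * (E * Jt) := by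
      rw [hT, hTw, add_mul, mul_add, mul_add, hZZ]
      have h5 : Z * (J * (E * D * V * (Di * E)) * Jt) = 0 := by
        rw [← mul_assoc, ← mul_assoc, hZJ0, zero_mul, zero_mul]
      have h6 : J * (E * U' * E) * Jt * Z = 0 := by rw [mul_assoc, hJZ0, mul_zero]
      have h7 : J * (E * U' * E) * Jt * (J * (E * D * V * (Di * E)) * Jt) =
          J * E * U' * (E * E) * D * V * Di * (E * Jt) := by
        simp only [mul_assoc]
        rw [← mul_assoc Jt J, hJ, one_mul]
      rw [h5, h6, h7, hEE, mul_one, add_zero, zero_add]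
    rw [h4, h1, h3, hLM, ← hZJ]
    abel
  have hLQ : RapidMatrix (L * Q).val := hQr.mmul_left <| by
    refine RowOp.transpose_mul (RowOp.transpose_mul (RowOp.transpose_mul ?_ ?_) ?_) ?_
    · exact rowTame_skipMatrix_transpose
    · exact (signDiag_transpose (-1 : RapidLaurent A)).symm ▸ E.tame
    · exact hu.rowTame_transpose
    · exact (signDiag_transpose (w : RapidLaurent A)).symm ▸ D.tame
  have hMt : RowTame M.val.transpose := by
    refine RowOp.transpose_mul (RowOp.transpose_mul (RowOp.transpose_mul ?_ ?_) ?_) ?_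
    · exact (signDiag_transpose (↑w⁻¹ : RapidLaurent A)).symm ▸ Di.tame
    · exact hv.rowTame_transpose
    · exact (signDiag_transpose (-1 : RapidLaurent A)).symm ▸ E.tame
    · exact (Matrix.transpose_transpose (skipMatrix (RapidLaurent A))).symm ▸ J.tame
  have hNdet : idet (T * Twi).val = idet (1 + Q.val) := by
    -- Sylvester's identity for (L Q) M, followed by M L = 1.
    have h1 := hLQ.idet_comm M.tame hMt
    rw [hN]
    refine h1.trans ?_
    have h2 : (M * (L * Q)).val = Q.val := by rw [← mul_assoc, hML, one_mul]
    rw [← RowOp.val_mul, h2]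
  have hS : RapidMatrix ((U' - T) * Ti).val := by
    refine RapidMatrix.mmul ?_ Ti.tame
    rw [RowOp.val_sub, hT1]
    exact rapid_U_sub_UTilde _
  have hUT : U' * Ti = 1 + (U' - T) * Ti := by
    rw [sub_mul, hTi']
    abel
  have hUT1 : tildeMatrix a 1 = 1 + ((U' - T) * Ti).val := by
    have : (U' * Ti).val = tildeMatrix a 1 := by rw [RowOp.val_mul, hT1i]; rfl
    rw [← this, hUT]; rfl
  have hcomm : commMatrixInt a w = 1 + Q.val := congrArg RowOp.val hQ
  have hUTw : tildeMatrix a w = (T * Twi).val + ((U' - T) * Ti).val ⊠ (T * Twi).val := by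
    have h1 : U' * Twi = T * Twi + (U' - T) * Ti * (T * Twi) := by
      have : (U' - T) * Ti * (T * Twi) = (U' - T) * Twi := by
        rw [mul_assoc, ← mul_assoc Ti T, hTi, one_mul]
      rw [this, sub_mul]
      abel
    have h2 : (U' * Twi).val = tildeMatrix a w := by rw [RowOp.val_mul, hTwi]; rfl
    rw [← h2, h1]; rfl
  have hQn := hQr.nuclear
  have hSn := hS.nuclear
  refine ⟨idet (1 + ((U' - T) * Ti).val), idet (1 + Q.val), ?_, ?_, ?_, ?_, ?_⟩
  · rw [hUT1]
    exact hSn.hasDet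
  · rw [hUT1]
    simp only [block_one_add]
    exact hSn.tendsto_block
  · rw [hcomm]
    exact hQn.hasDet
  · rw [hcomm]
    simp only [block_one_add]
    exact hQn.tendsto_block
  · have hNn := (hLQ.mmul M.tame).nuclear
    have hg : Good Eq (fun ν (x : ℤ × ℤ) => ν ((L * Q * M).val x.1 x.2)) (T * Twi).val := by
      rw [hN]
      exact good_one_add (A := (L * Q * M).val) fun ν _ i j => le_rfl
    rw [hUTw, ← hNdet]
    exact (hg.hasDet_add_mmul hNn.control hSn (hS.tripleSummable (T * Twi).tame)).1

end Tilde

/-! ### Finite determinants -/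

section Finite

variable {ι R : Type*} [CommRing R]

lemma block_one_sub_smul [DecidableEq ι] (T : Finset ι) (x : R) (M : Matrix ι ι R) :
    block T (1 - x • M) = 1 - x • block T M := by
  have h : block T (1 : Matrix ι ι R) = 1 := Matrix.submatrix_one _ Subtype.val_injective
  rw [← h]
  rfl

lemma submatrix_one_sub_smul {κ : Type*} [DecidableEq ι] [DecidableEq κ] (e : κ ≃ ι) (x : R)
    (M : Matrix ι ι R) :
    (1 - x • M).submatrix e e = 1 - x • M.submatrix e e := by
  rw [← Matrix.submatrix_one_equiv (α := R) e]
  rfl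

variable [TopologicalSpace R] [T2Space R] [LinearOrder ι]

/-- The limit of the block determinants of a matrix with trivial columns outside `S`. -/
lemma eq_det_block_of_col {M : Matrix ι ι R} {S : Finset ι}
    (h : ∀ i, ∀ j ∉ S, M i j = (1 : Matrix ι ι R) i j) {d : R}
    (hd : Tendsto (fun T => (block T M).det) atTop (𝓝 d)) : d = (block S M).det := by
  refine tendsto_nhds_unique hd (tendsto_const_nhds.congr' ?_)
  filter_upwards [eventually_ge_atTop S] with T hT
  refine (det_block_eq_of_subset hT (fun i hi j hj => ?_) (fun i _ j hj hji => ?_)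
    fun j hj => ?_).symm
  · have hne : i ≠ j := fun e => hj (e ▸ hi)
    rw [h i j hj, Matrix.one_apply_ne hne]
  · rw [h i j hj, Matrix.one_apply_ne hji.ne']
  · rw [h j j hj, Matrix.one_apply_eq]

/-- The limit of the block determinants of a matrix with trivial rows outside `S`. -/
lemma eq_det_block_of_row {M : Matrix ι ι R} {S : Finset ι}
    (h : ∀ i ∉ S, ∀ j, M i j = (1 : Matrix ι ι R) i j) {d : R}
    (hd : Tendsto (fun T => (block T M).det) atTop (𝓝 d)) : d = (block S M).det := by
  rw [← Matrix.det_transpose (block S M), ← block_transpose]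
  refine eq_det_block_of_col (fun i j hj => ?_) (hd.congr fun T => ?_)
  · rw [Matrix.transpose_apply, h j hj, Matrix.one_apply, Matrix.one_apply]
    simp only [eq_comm]
  · rw [block_transpose, Matrix.det_transpose]

end Finite

/-! ### The strictly holomorphic part -/

section Plus

variable {A : Type u} [CommRing A] [TopologicalSpace A] [StrongPolymetricRing A]
  [SequentiallyComplete A] [T2Space A]

lemma toep_map_C_mmul {u v : ℤ → A} (hu : RapidSeq u) (hv : RapidSeq v)
    (huv : toep u ⊠ toep v = 1) : (toep u).map C ⊠ (toep v).map C = 1 := by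
  rw [← map_C_mmul hu.rowTame hv.rowTame, huv, map_C_one]

/-- Formulated for symbols u, v and a general unit x, so that it also serves for the reflected
symbols and w⁻¹. -/
lemma exists_det_plus_C {u v : ℤ → A} (hu : RapidSeq u) (hv : RapidSeq v)
    (huv : toep u ⊠ toep v = 1) (hvu : toep v ⊠ toep u = 1) {x : (RapidLaurent A)ˣ}
    (hx : PowGrowth x) :
    ∃ d, HasDet (FPlus C (x : RapidLaurent A) ⊠ (toep u).map C ⊠ FPlusInv (x : RapidLaurent A) ⊠
        (toep v).map C) d ∧
      HasDet ((toep v).map C ⊠ FPlus C (x : RapidLaurent A) ⊠ (toep u).map C) d ∧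
      HasDet (1 - (x : RapidLaurent A) •
        (toep v ⊠ oneOn A negZ ⊠ toep u ⊠ U (↑(X A)⁻¹ : RapidLaurent A)).map C) d ∧
      ∀ p q : ℕ, (∀ n : ℤ, n < -p ∨ q < n → u n = 0) →
        d = (block (Finset.Ioc (-q : ℤ) p) (1 - (x : RapidLaurent A) •
          (toep v ⊠ oneOn A negZ ⊠ toep u ⊠ U (↑(X A)⁻¹ : RapidLaurent A)).map C)).det := by
  have huv' := toep_map_C_mmul hu hv huv
  have hvu' := toep_map_C_mmul hv hu hvu
  obtain ⟨d, h1, h2, -⟩ := exists_det_plus C hu.map_C hv.map_C huv' hvu' hx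
  refine ⟨d, h1, h2, ?_, fun p q hpq => ?_⟩
  · rw [← conj_FPlus_eq hu hv hvu]
    exact h2
  · rw [← conj_FPlus_eq hu hv hvu]
    refine det_plus_eq_block C hu.map_C hv.map_C huv' hvu' hx (fun n hn => ?_) h2
    rw [hpq n hn, map_zero]

lemma hasSum_coeff_UPlus (a : RapidLaurent A) (n m : ℤ) :
    HasSum (fun j => PowerSeries.coeff j (UPlus a n m))
      ((FPlus C (X A : RapidLaurent A) ⊠ (U a).map C ⊠ FPlusInv (X A : RapidLaurent A)) n m) :=
  hasSum_coeff_FPlus_conj powGrowth_X a.rapidSeq_coeff n m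

lemma UPlus_map_evalOne (a : RapidLaurent A) : (UPlus a).map evalOne =
    FPlus C (X A : RapidLaurent A) ⊠ (U a).map C ⊠ FPlusInv (X A : RapidLaurent A) := by
  ext1 n m
  exact (hasSum_coeff_UPlus a n m).tsum_eq

end Plus

/-! ### The strictly antiholomorphic part -/

section Minus

variable {A : Type u} [CommRing A] [TopologicalSpace A] [StrongPolymetricRing A]
  [SequentiallyComplete A] [T2Space A]

/-- The reflection n ↦ -n exchanges positive and negative indices as well as z and z⁻¹; all of the
antiholomorphic case is transported along it. -/
lemma FMinus_eq_submatrix {R : Type*} [CommRing R] (f : A →+* R) (x : R) :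
    FMinus f x = (FPlus f x).submatrix (Equiv.neg ℤ) (Equiv.neg ℤ) := by
  ext n m
  have e : 0 < n ∧ m = n - 1 ↔ -n < 0 ∧ -m = -n + 1 := by omega
  simp only [Matrix.submatrix_apply, FMinus_apply, FPlus_apply, Equiv.neg_apply, neg_inj, e]

lemma FMinusInv_eq_submatrix {R : Type*} [CommRing R] (x : R) :
    FMinusInv x = (FPlusInv x).submatrix (Equiv.neg ℤ) (Equiv.neg ℤ) := by
  ext n m
  have e : -m - -n = n - m := by ring
  simp only [Matrix.submatrix_apply, FMinusInv, FPlusInv, Equiv.neg_apply, neg_inj, e,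
    neg_lt_neg_iff, neg_nonpos]

lemma toep_eq_submatrix {R : Type*} (u : ℤ → R) :
    toep u = (toep fun n => u (-n)).submatrix (Equiv.neg ℤ) (Equiv.neg ℤ) := by
  ext n m
  simp only [Matrix.submatrix_apply, toep, Equiv.neg_apply]
  congr 1
  ring

lemma toep_neg_eq_submatrix {R : Type*} (u : ℤ → R) :
    (toep fun n => u (-n)) = (toep u).submatrix (Equiv.neg ℤ) (Equiv.neg ℤ) := by
  ext n m
  simp only [Matrix.submatrix_apply, toep, Equiv.neg_apply]
  congr 1
  ring

lemma U_X_eq_submatrix : U (X A : RapidLaurent A) =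
    (U (↑(X A)⁻¹ : RapidLaurent A)).submatrix (Equiv.neg ℤ) (Equiv.neg ℤ) := by
  ext n m
  have e1 : U (X A : RapidLaurent A) n m = if n - m = 1 then 1 else 0 := rfl
  have e2 : U (↑(X A)⁻¹ : RapidLaurent A) (-n) (-m) = if -n - -m = -1 then 1 else 0 := rfl
  have e : n - m = 1 ↔ -n - -m = -1 := by omega
  simp only [Matrix.submatrix_apply, Equiv.neg_apply, e1, e2, e]

lemma toep_neg_mmul {u v : ℤ → A} (huv : toep u ⊠ toep v = 1) :
    (toep fun n => u (-n)) ⊠ (toep fun n => v (-n)) = 1 := by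
  rw [toep_neg_eq_submatrix u, toep_neg_eq_submatrix v, ← reindex_mmul, huv,
    Matrix.submatrix_one_equiv]

lemma UMinus_eq_submatrix (a : RapidLaurent A) : UMinus a =
    (FPlus (CC A) (PowerSeries.X * PowerSeries.C (↑(X A)⁻¹ : RapidLaurent A)) ⊠
      (toep fun n => a.coeff (-n)).map (CC A) ⊠
      FPlusInv (PowerSeries.X * PowerSeries.C (↑(X A)⁻¹ : RapidLaurent A))).submatrix
        (Equiv.neg ℤ) (Equiv.neg ℤ) := by
  rw [reindex_mmul, reindex_mmul, ← FMinus_eq_submatrix, ← FMinusInv_eq_submatrix,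
    Matrix.submatrix_map, ← toep_eq_submatrix]
  rfl

lemma hasSum_coeff_UMinus (a : RapidLaurent A) (n m : ℤ) :
    HasSum (fun j => PowerSeries.coeff j (UMinus a n m))
      ((FMinus C (↑(X A)⁻¹ : RapidLaurent A) ⊠ (U a).map C ⊠
        FMinusInv (↑(X A)⁻¹ : RapidLaurent A)) n m) := by
  have h := hasSum_coeff_FPlus_conj powGrowth_X.inv a.rapidSeq_coeff.comp_neg (-n) (-m)
  rw [UMinus_eq_submatrix, FMinus_eq_submatrix, FMinusInv_eq_submatrix,
    show U a = toep a.coeff from rfl, toep_eq_submatrix a.coeff, ← Matrix.submatrix_map,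
    ← reindex_mmul, ← reindex_mmul]
  exact h

lemma UMinus_map_evalOne (a : RapidLaurent A) : (UMinus a).map evalOne =
    FMinus C (↑(X A)⁻¹ : RapidLaurent A) ⊠ (U a).map C ⊠
      FMinusInv (↑(X A)⁻¹ : RapidLaurent A) := by
  ext1 n m
  exact (hasSum_coeff_UMinus a n m).tsum_eq

lemma conjPos_eq_submatrix (a : (RapidLaurent A)ˣ) : conjPos a =
    ((toep fun n => (↑a⁻¹ : RapidLaurent A).coeff (-n)) ⊠ oneOn A negZ ⊠
      (toep fun n => (a : RapidLaurent A).coeff (-n))).submatrix (Equiv.neg ℤ) (Equiv.neg ℤ) := by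
  rw [reindex_mmul, reindex_mmul, ← toep_eq_submatrix, ← toep_eq_submatrix, ← oneOn_posZ]
  rfl

lemma exists_det_minus (a : (RapidLaurent A)ˣ) :
    ∃ d, HasDet (minusMatrix a) d ∧
      HasDet ((U (↑a⁻¹ : RapidLaurent A)).map C ⊠ FMinus C (↑(X A)⁻¹ : RapidLaurent A) ⊠
        (U (a : RapidLaurent A)).map C) d ∧
      HasDet (1 - (↑(X A)⁻¹ : RapidLaurent A) •
        (conjPos a ⊠ U (X A : RapidLaurent A)).map C) d ∧
      ∀ p q : ℕ, (∀ n : ℤ, n < -p ∨ q < n → (a : RapidLaurent A).coeff n = 0) →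
        d = (1 - (↑(X A)⁻¹ : RapidLaurent A) • block (Finset.Ico (-q : ℤ) p)
          ((conjPos a ⊠ U (X A : RapidLaurent A)).map C)).det := by
  have hu := (a : RapidLaurent A).rapidSeq_coeff.comp_neg
  have hv := (↑a⁻¹ : RapidLaurent A).rapidSeq_coeff.comp_neg
  obtain ⟨d, h1, h2, h3, h4⟩ := exists_det_plus_C hu hv (toep_neg_mmul (U_inv a).1)
    (toep_neg_mmul (U_inv a).2) powGrowth_X.inv
  have eu : ∀ b : RapidLaurent A, (U b).map C =
      ((toep fun n => b.coeff (-n)).map C).submatrix (Equiv.neg ℤ) (Equiv.neg ℤ) := fun b => by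
    rw [Matrix.submatrix_map, ← toep_eq_submatrix]; rfl
  have e3 : 1 - (↑(X A)⁻¹ : RapidLaurent A) • (conjPos a ⊠ U (X A : RapidLaurent A)).map C =
      (1 - (↑(X A)⁻¹ : RapidLaurent A) • ((toep fun n => (↑a⁻¹ : RapidLaurent A).coeff (-n)) ⊠
        oneOn A negZ ⊠ (toep fun n => (a : RapidLaurent A).coeff (-n)) ⊠
        U (↑(X A)⁻¹ : RapidLaurent A)).map C).submatrix (Equiv.neg ℤ) (Equiv.neg ℤ) := by
    rw [conjPos_eq_submatrix, U_X_eq_submatrix, ← reindex_mmul, submatrix_one_sub_smul]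
    rfl
  refine ⟨d, ?_, ?_, ?_, fun p q hpq => ?_⟩
  · rw [minusMatrix, UMinus_map_evalOne, FMinus_eq_submatrix, FMinusInv_eq_submatrix, eu, eu,
      ← reindex_mmul, ← reindex_mmul, ← reindex_mmul]
    exact h1.reindex _
  · rw [FMinus_eq_submatrix, eu, eu, ← reindex_mmul, ← reindex_mmul]
    exact h2.reindex _
  · rw [e3]
    exact h3.reindex _
  · rw [← block_one_sub_smul, e3, det_block_submatrix]
    -- Reflection of the symbol exchanges p and q, and reflection of the window exchanges its open
    -- and its closed end.
    have hS : (Finset.Ico (-q : ℤ) p).map (Equiv.neg ℤ).toEmbedding = Finset.Ioc (-p : ℤ) q := by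
      ext n
      simp only [Finset.mem_map_equiv, Equiv.neg_symm, Equiv.neg_apply, Finset.mem_Ico,
        Finset.mem_Ioc]
      omega
    rw [hS]
    exact h4 q p fun n hn => hpq _ (by omega)

lemma conjPos_apply_eq (a : (RapidLaurent A)ˣ) {p q : ℕ}
    (hpq : ∀ n : ℤ, n < -p ∨ q < n → (a : RapidLaurent A).coeff n = 0) (n m : ℤ)
    (hm : m ∉ Finset.Ioc (-q : ℤ) p) : conjPos a n m = oneOn A posZ n m := by
  rw [conjPos_eq_submatrix, oneOn_posZ]
  refine conjNeg_apply_eq (a : RapidLaurent A).rapidSeq_coeff.comp_neg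
    (↑a⁻¹ : RapidLaurent A).rapidSeq_coeff.comp_neg (toep_neg_mmul (U_inv a).2) (p := q) (q := p)
    (fun k hk => hpq _ (by omega)) (-n) (-m) ?_
  simp only [Finset.mem_Ico, Finset.mem_Ioc] at hm ⊢
  omega

end Minus

/-! ### Half-integers -/

section HalfIntegers

/-- The bijection of the half-integers with the integers that subtracts `1/2`. -/
def HalfInt.floorEquiv : HalfInt ≃ ℤ where
  toFun := HalfInt.floor
  invFun := HalfInt.mk
  left_inv _ := rfl
  right_inv _ := rfl

lemma HalfInt.toRat_neg_iff (s : HalfInt) : s.toRat < 0 ↔ s.floor < 0 := by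
  have h : 2 * s.toRat = ((2 * s.floor + 1 : ℤ) : ℚ) := by
    unfold HalfInt.toRat
    push_cast
    ring
  have h1 : s.toRat < 0 ↔ 2 * s.toRat < 0 := by constructor <;> intro h <;> linarith
  rw [h1, h, Int.cast_lt_zero]
  omega

lemma HalfInt.toRat_pos_iff (s : HalfInt) : 0 < s.toRat ↔ ¬ s.floor < 0 := by
  have h : 2 * s.toRat = ((2 * s.floor + 1 : ℤ) : ℚ) := by
    unfold HalfInt.toRat
    push_cast
    ring
  have h1 : 0 < s.toRat ↔ 0 < 2 * s.toRat := by constructor <;> intro h <;> linarith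
  rw [h1, h, Int.cast_pos]
  omega

lemma HalfInt.map_between (m n : ℤ) :
    (HalfInt.between m n).map HalfInt.floorEquiv.toEmbedding = Finset.Ico m n := by
  ext k
  simp [HalfInt.between, HalfInt.floorEquiv]

lemma oneOn_negH (R : Type*) [Semiring R] :
    oneOn R negH = (oneOn R negZ).submatrix HalfInt.floorEquiv HalfInt.floorEquiv := by
  ext s t
  by_cases h : s.floor = t.floor <;> by_cases h1 : s.floor < 0 <;>
    simp [oneOn, negH, negZ, HalfInt.toRat_neg_iff, HalfInt.floorEquiv, HalfInt.ext_iff, h, h1]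

variable {A : Type u} [CommRing A] [TopologicalSpace A] [StrongPolymetricRing A]
  [SequentiallyComplete A] [T2Space A]

lemma DH_eq_submatrix (w : (RapidLaurent A)ˣ) :
    DH w = (signDiag (w : RapidLaurent A)).submatrix HalfInt.floorEquiv HalfInt.floorEquiv := by
  ext1 s t
  obtain ⟨k⟩ := s
  obtain ⟨l⟩ := t
  by_cases h : k = l
  · subst h
    by_cases h1 : k < 0
    · simp [DH, signDiag, oneOn, negH, posH, HalfInt.toRat_neg_iff, HalfInt.toRat_pos_iff,
        HalfInt.floorEquiv, h1]
    · simp [DH, signDiag, oneOn, negH, posH, HalfInt.toRat_neg_iff, HalfInt.toRat_pos_iff,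
        HalfInt.floorEquiv, h1, not_lt.1 h1]
  · simp [DH, signDiag, oneOn, HalfInt.floorEquiv, h]

lemma commMatrix_eq_submatrix (a w : (RapidLaurent A)ˣ) : commMatrix a w =
    (commMatrixInt a w).submatrix HalfInt.floorEquiv HalfInt.floorEquiv := by
  rw [commMatrix, DH_eq_submatrix, DH_eq_submatrix, commMatrixInt, reindex_mmul, reindex_mmul,
    reindex_mmul]
  rfl

lemma conjNegH_eq_submatrix (a : (RapidLaurent A)ˣ) : conjNegH a =
    (conjNeg a).submatrix HalfInt.floorEquiv HalfInt.floorEquiv := by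
  rw [conjNegH, oneOn_negH, conjNeg, reindex_mmul, reindex_mmul]
  rfl

end HalfIntegers

/-! ### The orthogonal part of Laurent polynomials -/

section FiniteTilde

variable {A : Type u} [CommRing A] [TopologicalSpace A] [StrongPolymetricRing A]
  [SequentiallyComplete A] [T2Space A]

/-- In a row n > q or n < -p, the coefficients in column 0 and in the columns of the opposite sign
vanish for both matrices, so U(a) and Ũ(a, 1) have the same row. -/
lemma tildeMatrix_one_apply_eq (a : (RapidLaurent A)ˣ) {p q : ℕ}
    (hpq : ∀ n : ℤ, n < -p ∨ q < n → (a : RapidLaurent A).coeff n = 0) {n : ℤ}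
    (hn : n ∉ Finset.Icc (-p : ℤ) q) (m : ℤ) :
    tildeMatrix a 1 n m = (1 : Matrix ℤ ℤ (RapidLaurent A)) n m := by
  rw [Finset.mem_Icc] at hn
  have hrow : ∀ k, (U (a : RapidLaurent A)).map C n k = UTilde (a : RapidLaurent A) 1 n k := by
    intro k
    simp only [Matrix.map_apply, U, UTilde, Units.val_one, inv_one, one_mul]
    split_ifs with h1 h2 h3 h4
    · omega
    · rw [hpq _ (by omega), map_zero]
    · rw [hpq _ (by omega), hpq _ (by omega), map_zero, neg_zero]
    · rw [hpq _ (by omega), hpq _ (by omega), map_zero, neg_zero]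
    · rfl
  rw [← (UTilde_inv a 1).1, tildeMatrix, mmul, mmul]
  exact tsum_congr fun k => by rw [hrow]

/-- The inner diagonal matrix is 1 - (1 - w⁻¹) times the cutoff to the negative indices, and the
outer one multiplies the columns. -/
lemma commMatrixInt_apply (a w : (RapidLaurent A)ˣ) (n m : ℤ) :
    commMatrixInt a w n m =
      (1 - (1 - (↑w⁻¹ : RapidLaurent A)) • (conjNeg a).map C : Matrix ℤ ℤ (RapidLaurent A)) n m *
        (if m < 0 then (w : RapidLaurent A) else 1) := by
  have hu := (a : RapidLaurent A).rapidSeq_coeff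
  have hv := (↑a⁻¹ : RapidLaurent A).rapidSeq_coeff
  rw [commMatrixInt, signDiag, signDiag, mmul_diagonal_apply, mmul_diagonal_mmul_apply]
  congr 1
  have h1 := (hv.map_C.rowTame.summable hu.map_C.rowTame n m).hasSum
  have e : ∑' k, toep (fun n => C ((↑a⁻¹ : RapidLaurent A).coeff n)) n k *
      toep (fun n => C ((a : RapidLaurent A).coeff n)) k m =
        (1 : Matrix ℤ ℤ (RapidLaurent A)) n m :=
    congrFun₂ (toep_map_C_mmul hv hu (U_inv a).2) n m
  rw [e] at h1
  have h2 := ((hasSum_conjNeg hu hv n m).map (C : A →+* RapidLaurent A) continuous_C).mul_left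
    (1 - (↑w⁻¹ : RapidLaurent A))
  refine (tsum_congr fun k => ?_).trans (h1.sub h2).tsum_eq
  simp only [Function.comp_apply, Matrix.map_apply, U, toep, map_mul]
  split_ifs
  · rw [map_one]; ring
  · rw [map_zero]; ring

lemma commMatrixInt_apply_eq (a w : (RapidLaurent A)ˣ) {p q : ℕ}
    (hpq : ∀ n : ℤ, n < -p ∨ q < n → (a : RapidLaurent A).coeff n = 0) (n : ℤ) {m : ℤ}
    (hm : m ∉ Finset.Ico (-q : ℤ) p) :
    commMatrixInt a w n m = (1 : Matrix ℤ ℤ (RapidLaurent A)) n m := by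
  have h : conjNeg a n m = oneOn A negZ n m :=
    conjNeg_apply_eq (a : RapidLaurent A).rapidSeq_coeff (↑a⁻¹ : RapidLaurent A).rapidSeq_coeff
      (U_inv a).2 hpq n m hm
  rw [commMatrixInt_apply, Matrix.sub_apply, Matrix.smul_apply, Matrix.map_apply, h, oneOn_negZ,
    Matrix.diagonal_apply, Matrix.one_apply, smul_eq_mul]
  have hw : (↑w⁻¹ : RapidLaurent A) * w = 1 := w.inv_mul
  by_cases h1 : n = m
  · subst h1
    by_cases h2 : n < 0
    · simp only [h2, if_true, map_one]
      linear_combination hw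
    · simp [h2]
  · simp [h1]

lemma det_block_commMatrixInt (a w : (RapidLaurent A)ˣ) (p q : ℕ) :
    (block (Finset.Ico (-q : ℤ) p) (commMatrixInt a w)).det =
      (w : RapidLaurent A) ^ q * (block (Finset.Ico (-q : ℤ) p)
        (1 - (1 - (↑w⁻¹ : RapidLaurent A)) • (conjNeg a).map C)).det := by
  set S := Finset.Ico (-q : ℤ) p
  have h : block S (commMatrixInt a w) =
      block S (1 - (1 - (↑w⁻¹ : RapidLaurent A)) • (conjNeg a).map C) *
        Matrix.diagonal fun m : S => if m.1 < 0 then (w : RapidLaurent A) else 1 := by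
    ext1 i j
    rw [Matrix.mul_diagonal]
    exact commMatrixInt_apply a w i j
  rw [h, Matrix.det_mul, Matrix.det_diagonal, mul_comm]
  congr 1
  rw [Finset.prod_coe_sort S fun m => if m < 0 then (w : RapidLaurent A) else 1,
    Finset.prod_ite, Finset.prod_const_one, mul_one, Finset.prod_const]
  -- The power of w counts the negative indices of the window, of which there are q.
  have hS : S.filter (· < 0) = Finset.Ico (-q : ℤ) 0 := by
    ext n
    simp only [S, Finset.mem_filter, Finset.mem_Ico]
    omega
  rw [hS, Int.card_Ico]
  simp

lemma det_block_commMatrixInt_eq (a w : (RapidLaurent A)ˣ) (p q : ℕ) :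
    (block (Finset.Ico (-q : ℤ) p) (commMatrixInt a w)).det =
      (w : RapidLaurent A) ^ q * (1 - (1 - (↑w⁻¹ : RapidLaurent A)) •
        block (HalfInt.between (-q) p) ((conjNegH a).map C)).det := by
  rw [det_block_commMatrixInt, ← HalfInt.map_between, ← det_block_submatrix,
    submatrix_one_sub_smul, block_one_sub_smul, conjNegH_eq_submatrix]
  rfl

end FiniteTilde

end WienerHopf

end

/-! ### The proposition. -/

open WienerHopf in
theorem mainTheorem2 {A : Type*} [CommRing A] [TopologicalSpace A] [T2Space A]
    [StrongPolymetricRing A] [SequentiallyComplete A] (a : (RapidLaurent A)ˣ) :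
    -- the substitution `t = 1` in `U⁺(a, t, w)` and `U⁻(a, t, w)` converges
    (∀ n m, Summable fun j => PowerSeries.coeff j (UPlus (a : RapidLaurent A) n m)) ∧
    (∀ n m, Summable fun j => PowerSeries.coeff j (UMinus (a : RapidLaurent A) n m)) ∧
    -- `π⁺`
    HasDet (plusMatrix a) (piPlus a) ∧
    HasDet ((U (↑a⁻¹ : RapidLaurent A)).map RapidLaurent.C ⊠
      FPlus RapidLaurent.C (RapidLaurent.X A : RapidLaurent A) ⊠
      (U (a : RapidLaurent A)).map RapidLaurent.C) (piPlus a) ∧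
    HasDet (1 - (RapidLaurent.X A : RapidLaurent A) •
      (conjNeg a ⊠ U (↑(RapidLaurent.X A)⁻¹ : RapidLaurent A)).map RapidLaurent.C) (piPlus a) ∧
    -- `π⁻`
    HasDet (minusMatrix a) (piMinus a) ∧
    HasDet ((U (↑a⁻¹ : RapidLaurent A)).map RapidLaurent.C ⊠
      FMinus RapidLaurent.C (↑(RapidLaurent.X A)⁻¹ : RapidLaurent A) ⊠
      (U (a : RapidLaurent A)).map RapidLaurent.C) (piMinus a) ∧
    HasDet (1 - (↑(RapidLaurent.X A)⁻¹ : RapidLaurent A) •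
      (conjPos a ⊠ U (RapidLaurent.X A : RapidLaurent A)).map RapidLaurent.C) (piMinus a) ∧
    -- `π̃`
    HasDet (tildeMatrix a (RapidLaurent.X A)) (piTilde a) ∧
    (∃ d₁ d₂ : RapidLaurent A, HasDet (tildeMatrix a 1) d₁ ∧
      HasDet (commMatrix a (RapidLaurent.X A)) d₂ ∧ piTilde a = d₁ * d₂) ∧
    -- reduction to finite determinants for Laurent polynomials
    (∀ p q : ℕ, (∀ n : ℤ, n < -p ∨ q < n → (a : RapidLaurent A).coeff n = 0) →
      (∀ n m : ℤ, m ∉ Finset.Ico (-q : ℤ) p → conjNeg a n m = oneOn A negZ n m) ∧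
      (∀ n m : ℤ, m ∉ Finset.Ioc (-q : ℤ) p → conjPos a n m = oneOn A posZ n m) ∧
      piPlus a = (1 - (RapidLaurent.X A : RapidLaurent A) •
        block (Finset.Ioc (-q : ℤ) p)
          ((conjNeg a ⊠ U (↑(RapidLaurent.X A)⁻¹ : RapidLaurent A)).map RapidLaurent.C)).det ∧
      piMinus a = (1 - (↑(RapidLaurent.X A)⁻¹ : RapidLaurent A) •
        block (Finset.Ico (-q : ℤ) p)
          ((conjPos a ⊠ U (RapidLaurent.X A : RapidLaurent A)).map RapidLaurent.C)).det ∧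
      HasDet (tildeMatrix a 1) (block (Finset.Icc (-p : ℤ) q) (tildeMatrix a 1)).det ∧
      HasDet (commMatrix a (RapidLaurent.X A))
        ((RapidLaurent.X A : RapidLaurent A) ^ q *
          (1 - (1 - (↑(RapidLaurent.X A)⁻¹ : RapidLaurent A)) •
            block (HalfInt.between (-q) p) ((conjNegH a).map RapidLaurent.C)).det)) := by
  have hu := (a : RapidLaurent A).rapidSeq_coeff
  have hv := (↑a⁻¹ : RapidLaurent A).rapidSeq_coeff
  obtain ⟨d, h1, h2, h3, h4⟩ := exists_det_plus_C hu hv (U_inv a).1 (U_inv a).2 powGrowth_X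
  have hd : HasDet (plusMatrix a) d := by
    rw [plusMatrix, UPlus_map_evalOne]
    exact h1
  have hpi : piPlus a = d := hd.idet_eq
  obtain ⟨e, m1, m2, m3, m4⟩ := exists_det_minus a
  have hpim : piMinus a = e := m1.idet_eq
  obtain ⟨d₁, d₂, t1, t2, t3, t4, t5⟩ := tilde_factorization a (RapidLaurent.X A)
  have hpit : piTilde a = d₁ * d₂ := t5.idet_eq
  have hcomm : HasDet (commMatrix a (RapidLaurent.X A)) d₂ := by
    rw [commMatrix_eq_submatrix]
    exact t3.reindex _
  rw [hpi, hpim, hpit]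
  refine ⟨fun n m => (hasSum_coeff_UPlus _ n m).summable,
    fun n m => (hasSum_coeff_UMinus _ n m).summable, hd, h2, h3, m1, m2, m3, t5,
    ⟨d₁, d₂, t1, hcomm, rfl⟩, fun p q hpq => ⟨?_, ?_, ?_, m4 p q hpq, ?_, ?_⟩⟩
  · exact conjNeg_apply_eq hu hv (U_inv a).2 hpq
  · exact conjPos_apply_eq a hpq
  · rw [← block_one_sub_smul]
    exact h4 p q hpq
  -- Outside its window the first factor has trivial rows and the second trivial columns; in either
  -- case the block determinants are eventually constant.
  · rw [← eq_det_block_of_row (fun n hn m => tildeMatrix_one_apply_eq a hpq hn m) t2]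
    exact t1
  · rw [← det_block_commMatrixInt_eq,
      ← eq_det_block_of_col (fun n m hm => commMatrixInt_apply_eq a _ hpq n hm) t4]
    exact hcomm
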